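/- Let $J\subset\mathbb R$ be an unbounded open interval (for instance $(0,\infty)$ or $\mathbb R$) and let $\Sigma=J\times S^2$ be the 3-cylinder, foliated by the spheres $S_u=\{u\}\times S^2$, with a smooth Riemannian metric of the form $\overline g=a^2\,du^2+\gamma_u$, where the lapse $a>0$ is a smooth function on $\Sigma$ and $\gamma_u$ is a smooth Riemannian metric on $S_u$ depending smoothly on $u$. Let $r=r(u)$ be the area radius, $\mathrm{Area}(S_u)=4\pi r(u)^2$ (constant if $\Sigma=\Sigma_r$ is a level set of the area radius), let $\operatorname{tr}\theta_{S}$ be the mean curvature of $S_u$ in $\Sigma$ (the trace of its second fundamental form with respect to the unit normal $X=a^{-1}\partial_u$), and let $$I(u)=\sup_{U\subset S_u}\frac{\min\{\mathrm{Area}(U),\mathrm{Area}(S_u\setminus U)\}}{\mathrm{Per}(U)^2}$$ be the isoperimetric constant of $S_u$, where $U$ ranges over the measurable subsets of $S_u$ and $\mathrm{Per}(U)$ is the perimeter (the length of $\partial U$ if $U$ has $C^1$ boundary). Assume $$a_m=\inf_\Sigma a>0,\qquad a_M=\sup_\Sigma a<\infty,\qquad I=\sup_u I(u)<\infty,\qquad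 h=\sup_\Sigma|r\operatorname{tr}\theta_S|<\infty .$$ Then for every $k\ge 0$ and every continuously differentiable covariant $k$-tensor field $\theta$ on $\Sigma$ tangent to the spheres $S_u$, $$\Bigl(\int_{\Sigma} r^6|\theta|^6\Bigr)^{1/6}\le C\Bigl(\int_{\Sigma}|\theta|^2+r^2|\overline\nabla\theta|^2\Bigr)^{1/2},\qquad \sup_{u\in J}\Bigl(\int_{S_u} r^4|\theta|^4\Bigr)^{1/4}\le C\Bigl(\int_{\Sigma}|\theta|^2+r^2|\overline\nabla\theta|^2\Bigr)^{1/2},$$ where $\overline\nabla$ is the Levi-Civita connection of $(\Sigma,\overline g)$, the integrals are taken with respect to the Riemannian volume and area and may be infinite, and the constant $C$ depends only on upper bounds for $a_M/a_m$, $I$ and $h$. -/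

import Mathlib

open MeasureTheory
open scoped ENNReal NNReal Manifold ContDiff

noncomputable section

namespace FoliatedSobolev

/-- Euclidean plane and Euclidean space. -/
abbrev E2 := EuclideanSpace ℝ (Fin 2)
abbrev E3 := EuclideanSpace ℝ (Fin 3)

instance factFinrankE3 : Fact (Module.finrank ℝ E3 = 2 + 1) := ⟨by simp⟩

/-- The unit sphere `S²` in Euclidean 3-space, with Mathlib's smooth structure.
The tangent space at `x` is identified with the vectors `v` of `E3` orthogonal to `x`. -/
abbrev S2 := Metric.sphere (0 : E3) 1

/-- `v` is tangent to `S²` at `x`. -/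
def IsTangent (x : S2) (v : E3) : Prop := inner ℝ (x : E3) v = 0

/-! ### Foliated cylinders -/

/-- A Riemannian 3-cylinder foliated by spheres, in canonical form: `Σ = J × S²` with an
unbounded open interval `J` (for instance `(0, ∞)` or `ℝ`), the leaves `S_u = {u} × S²`, and
the metric `a² du² + γ_u`, where the lapse `a` is a smooth positive function on `Σ` and `γ_u` is
a smooth Riemannian metric on `S²` that depends smoothly on `u`.
The bilinear form `γ u x` is only ever evaluated on tangent vectors, so its values on vectors
normal to `S²` (and everything outside `J`) carry no information; each smooth family of metrics
on `S²` is of this form, for example extended by `0` to the normal direction. -/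
structure FoliatedCylinder where
  /-- range of the foliation function `u` -/
  J : Set ℝ
  isOpen_J : IsOpen J
  ordConnected_J : J.OrdConnected
  unbounded_J : ¬ Bornology.IsBounded J
  /-- the lapse -/
  a : ℝ → S2 → ℝ
  a_smooth : ContMDiffOn (𝓘(ℝ, ℝ).prod (𝓡 2)) 𝓘(ℝ, ℝ) ∞
    (fun p : ℝ × S2 => a p.1 p.2) (J ×ˢ Set.univ)
  a_pos : ∀ u ∈ J, ∀ x, 0 < a u x
  /-- the metrics of the leaves -/
  γ : ℝ → S2 → E3 →L[ℝ] E3 →L[ℝ] ℝ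
  γ_smooth : ContMDiffOn (𝓘(ℝ, ℝ).prod (𝓡 2)) 𝓘(ℝ, E3 →L[ℝ] E3 →L[ℝ] ℝ) ∞
    (fun p : ℝ × S2 => γ p.1 p.2) (J ×ˢ Set.univ)
  γ_symm : ∀ u ∈ J, ∀ x, ∀ v w, IsTangent x v → IsTangent x w → γ u x v w = γ u x w v
  γ_pos : ∀ u ∈ J, ∀ x, ∀ v, IsTangent x v → v ≠ 0 → 0 < γ u x v v

/-! ### Stereographic coordinates

Stereographic projection from the north pole gives coordinates `y ∈ ℝ²` on `S²` minus a point,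
hence `(u, y)` are coordinates on `Σ` minus a curve. The point and the curve are null sets, so
all integrals over `S_u` and `Σ` may be computed in these coordinates. -/

/-- Inverse stereographic projection, as a map into `E3`. -/
def stereo (y : E2) : E3 :=
  (1 + ‖y‖ ^ 2)⁻¹ • !₂[2 * y 0, 2 * y 1, ‖y‖ ^ 2 - 1]

theorem stereo_mem (y : E2) : stereo y ∈ Metric.sphere (0 : E3) 1 := by
  have h : ‖y‖ ^ 2 = y 0 ^ 2 + y 1 ^ 2 := by
    rw [EuclideanSpace.norm_sq_eq]; simp [Fin.sum_univ_two]
  have hp : (0 : ℝ) < 1 + ‖y‖ ^ 2 := by positivity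
  have h2 : ‖stereo y‖ ^ 2 = 1 := by
    rw [stereo, EuclideanSpace.norm_sq_eq, Fin.sum_univ_three]
    simp only [PiLp.smul_apply, smul_eq_mul, Real.norm_eq_abs, sq_abs]
    simp only [Matrix.cons_val_zero, Matrix.cons_val_one, Matrix.cons_val]
    field_simp
    rw [h]; ring
  rw [mem_sphere_zero_iff_norm]
  nlinarith [norm_nonneg (stereo y)]

/-- Inverse stereographic projection, as a map into `S²`. -/
def stereoS (y : E2) : S2 := ⟨stereo y, stereo_mem y⟩

/-- The coordinate space of `Σ`, with points `(u, y)`. -/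
abbrev Coord := ℝ × E2

/-- The coordinate directions: `0` stands for `u`, and `1`, `2` for `y`. -/
def dir : Fin 3 → Coord :=
  Fin.cons (1, 0) fun A : Fin 2 => (0, EuclideanSpace.single A 1)

/-- Partial derivative of a function on the coordinate space. -/
def pd (i : Fin 3) (f : Coord → ℝ) (p : Coord) : ℝ := fderiv ℝ f p (dir i)

/-- The part tangent to the leaf of the coordinate vector field with index `i`, as a vector of
`E3`: zero for `i = 0`, and the partial derivative of `stereo` for `i = 1, 2`. -/
def frame (i : Fin 3) (y : E2) : E3 := fderiv ℝ stereo y (dir i).2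

/-! ### Riemannian geometry in three coordinates -/

/-- Christoffel symbols `Γ^k_{ij}` of the Levi-Civita connection of the metric `g`. -/
def christoffel (g : Coord → Matrix (Fin 3) (Fin 3) ℝ) (k i j : Fin 3) (p : Coord) : ℝ :=
  (1 / 2) * ∑ l, (g p)⁻¹ k l *
    (pd i (fun q => g q j l) p + pd j (fun q => g q i l) p - pd l (fun q => g q i j) p)

/-- Covariant derivative `(∇_i X)^k` of a vector field. -/
def covDerivVec (g : Coord → Matrix (Fin 3) (Fin 3) ℝ) (X : Fin 3 → Coord → ℝ)
    (i k : Fin 3) (p : Coord) : ℝ :=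
  pd i (X k) p + ∑ l, christoffel g k i l p * X l p

/-- Covariant derivative of a covariant `k`-tensor with components `T I`; the result is a
covariant `(k+1)`-tensor, with the index of differentiation in the first place. -/
def covDeriv (g : Coord → Matrix (Fin 3) (Fin 3) ℝ) {k : ℕ}
    (T : (Fin k → Fin 3) → Coord → ℝ) (I : Fin (k + 1) → Fin 3) (p : Coord) : ℝ :=
  pd (I 0) (T (Fin.tail I)) p -
    ∑ j : Fin k, ∑ m, christoffel g m (I 0) (I j.succ) p *
      T (Function.update (Fin.tail I) j m) p

/-- Pointwise norm `|T|` of a covariant `k`-tensor: the root of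
`g^{i₁ j₁} ⋯ g^{iₖ jₖ} T_{i₁ … iₖ} T_{j₁ … jₖ}`. -/
def tensorNorm (g : Coord → Matrix (Fin 3) (Fin 3) ℝ) {k : ℕ}
    (T : (Fin k → Fin 3) → Coord → ℝ) (p : Coord) : ℝ :=
  Real.sqrt (∑ I : Fin k → Fin 3, ∑ K : Fin k → Fin 3,
    (∏ j, (g p)⁻¹ (I j) (K j)) * T I p * T K p)

namespace FoliatedCylinder

variable (M : FoliatedCylinder)

/-- The metric `a² du² + γ_u` of `Σ` in coordinates. -/
def metric (p : Coord) : Matrix (Fin 3) (Fin 3) ℝ :=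
  Matrix.of fun i j => M.γ p.1 (stereoS p.2) (frame i p.2) (frame j p.2) +
    if i = 0 ∧ j = 0 then M.a p.1 (stereoS p.2) ^ 2 else 0

/-- The metric of the leaf `S_u` in coordinates. -/
def leafMetric (u : ℝ) (y : E2) : Matrix (Fin 2) (Fin 2) ℝ :=
  (M.metric (u, y)).submatrix Fin.succ Fin.succ

/-- Density of the volume of `Σ`. -/
def volDensity (p : Coord) : ℝ := Real.sqrt (M.metric p).det

/-- Density of the area of `S_u`. -/
def areaDensity (u : ℝ) (y : E2) : ℝ := Real.sqrt (M.leafMetric u y).det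

/-- Integral over `Σ` of a function `f ≥ 0`. -/
def integralSigma (f : Coord → ℝ) : ℝ≥0∞ :=
  ∫⁻ p in M.J ×ˢ (Set.univ : Set E2), ENNReal.ofReal (f p * M.volDensity p)

/-- Integral over `S_u` of a function `f ≥ 0`. -/
def integralLeaf (u : ℝ) (f : Coord → ℝ) : ℝ≥0∞ :=
  ∫⁻ y : E2, ENNReal.ofReal (f (u, y) * M.areaDensity u y)

/-- Area of a subset of `S_u`. -/
def area (u : ℝ) (U : Set S2) : ℝ≥0∞ :=
  ∫⁻ y in stereoS ⁻¹' U, ENNReal.ofReal (M.areaDensity u y)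

/-- Area radius `r` of the leaf `S_u`, so that `S_u` has area `4πr²`. -/
def areaRadius (u : ℝ) : ℝ := Real.sqrt ((M.area u Set.univ).toReal / (4 * Real.pi))

/-! ### The isoperimetric constant of a leaf -/

/-- Contravariant components `Y^A` in coordinates of a vector field `Y` tangent to `S_u`. -/
def vecComp (u : ℝ) (Y : S2 → E3) (A : Fin 2) (y : E2) : ℝ :=
  ∑ B : Fin 2, (M.leafMetric u y)⁻¹ A B * M.γ u (stereoS y) (Y (stereoS y)) (frame B.succ y)

/-- The density `div Y dμ = ∂_A (√(det γ) Y^A) dy` of the divergence of a vector field on `S_u`. -/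
def divDensity (u : ℝ) (Y : S2 → E3) (y : E2) : ℝ :=
  ∑ A : Fin 2, fderiv ℝ (fun z => M.areaDensity u z * M.vecComp u Y A z) y
    (EuclideanSpace.single A 1)

/-- `Y` is a smooth tangent vector field on `S_u` with `|Y| ≤ 1`. -/
def IsTestField (u : ℝ) (Y : S2 → E3) : Prop :=
  ContMDiff (𝓡 2) 𝓘(ℝ, E3) ∞ Y ∧ (∀ x, IsTangent x (Y x)) ∧ ∀ x, M.γ u x (Y x) (Y x) ≤ 1

/-- Perimeter in `S_u` of a set `U` (De Giorgi): the supremum of `∫_U div Y` over the test fields.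
This is the length of the boundary curve if `U` has a `C¹` boundary. -/
def perimeter (u : ℝ) (U : Set S2) : ℝ≥0∞ :=
  ⨆ (Y : S2 → E3) (_ : M.IsTestField u Y),
    ENNReal.ofReal (∫ y in stereoS ⁻¹' U, M.divDensity u Y y)

/-- Isoperimetric constant of `S_u`: the supremum of
`min (|U|, |S_u \ U|) / (perimeter of U)²`. (In the extended nonnegative reals, `0 / 0 = 0`.) -/
def isoConst (u : ℝ) : ℝ≥0∞ :=
  ⨆ (U : Set S2) (_ : MeasurableSet U), min (M.area u U) (M.area u Uᶜ) / M.perimeter u U ^ 2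

/-! ### The second fundamental form of the leaves -/

/-- Components of the unit normal `X = a⁻¹ ∂_u` of the leaves. -/
def unitNormal (k : Fin 3) (p : Coord) : ℝ :=
  if k = 0 then (M.a p.1 (stereoS p.2))⁻¹ else 0

/-- Second fundamental form `⟨∇_A X, ∂_B⟩` of the leaves in `Σ`. -/
def secondForm (p : Coord) : Matrix (Fin 2) (Fin 2) ℝ :=
  Matrix.of fun A B =>
    ∑ k, M.metric p k B.succ * covDerivVec M.metric M.unitNormal A.succ k p

/-- Mean curvature of the leaves: the trace of the second fundamental form. -/
def meanCurvature (p : Coord) : ℝ :=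
  ∑ A, ∑ B, (M.leafMetric p.1 p.2)⁻¹ A B * M.secondForm p A B

end FoliatedCylinder

/-! ### Tensor fields tangent to the leaves

A covariant `k`-tensor field tangent to the leaves assigns to each `(u, x)` a `k`-linear form on
the tangent space of `S²` at `x`. As for the metric, we let the form be defined on all of `E3`,
and only use its values on tangent vectors. -/

/-- A covariant `k`-tensor field on the leaves. -/
abbrev LeafTensor (k : ℕ) := ℝ → S2 → E3 [×k]→L[ℝ] ℝ

/-- The tensor field is continuously differentiable on `Σ`. -/
def LeafTensor.IsC1 {k : ℕ} (M : FoliatedCylinder) (θ : LeafTensor k) : Prop :=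
  ContMDiffOn (𝓘(ℝ, ℝ).prod (𝓡 2)) 𝓘(ℝ, E3 [×k]→L[ℝ] ℝ) 1
    (fun p : ℝ × S2 => θ p.1 p.2) (M.J ×ˢ Set.univ)

/-- Components of the tensor field as a tensor field on `Σ`; a component vanishes if one of its
indices is the index `0` of `u`, because `frame 0 = 0`. -/
def LeafTensor.comp {k : ℕ} (θ : LeafTensor k) (I : Fin k → Fin 3) (p : Coord) : ℝ :=
  θ p.1 (stereoS p.2) fun j => frame (I j) p.2

/-- `|θ|` -/
def LeafTensor.norm {k : ℕ} (M : FoliatedCylinder) (θ : LeafTensor k) (p : Coord) : ℝ :=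
  tensorNorm M.metric θ.comp p

/-- `|∇θ|`, for the Levi-Civita connection of `Σ`. -/
def LeafTensor.normDeriv {k : ℕ} (M : FoliatedCylinder) (θ : LeafTensor k) (p : Coord) : ℝ :=
  tensorNorm M.metric (covDeriv M.metric θ.comp) p

/-- `∫_Σ |θ|² + r² |∇θ|²` -/
def LeafTensor.energy {k : ℕ} (M : FoliatedCylinder) (θ : LeafTensor k) : ℝ≥0∞ :=
  M.integralSigma fun p => θ.norm M p ^ 2 + M.areaRadius p.1 ^ 2 * θ.normDeriv M p ^ 2

end FoliatedSobolev

end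

noncomputable section

namespace FoliatedSobolev

/-! Write `F = |θ|`, `φ(u) = ∫_{S_u} r⁴ F⁴` and `e(u) = ∫_{S_u} F² + r² |∇θ|²`. Since the volume of
`Σ` is `a du` times the area of the leaves, `∫ e du` is the energy up to the bounds of the lapse,
and everything reduces to a bound of `φ` by the square of `∫ e du`.

Only two facts about `θ` are needed: `w = |θ|²` is `C¹`, and Kato's inequality `|d|θ|²| ≤ 2 |θ|
|∇θ|`, which follows from metric compatibility (`pd_contract`, `contract_pd_le`). They are
abstracted into `Controlled M w N`, a class that is stable under truncation of `w`.

On one leaf, the isoperimetric inequality for superlevel sets and one half of the coarea formula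
give `‖f‖_{L²} ≲ ‖∇f‖_{L¹} + r⁻¹ ‖f‖_{L¹}` (`leaf_sobolev`). Stereographic coordinates miss a point
of the leaf, which cut-off functions show to be negligible. With `f = F²` this yields `φ ≲ r² e²`,
and with `f = F³` it yields `∫ r⁶ F⁶ ≲ φ e` (`leafFour_le`, `leafSix_le`).

In the direction of `u`, the area element grows at the rate `a tr θ_S` (`pd_areaDensity`), hence
`|r'| ≤ a_M h / 2`, and `|φ'| ≤ a_M (3h + 4) ∫ r³ F³ (F + r |∇θ|) ≲ a_M √φ e` by Cauchy–Schwarz and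
the `L⁶` bound. So `√φ` varies by at most a multiple of `a_M ∫ e du`.

It remains to find leaves where `φ` is arbitrarily small. If `φ ≥ δ²` everywhere, then `e ≳ δ / r`;
but `r` grows at most linearly and `J` is unbounded, so `∫ e du` would diverge logarithmically
(`exists_leafFour_le`). This bounds `sup φ`, and integration of `∫ r⁶ F⁶ ≲ φ e` over `u` gives the
`L⁶` inequality. The lapse enters only through `a_M / a_m`, one factor from the volume or the rate
of change and the other from the energy. -/

/-! ### Inverse stereographic projection -/

theorem contDiff_stereo : ContDiff ℝ ∞ stereo := by
  have hs : ContDiff ℝ ∞ fun y : E2 => (1 + ‖y‖ ^ 2)⁻¹ :=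
    (contDiff_const.add (contDiff_norm_sq ℝ)).inv fun y => by positivity
  have hc (i : Fin 2) : ContDiff ℝ ∞ fun y : E2 => y i := by fun_prop
  refine hs.smul (contDiff_euclidean.2 fun i => ?_)
  fin_cases i
  · exact contDiff_const.mul (hc 0)
  · exact contDiff_const.mul (hc 1)
  · exact (contDiff_norm_sq ℝ).sub contDiff_const

theorem differentiable_stereo : Differentiable ℝ stereo :=
  contDiff_stereo.differentiable (by simp)

theorem stereo_apply (y : E2) :
    stereo y = !₂[2 * y 0 * (1 + ‖y‖ ^ 2)⁻¹, 2 * y 1 * (1 + ‖y‖ ^ 2)⁻¹,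
      1 - 2 * (1 + ‖y‖ ^ 2)⁻¹] := by
  have hp : (1 + ‖y‖ ^ 2) ≠ 0 := by positivity
  ext i
  fin_cases i <;> (simp [stereo]; field_simp; try ring)

/-- Stereographic projection is conformal with factor `2 / (1 + |y|²)`. This gives both the
injectivity of the differential and the decay of the coordinate frame towards the pole. -/
theorem norm_fderiv_stereo_sq (y v : E2) :
    ‖fderiv ℝ stereo y v‖ ^ 2 = 4 * ‖v‖ ^ 2 / (1 + ‖y‖ ^ 2) ^ 2 := by
  have hp : (1 + ‖y‖ ^ 2) ≠ 0 := by positivity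
  have hd : HasFDerivAt (fun y : E2 => (1 + ‖y‖ ^ 2)⁻¹)
      (-((1 + ‖y‖ ^ 2) ^ 2)⁻¹ • (2 • innerSL ℝ y)) y := by
    have h1 : HasFDerivAt (fun y : E2 => 1 + ‖y‖ ^ 2) (2 • innerSL ℝ y) y := by
      simpa using ((hasStrictFDerivAt_norm_sq y).hasFDerivAt.const_add 1)
    exact (hasDerivAt_inv hp).comp_hasFDerivAt y h1
  have hc (i : Fin 2) : HasFDerivAt (fun y : E2 => y i) (EuclideanSpace.proj i : E2 →L[ℝ] ℝ) y :=
    (EuclideanSpace.proj i : E2 →L[ℝ] ℝ).hasFDerivAt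
  have hst (i : Fin 3) : HasFDerivAt (fun z => stereo z i)
      ((EuclideanSpace.proj i : E3 →L[ℝ] ℝ) ∘L fderiv ℝ stereo y) y :=
    (EuclideanSpace.proj i : E3 →L[ℝ] ℝ).hasFDerivAt.comp y (differentiable_stereo y).hasFDerivAt
  have e0 := (hst 0).unique (((hc 0).const_mul 2).mul hd |>.congr_of_eventuallyEq
    (Filter.Eventually.of_forall fun z => by simp [stereo_apply]))
  have e1 := (hst 1).unique (((hc 1).const_mul 2).mul hd |>.congr_of_eventuallyEq
    (Filter.Eventually.of_forall fun z => by simp [stereo_apply]))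
  have e2 := (hst 2).unique ((hd.const_mul 2).const_sub 1 |>.congr_of_eventuallyEq
    (Filter.Eventually.of_forall fun z => by simp [stereo_apply]))
  have f0 := DFunLike.congr_fun e0 v
  have f1 := DFunLike.congr_fun e1 v
  have f2 := DFunLike.congr_fun e2 v
  simp only [ContinuousLinearMap.comp_apply, PiLp.proj_apply,
    add_apply, smul_apply, neg_apply,
    innerSL_apply_apply, smul_eq_mul, nsmul_eq_mul] at f0 f1 f2
  have hin : inner ℝ y v = y 0 * v 0 + y 1 * v 1 := by
    simp [PiLp.inner_apply, Fin.sum_univ_two]; ring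
  have hy : ‖y‖ ^ 2 = y 0 ^ 2 + y 1 ^ 2 := by
    rw [EuclideanSpace.norm_sq_eq]; simp [Fin.sum_univ_two]
  have hv : ‖v‖ ^ 2 = v 0 ^ 2 + v 1 ^ 2 := by
    rw [EuclideanSpace.norm_sq_eq]; simp [Fin.sum_univ_two]
  rw [EuclideanSpace.norm_sq_eq, Fin.sum_univ_three]
  simp only [Real.norm_eq_abs, sq_abs]
  rw [f0, f1, f2, hin, hv, div_eq_mul_inv, ← inv_pow]
  have hts : (1 + ‖y‖ ^ 2)⁻¹ * (1 + (y 0 ^ 2 + y 1 ^ 2)) = 1 := by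
    rw [← hy]; exact inv_mul_cancel₀ hp
  generalize (1 + ‖y‖ ^ 2)⁻¹ = t at hts ⊢
  push_cast
  -- With `t = 1 / (1 + |y|²)` the squares add up to `4 t² |v|² + 16 ⟨y, v⟩² t³ (t (1 + |y|²) - 1)`,
  -- and the last bracket vanishes.
  linear_combination 16 * (y 0 * v 0 + y 1 * v 1) ^ 2 * t ^ 3 * hts

theorem isTangent_fderiv_stereo (y v : E2) : IsTangent (stereoS y) (fderiv ℝ stereo y v) := by
  have h : HasFDerivAt (fun y => inner ℝ (stereo y) (stereo y)) _ y :=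
    (differentiable_stereo y).hasFDerivAt.inner ℝ (differentiable_stereo y).hasFDerivAt
  have hone (z : E2) : inner ℝ (stereo z) (stereo z) = (1 : ℝ) := by
    rw [real_inner_self_eq_norm_sq, mem_sphere_zero_iff_norm.1 (stereo_mem z), one_pow]
  simp only [hone] at h
  have := DFunLike.congr_fun (h.unique (hasFDerivAt_const 1 y)) v
  simp [real_inner_comm] at this
  simp only [IsTangent, stereoS]
  linarith [real_inner_comm (stereo y) (fderiv ℝ stereo y v)]

theorem fderiv_stereo_ne_zero (y : E2) {v : E2} (hv : v ≠ 0) : fderiv ℝ stereo y v ≠ 0 := by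
  intro h
  have := norm_fderiv_stereo_sq y v
  rw [h] at this
  have : 0 < 4 * ‖v‖ ^ 2 / (1 + ‖y‖ ^ 2) ^ 2 := by positivity
  simp_all

theorem contMDiff_stereoS : ContMDiff 𝓘(ℝ, E2) (𝓡 2) ∞ stereoS :=
  contDiff_stereo.contMDiff.codRestrict_sphere stereo_mem

theorem stereo_injective : Function.Injective stereo := by
  intro y z h
  rw [stereo_apply, stereo_apply] at h
  have h0 := congrFun (congrArg WithLp.ofLp h) 0
  have h1 := congrFun (congrArg WithLp.ofLp h) 1
  have h2 := congrFun (congrArg WithLp.ofLp h) 2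
  simp only [Matrix.cons_val_zero, Matrix.cons_val_one, Matrix.cons_val] at h0 h1 h2
  have hp : (1 + ‖z‖ ^ 2)⁻¹ ≠ 0 := by positivity
  have ht : (1 + ‖y‖ ^ 2)⁻¹ = (1 + ‖z‖ ^ 2)⁻¹ := by linarith
  rw [ht] at h0 h1
  have h0 := mul_right_cancel₀ hp h0
  have h1 := mul_right_cancel₀ hp h1
  ext i
  fin_cases i
  · simpa using h0
  · simpa using h1

theorem stereoS_injective : Function.Injective stereoS := fun _ _ h =>
  stereo_injective (congrArg Subtype.val h)

/-- Makes images of planar superlevel sets measurable in the sphere, so that they compete in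
`isoConst`. -/
theorem measurableEmbedding_stereoS : MeasurableEmbedding stereoS :=
  contMDiff_stereoS.continuous.measurableEmbedding stereoS_injective

/-- A function that is `C^n` on the cylinder is `C^n` in stereographic coordinates. -/
theorem contDiffOn_coord {V : Type*} [NormedAddCommGroup V] [NormedSpace ℝ V] {n : ℕ∞ω}
    (hn : n ≤ (∞ : ℕ∞ω)) {J : Set ℝ} {F : ℝ → S2 → V}
    (hF : ContMDiffOn (𝓘(ℝ, ℝ).prod (𝓡 2)) 𝓘(ℝ, V) n (fun p : ℝ × S2 => F p.1 p.2)
      (J ×ˢ Set.univ)) :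
    ContDiffOn ℝ n (fun p : Coord => F p.1 (stereoS p.2)) (J ×ˢ Set.univ) := by
  rw [← contMDiffOn_iff_contDiffOn]
  have h1 : ContMDiff 𝓘(ℝ, ℝ × E2) (𝓘(ℝ, ℝ).prod (𝓡 2)) n
      (fun p : Coord => ((p.1, stereoS p.2) : ℝ × S2)) := by
    refine ContMDiff.prodMk contDiff_fst.contMDiff ?_
    exact (contMDiff_stereoS.of_le hn).comp contDiff_snd.contMDiff
  exact hF.comp h1.contMDiffOn fun p hp => ⟨hp.1, trivial⟩

/-- A smooth function on the sphere is smooth in stereographic coordinates. -/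
theorem contDiff_coord {V : Type*} [NormedAddCommGroup V] [NormedSpace ℝ V]
    {F : S2 → V} (hF : ContMDiff (𝓡 2) 𝓘(ℝ, V) ∞ F) :
    ContDiff ℝ ∞ (fun y : E2 => F (stereoS y)) :=
  (hF.comp contMDiff_stereoS).contDiff

@[simp] theorem frame_zero (y : E2) : frame 0 y = 0 := by simp [frame, dir]

theorem frame_succ (A : Fin 2) (y : E2) :
    frame A.succ y = fderiv ℝ stereo y (EuclideanSpace.single A 1) := by simp [frame, dir]

theorem contDiff_frame (i : Fin 3) : ContDiff ℝ ∞ (frame i) :=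
  (contDiff_stereo.fderiv_right (by simp)).clm_apply contDiff_const

theorem isTangent_frame (i : Fin 3) (y : E2) : IsTangent (stereoS y) (frame i y) :=
  isTangent_fderiv_stereo y _

theorem norm_frame_le (i : Fin 3) (y : E2) : ‖frame i y‖ ≤ 2 / (1 + ‖y‖ ^ 2) := by
  refine Fin.cases (by simp; positivity) (fun A => ?_) i
  rw [frame_succ]
  refine le_of_sq_le_sq ?_ (by positivity)
  rw [norm_fderiv_stereo_sq]
  rw [div_pow]
  norm_num

namespace FoliatedCylinder

variable (M : FoliatedCylinder)

/-! ### The metric in coordinates -/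

theorem isOpen_coord : IsOpen (M.J ×ˢ (Set.univ : Set E2)) := M.isOpen_J.prod isOpen_univ

theorem leafMetric_apply (u : ℝ) (y : E2) (A B : Fin 2) :
    M.leafMetric u y A B = M.γ u (stereoS y) (frame A.succ y) (frame B.succ y) := by
  simp [leafMetric, metric]

@[simp] theorem metric_zero_zero (p : Coord) :
    M.metric p 0 0 = M.a p.1 (stereoS p.2) ^ 2 := by simp [metric]

@[simp] theorem metric_zero_succ (p : Coord) (A : Fin 2) : M.metric p 0 A.succ = 0 := by
  simp [metric]

@[simp] theorem metric_succ_zero (p : Coord) (A : Fin 2) : M.metric p A.succ 0 = 0 := by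
  simp [metric]

@[simp] theorem metric_succ_succ (p : Coord) (A B : Fin 2) :
    M.metric p A.succ B.succ = M.leafMetric p.1 p.2 A B := rfl

variable {M}

theorem leafMetric_symm {u : ℝ} (hu : u ∈ M.J) (y : E2) (A B : Fin 2) :
    M.leafMetric u y A B = M.leafMetric u y B A := by
  simp only [leafMetric_apply]
  exact M.γ_symm u hu _ _ _ (isTangent_frame _ y) (isTangent_frame _ y)

theorem metric_symm {p : Coord} (hp : p.1 ∈ M.J) (i j : Fin 3) :
    M.metric p i j = M.metric p j i := by
  refine Fin.cases ?_ (fun A => ?_) i <;> refine Fin.cases ?_ (fun B => ?_) j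
  · rfl
  · simp
  · simp
  · simp [leafMetric_symm hp]

theorem leafMetric_quadratic {u : ℝ} (hu : u ∈ M.J) (y : E2) (s t : ℝ) :
    M.leafMetric u y 0 0 * s ^ 2 + 2 * M.leafMetric u y 0 1 * (s * t) +
        M.leafMetric u y 1 1 * t ^ 2 =
      M.γ u (stereoS y) (fderiv ℝ stereo y !₂[s, t]) (fderiv ℝ stereo y !₂[s, t]) := by
  have hv : (!₂[s, t] : E2) = s • EuclideanSpace.single 0 1 + t • EuclideanSpace.single 1 1 := by
    ext i; fin_cases i <;> simp
  have hs := leafMetric_symm hu y 1 0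
  rw [hv]
  simp only [map_add, map_smul, leafMetric_apply, frame_succ, add_apply,
    smul_apply, smul_eq_mul] at hs ⊢
  linear_combination (- s * t) * hs

theorem leafMetric_quadratic_pos {u : ℝ} (hu : u ∈ M.J) (y : E2) {s t : ℝ} (h : s ≠ 0 ∨ t ≠ 0) :
    0 < M.leafMetric u y 0 0 * s ^ 2 + 2 * M.leafMetric u y 0 1 * (s * t) +
        M.leafMetric u y 1 1 * t ^ 2 := by
  rw [leafMetric_quadratic hu]
  refine M.γ_pos u hu _ _ (isTangent_fderiv_stereo y _) (fderiv_stereo_ne_zero y fun h0 => ?_)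
  have h1 := congrFun (congrArg WithLp.ofLp h0) 0
  have h2 := congrFun (congrArg WithLp.ofLp h0) 1
  simp at h1 h2
  tauto

theorem leafMetric_diag_pos {u : ℝ} (hu : u ∈ M.J) (y : E2) (A : Fin 2) :
    0 < M.leafMetric u y A A := by
  fin_cases A
  · simpa using leafMetric_quadratic_pos hu y (s := 1) (t := 0) (by simp)
  · simpa using leafMetric_quadratic_pos hu y (s := 0) (t := 1) (by simp)

theorem leafMetric_det {u : ℝ} (hu : u ∈ M.J) (y : E2) :
    (M.leafMetric u y).det =
      M.leafMetric u y 0 0 * M.leafMetric u y 1 1 - M.leafMetric u y 0 1 ^ 2 := by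
  rw [Matrix.det_fin_two, leafMetric_symm hu y 1 0]; ring

theorem leafMetric_det_pos {u : ℝ} (hu : u ∈ M.J) (y : E2) : 0 < (M.leafMetric u y).det := by
  have h := leafMetric_quadratic_pos hu y (s := - M.leafMetric u y 0 1) (t := M.leafMetric u y 0 0)
    (Or.inr (leafMetric_diag_pos hu y 0).ne')
  rw [leafMetric_det hu]
  refine pos_of_mul_pos_right (a := M.leafMetric u y 0 0) ?_ (leafMetric_diag_pos hu y 0).le
  linarith

theorem areaDensity_pos {u : ℝ} (hu : u ∈ M.J) (y : E2) : 0 < M.areaDensity u y :=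
  Real.sqrt_pos.2 (leafMetric_det_pos hu y)

theorem areaDensity_sq {u : ℝ} (hu : u ∈ M.J) (y : E2) :
    M.areaDensity u y ^ 2 = (M.leafMetric u y).det := Real.sq_sqrt (leafMetric_det_pos hu y).le

theorem metric_det (p : Coord) :
    (M.metric p).det = M.a p.1 (stereoS p.2) ^ 2 * (M.leafMetric p.1 p.2).det := by
  rw [Matrix.det_succ_row_zero, Fin.sum_univ_succ]
  simp [leafMetric, Fin.succAbove_zero]

theorem volDensity_eq {p : Coord} (hp : p.1 ∈ M.J) :
    M.volDensity p = M.a p.1 (stereoS p.2) * M.areaDensity p.1 p.2 := by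
  rw [volDensity, metric_det, Real.sqrt_mul (sq_nonneg _), Real.sqrt_sq (M.a_pos _ hp _).le,
    areaDensity]

theorem metric_det_ne_zero {p : Coord} (hp : p.1 ∈ M.J) : (M.metric p).det ≠ 0 := by
  rw [metric_det]
  exact mul_ne_zero (pow_ne_zero 2 (M.a_pos _ hp _).ne') (leafMetric_det_pos hp _).ne'

/-- The inverse metric in block form. -/
theorem metric_inv {p : Coord} (hp : p.1 ∈ M.J) :
    (M.metric p)⁻¹ = Matrix.of (Fin.cons (Fin.cons (M.a p.1 (stereoS p.2) ^ 2)⁻¹ 0)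
      fun A => Fin.cons 0 ((M.leafMetric p.1 p.2)⁻¹ A)) := by
  have ha : M.a p.1 (stereoS p.2) ^ 2 ≠ 0 := pow_ne_zero 2 (M.a_pos _ hp _).ne'
  have hm : M.leafMetric p.1 p.2 * (M.leafMetric p.1 p.2)⁻¹ = 1 :=
    Matrix.mul_nonsing_inv _ (leafMetric_det_pos hp _).ne'.isUnit
  refine Matrix.inv_eq_right_inv ?_
  ext i j
  refine Fin.cases ?_ (fun A => ?_) i <;> refine Fin.cases ?_ (fun B => ?_) j <;>
    rw [Matrix.mul_apply, Fin.sum_univ_succ]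
  · simp [ha]
  · simp [(Fin.succ_ne_zero B).symm]
  · simp
  · simpa [Matrix.mul_apply, Matrix.one_apply] using congrFun (congrFun hm A) B

theorem metric_inv_zero_zero {p : Coord} (hp : p.1 ∈ M.J) :
    (M.metric p)⁻¹ 0 0 = (M.a p.1 (stereoS p.2) ^ 2)⁻¹ := by simp [metric_inv hp]

theorem metric_inv_zero_succ {p : Coord} (hp : p.1 ∈ M.J) (A : Fin 2) :
    (M.metric p)⁻¹ 0 A.succ = 0 := by simp [metric_inv hp]

theorem metric_inv_succ_zero {p : Coord} (hp : p.1 ∈ M.J) (A : Fin 2) :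
    (M.metric p)⁻¹ A.succ 0 = 0 := by simp [metric_inv hp]

theorem metric_inv_succ_succ {p : Coord} (hp : p.1 ∈ M.J) (A B : Fin 2) :
    (M.metric p)⁻¹ A.succ B.succ = (M.leafMetric p.1 p.2)⁻¹ A B := by simp [metric_inv hp]

theorem leafMetric_inv {u : ℝ} (hu : u ∈ M.J) (y : E2) :
    (M.leafMetric u y)⁻¹ = ((M.leafMetric u y).det)⁻¹ •
      !![M.leafMetric u y 1 1, -M.leafMetric u y 0 1;
        -M.leafMetric u y 0 1, M.leafMetric u y 0 0] := by
  rw [Matrix.inv_def, Matrix.adjugate_fin_two, leafMetric_symm hu y 1 0, Ring.inverse_eq_inv']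

/-! ### Smoothness of the metric -/

theorem contDiffOn_γ_frame (i j : Fin 3) :
    ContDiffOn ℝ ∞ (fun p : Coord => M.γ p.1 (stereoS p.2) (frame i p.2) (frame j p.2))
      (M.J ×ˢ Set.univ) :=
  ((contDiffOn_coord le_rfl M.γ_smooth).clm_apply
    ((contDiff_frame i).comp contDiff_snd).contDiffOn).clm_apply
    ((contDiff_frame j).comp contDiff_snd).contDiffOn

theorem contDiffOn_lapse :
    ContDiffOn ℝ ∞ (fun p : Coord => M.a p.1 (stereoS p.2)) (M.J ×ˢ Set.univ) :=
  contDiffOn_coord le_rfl M.a_smooth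

theorem contDiffOn_leafMetric (A B : Fin 2) :
    ContDiffOn ℝ ∞ (fun p : Coord => M.leafMetric p.1 p.2 A B) (M.J ×ˢ Set.univ) := by
  simpa only [leafMetric_apply] using contDiffOn_γ_frame A.succ B.succ

theorem contDiffOn_metric (i j : Fin 3) :
    ContDiffOn ℝ ∞ (fun p : Coord => M.metric p i j) (M.J ×ˢ Set.univ) := by
  have h := contDiffOn_γ_frame (M := M) i j
  by_cases hij : i = 0 ∧ j = 0
  · simpa [metric, hij] using contDiffOn_lapse.pow 2
  · simpa [metric, hij] using h

theorem contDiffOn_leafMetric_det :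
    ContDiffOn ℝ ∞ (fun p : Coord => (M.leafMetric p.1 p.2).det) (M.J ×ˢ Set.univ) := by
  simp only [Matrix.det_fin_two]
  exact ((contDiffOn_leafMetric 0 0).mul (contDiffOn_leafMetric 1 1)).sub
    ((contDiffOn_leafMetric 0 1).mul (contDiffOn_leafMetric 1 0))

theorem contDiffOn_areaDensity :
    ContDiffOn ℝ ∞ (fun p : Coord => M.areaDensity p.1 p.2) (M.J ×ˢ Set.univ) :=
  contDiffOn_leafMetric_det.sqrt fun _ hp => (leafMetric_det_pos hp.1 _).ne'

theorem contDiffOn_leafMetric_inv (A B : Fin 2) :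
    ContDiffOn ℝ ∞ (fun p : Coord => (M.leafMetric p.1 p.2)⁻¹ A B) (M.J ×ˢ Set.univ) := by
  have hd : ContDiffOn ℝ ∞ (fun p : Coord => ((M.leafMetric p.1 p.2).det)⁻¹) (M.J ×ˢ Set.univ) :=
    contDiffOn_leafMetric_det.inv fun _ hp => (leafMetric_det_pos hp.1 _).ne'
  refine ContDiffOn.congr (f := fun p : Coord => ((M.leafMetric p.1 p.2).det)⁻¹ *
      !![M.leafMetric p.1 p.2 1 1, -M.leafMetric p.1 p.2 0 1;
        -M.leafMetric p.1 p.2 0 1, M.leafMetric p.1 p.2 0 0] A B) ?_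
    fun p hp => by rw [leafMetric_inv hp.1]; simp
  refine hd.mul ?_
  fin_cases A <;> fin_cases B
  · simpa using contDiffOn_leafMetric 1 1
  · simpa using (contDiffOn_leafMetric 0 1).neg
  · simpa using (contDiffOn_leafMetric 0 1).neg
  · simpa using contDiffOn_leafMetric 0 0

theorem contDiffOn_metric_inv (i j : Fin 3) :
    ContDiffOn ℝ ∞ (fun p : Coord => (M.metric p)⁻¹ i j) (M.J ×ˢ Set.univ) := by
  refine Fin.cases ?_ (fun A => ?_) i <;> refine Fin.cases ?_ (fun B => ?_) j
  · exact ((contDiffOn_lapse.pow 2).inv fun p hp => pow_ne_zero 2 (M.a_pos _ hp.1 _).ne').congr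
      fun p hp => metric_inv_zero_zero hp.1
  · exact contDiffOn_const.congr fun p hp => metric_inv_zero_succ hp.1 B
  · exact contDiffOn_const.congr fun p hp => metric_inv_succ_zero hp.1 A
  · exact (contDiffOn_leafMetric_inv A B).congr fun p hp => metric_inv_succ_succ hp.1 A B

/-! ### Locally uniform bounds -/

/-- `γ` is bounded on the compact set `K × S²` and the frame decays like the conformal factor. The
bound is uniform up to the missing pole and supplies integrable majorants. -/
theorem exists_leafMetric_le {K : Set ℝ} (hK : IsCompact K) (hKJ : K ⊆ M.J) :
    ∃ C : ℝ, 0 ≤ C ∧ ∀ u ∈ K, ∀ y A B,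
      |M.leafMetric u y A B| ≤ C * (2 / (1 + ‖y‖ ^ 2)) ^ 2 := by
  have hc : ContinuousOn (fun p : ℝ × S2 => M.γ p.1 p.2) (K ×ˢ Set.univ) :=
    M.γ_smooth.continuousOn.mono (Set.prod_mono hKJ subset_rfl)
  obtain ⟨C, hC⟩ := 
    IsCompact.exists_bound_of_continuousOn (E := E3 →L[ℝ] E3 →L[ℝ] ℝ) (hK.prod isCompact_univ) hc
  refine ⟨max C 0, le_max_right _ _, fun u hu y A B => ?_⟩
  rw [leafMetric_apply, ← Real.norm_eq_abs, sq, ← mul_assoc]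
  refine ((M.γ u (stereoS y)).le_opNorm₂ _ _).trans ?_
  have h1 := norm_frame_le A.succ y
  have h2 := norm_frame_le B.succ y
  have h3 : ‖M.γ u (stereoS y)‖ ≤ max C 0 := (hC (u, stereoS y) ⟨hu, trivial⟩).trans (le_max_left _ _)
  gcongr

/-- Hadamard's inequality: the determinant is at most the product of the diagonal entries. -/
theorem exists_areaDensity_le {K : Set ℝ} (hK : IsCompact K) (hKJ : K ⊆ M.J) :
    ∃ C : ℝ, 0 ≤ C ∧ ∀ u ∈ K, ∀ y, M.areaDensity u y ≤ C * (2 / (1 + ‖y‖ ^ 2)) ^ 2 := by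
  obtain ⟨C, hC0, hC⟩ := exists_leafMetric_le hK hKJ
  refine ⟨C, hC0, fun u hu y => ?_⟩
  refine Real.sqrt_le_iff.2 ⟨by positivity, ?_⟩
  rw [leafMetric_det (hKJ hu), sq (C * _)]
  have h1 := (abs_le.1 (hC u hu y 0 0)).2
  have h2 := (abs_le.1 (hC u hu y 1 1)).2
  have h3 := mul_le_mul h1 h2 (leafMetric_diag_pos (hKJ hu) y 1).le (by positivity)
  nlinarith [sq_nonneg (M.leafMetric u y 0 1)]

end FoliatedCylinder

/-! ### Metric compatibility and Kato's inequality -/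

section Tensor

theorem pd_congr {i : Fin 3} {f g : Coord → ℝ} {p : Coord} (h : f =ᶠ[nhds p] g) :
    pd i f p = pd i g p := by rw [pd, pd, h.fderiv_eq]

theorem pd_const (i : Fin 3) (c : ℝ) (p : Coord) : pd i (fun _ => c) p = 0 := by simp [pd]

theorem pd_mul {i : Fin 3} {f g : Coord → ℝ} {p : Coord} (hf : DifferentiableAt ℝ f p)
    (hg : DifferentiableAt ℝ g p) :
    pd i (fun q => f q * g q) p = pd i f p * g p + f p * pd i g p := by
  simp [pd, fderiv_fun_mul hf hg]; ring

theorem pd_sum {ι : Type*} {s : Finset ι} {i : Fin 3} {f : ι → Coord → ℝ} {p : Coord}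
    (hf : ∀ j ∈ s, DifferentiableAt ℝ (f j) p) :
    pd i (fun q => ∑ j ∈ s, f j q) p = ∑ j ∈ s, pd i (f j) p := by
  simp [pd, fderiv_fun_sum hf]

theorem pd_prod {ι : Type*} [DecidableEq ι] {s : Finset ι} {i : Fin 3} {f : ι → Coord → ℝ}
    {p : Coord} (hf : ∀ j ∈ s, DifferentiableAt ℝ (f j) p) :
    pd i (fun q => ∏ j ∈ s, f j q) p = ∑ j ∈ s, (∏ l ∈ s.erase j, f l p) * pd i (f j) p := by
  have h := HasFDerivAt.finsetProd (u := s) fun j hj => (hf j hj).hasFDerivAt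
  simp [pd, h.fderiv]

/-- This is `∇g⁻¹ = 0`. Differentiating `g⁻¹ g = 1` gives `∂g⁻¹ = -g⁻¹ (∂g) g⁻¹`; in the sum of the
two Christoffel terms only `∂_i g` survives, the other two derivatives being antisymmetric. Symmetry
and invertibility are asked for only near `p`, since the metric carries no information outside `J`.
-/
theorem pd_metric_inv {g : Coord → Matrix (Fin 3) (Fin 3) ℝ} {p : Coord}
    (hg : ∀ i j, DifferentiableAt ℝ (fun q => g q i j) p)
    (hg' : ∀ i j, DifferentiableAt ℝ (fun q => (g q)⁻¹ i j) p)
    (hsymm : ∀ᶠ q in nhds p, ∀ i j, g q i j = g q j i)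
    (hdet : ∀ᶠ q in nhds p, (g q).det ≠ 0) (i k l : Fin 3) :
    pd i (fun q => (g q)⁻¹ k l) p =
      -∑ m, (christoffel g k i m p * (g p)⁻¹ m l + christoffel g l i m p * (g p)⁻¹ k m) := by
  have hGs (i j l : Fin 3) : pd i (fun q => g q j l) p = pd i (fun q => g q l j) p :=
    pd_congr (hsymm.mono fun q hq => hq j l)
  have hT : (g p).transpose = g p := Matrix.ext fun i j => hsymm.self_of_nhds j i
  have hs (a b : Fin 3) : (g p)⁻¹ a b = (g p)⁻¹ b a := by
    rw [← Matrix.transpose_apply (g p)⁻¹, Matrix.transpose_nonsing_inv, hT]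
  have hinv : g p * (g p)⁻¹ = 1 := Matrix.mul_nonsing_inv _ hdet.self_of_nhds.isUnit
  have h0 (l : Fin 3) : ∑ m, (pd i (fun q => (g q)⁻¹ k m) p * g p m l +
      (g p)⁻¹ k m * pd i (fun q => g q m l) p) = 0 := by
    have h1 : pd i (fun q => ∑ m, (g q)⁻¹ k m * g q m l) p = 0 := by
      rw [pd_congr (g := fun _ => (1 : Matrix (Fin 3) (Fin 3) ℝ) k l), pd_const]
      filter_upwards [hdet] with q hq
      rw [← Matrix.mul_apply, Matrix.nonsing_inv_mul _ hq.isUnit]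
    rw [pd_sum fun m _ => (hg' k m).fun_mul (hg m l)] at h1
    simpa only [pd_mul (hg' _ _) (hg _ _)] using h1
  have h2 : pd i (fun q => (g q)⁻¹ k l) p =
      -∑ n, ∑ m, (g p)⁻¹ k m * pd i (fun q => g q m n) p * (g p)⁻¹ n l := by
    have h3 : ∑ n, (∑ m, (pd i (fun q => (g q)⁻¹ k m) p * g p m n +
      (g p)⁻¹ k m * pd i (fun q => g q m n) p)) * (g p)⁻¹ n l = 0 := by simp [h0]
    simp only [Finset.sum_add_distrib, add_mul, Finset.sum_mul] at h3
    rw [eq_neg_iff_add_eq_zero, ← h3]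
    congr 1
    rw [Finset.sum_comm]
    simp only [mul_assoc, ← Finset.mul_sum, ← Matrix.mul_apply, hinv]
    simp [Matrix.one_apply]
  rw [h2, neg_inj, Finset.sum_add_distrib]
  simp only [christoffel, Finset.mul_sum, Finset.sum_mul]
  rw [Finset.sum_comm (f := fun m n => 1 / 2 * ((g p)⁻¹ l n * _) * _), ← Finset.sum_add_distrib]
  refine Finset.sum_congr rfl fun n _ => ?_
  rw [← Finset.sum_add_distrib]
  refine Finset.sum_congr rfl fun m _ => ?_
  rw [hs l n, hGs i m n]
  ring

variable {k : ℕ}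

/-- The full contraction of two covariant tensors with a bilinear form. -/
def contract (h : Matrix (Fin 3) (Fin 3) ℝ) (S T : (Fin k → Fin 3) → ℝ) : ℝ :=
  ∑ I : Fin k → Fin 3, ∑ K : Fin k → Fin 3, (∏ j, h (I j) (K j)) * S I * T K

theorem contract_comm {h : Matrix (Fin 3) (Fin 3) ℝ} (hs : ∀ i j, h i j = h j i)
    (S T : (Fin k → Fin 3) → ℝ) : contract h S T = contract h T S := by
  rw [contract, contract, Finset.sum_comm]
  refine Finset.sum_congr rfl fun I _ => Finset.sum_congr rfl fun K _ => ?_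
  simp only [fun j => hs (K j) (I j)]
  ring

/-- Components of a covariant tensor after a linear change of frame. -/
def changeFrame (B : Matrix (Fin 3) (Fin 3) ℝ) (T : (Fin k → Fin 3) → ℝ) (α : Fin k → Fin 3) : ℝ :=
  ∑ I : Fin k → Fin 3, (∏ j, B (α j) (I j)) * T I

/-- If the inverse metric is `Bᵀ B`, the rows of `B` are an orthonormal frame, and the contraction
becomes the Euclidean product of the frame components. This yields positivity and Cauchy–Schwarz. -/
theorem contract_eq_sum {h B : Matrix (Fin 3) (Fin 3) ℝ} (hB : ∀ i j, h i j = ∑ a, B a i * B a j)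
    (S T : (Fin k → Fin 3) → ℝ) :
    contract h S T = ∑ α, changeFrame B S α * changeFrame B T α := by
  simp only [contract, changeFrame, hB, Finset.prod_univ_sum, Fintype.piFinset_univ,
    Finset.sum_mul_sum]
  rw [Finset.sum_comm]
  simp only [Finset.sum_mul]
  rw [Finset.sum_comm]
  conv_rhs => rw [Finset.sum_comm]
  refine Finset.sum_congr rfl fun I _ => ?_
  conv_rhs => rw [Finset.sum_comm]
  refine Finset.sum_congr rfl fun K _ => Finset.sum_congr rfl fun α _ => ?_
  rw [Finset.prod_mul_distrib]
  ring

theorem changeFrame_cons (B : Matrix (Fin 3) (Fin 3) ℝ) (T : (Fin (k + 1) → Fin 3) → ℝ)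
    (a : Fin 3) (α : Fin k → Fin 3) :
    changeFrame B T (Fin.cons a α) =
      ∑ i, B a i * changeFrame B (fun I => T (Fin.cons i I)) α := by
  rw [changeFrame, ← (Fin.consEquiv fun _ => Fin 3).sum_comp, Fintype.sum_prod_type]
  refine Finset.sum_congr rfl fun i _ => ?_
  rw [changeFrame, Finset.mul_sum]
  refine Finset.sum_congr rfl fun I _ => ?_
  simp [Fin.prod_univ_succ, Fin.consEquiv, mul_assoc]

/-- Exchanging the `j`-th entry of `I` with `m` is an involution of the pairs `(I, m)`. It moves a
Christoffel symbol from the inverse metric to a slot of the tensor. -/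
theorem sum_update_swap {β : Type*} [AddCommMonoid β] (j : Fin k)
    (F : (Fin k → Fin 3) → Fin 3 → β) :
    ∑ I, ∑ m, F I m = ∑ I : Fin k → Fin 3, ∑ m, F (Function.update I j m) (I j) := by
  let e : Equiv.Perm ((Fin k → Fin 3) × Fin 3) :=
    Function.Involutive.toPerm (fun x => (Function.update x.1 j x.2, x.1 j)) fun x => by simp
  rw [← Fintype.sum_prod_type', ← Fintype.sum_prod_type', ← Equiv.sum_comp e]
  rfl

/-- The identity `∂_i |T|² = 2 ⟨∇_i T, T⟩`: the derivatives of the factors `g⁻¹`, computed by metric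
compatibility, are the correction terms of the covariant derivative. -/
theorem pd_contract {g : Coord → Matrix (Fin 3) (Fin 3) ℝ} {p : Coord}
    (hg : ∀ i j, DifferentiableAt ℝ (fun q => g q i j) p)
    (hg' : ∀ i j, DifferentiableAt ℝ (fun q => (g q)⁻¹ i j) p)
    (hsymm : ∀ᶠ q in nhds p, ∀ i j, g q i j = g q j i)
    (hdet : ∀ᶠ q in nhds p, (g q).det ≠ 0) {T : (Fin k → Fin 3) → Coord → ℝ}
    (hT : ∀ I, DifferentiableAt ℝ (T I) p) (i : Fin 3) :
    pd i (fun q => contract (g q)⁻¹ (T · q) (T · q)) p =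
      2 * contract (g p)⁻¹ (fun I => covDeriv g T (Fin.cons i I) p) (T · p) := by
  have hTr : (g p).transpose = g p := Matrix.ext fun i j => hsymm.self_of_nhds j i
  have hs (a b : Fin 3) : (g p)⁻¹ a b = (g p)⁻¹ b a := by
    rw [← Matrix.transpose_apply (g p)⁻¹, Matrix.transpose_nonsing_inv, hTr]
  have hprod (I K : Fin k → Fin 3) :
      DifferentiableAt ℝ (fun q => ∏ j, (g q)⁻¹ (I j) (K j)) p :=
    (HasFDerivAt.finsetProd fun j _ => (hg' _ _).hasFDerivAt).differentiableAt
  have h1 : pd i (fun q => contract (g q)⁻¹ (T · q) (T · q)) p =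
      ∑ I, ∑ K, ((∑ j, (∏ l ∈ Finset.univ.erase j, (g p)⁻¹ (I l) (K l)) *
        pd i (fun q => (g q)⁻¹ (I j) (K j)) p) * T I p * T K p) +
      2 * contract (g p)⁻¹ (fun I => pd i (T I) p) (T · p) := by
    have h2 : ∑ I, ∑ K, (∏ j, (g p)⁻¹ (I j) (K j)) * T I p * pd i (T K) p =
      contract (g p)⁻¹ (fun I => pd i (T I) p) (T · p) := contract_comm hs _ _
    rw [two_mul, ← add_assoc]
    nth_rewrite 2 [← h2]
    rw [contract, ← Finset.sum_add_distrib, ← Finset.sum_add_distrib]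
    simp only [contract]
    rw [pd_sum fun I _ => DifferentiableAt.fun_sum fun K _ => ((hprod I K).fun_mul (hT I)).fun_mul (hT K)]
    refine Finset.sum_congr rfl fun I _ => ?_
    rw [pd_sum fun K _ => ((hprod I K).fun_mul (hT I)).fun_mul (hT K), ← Finset.sum_add_distrib,
      ← Finset.sum_add_distrib]
    refine Finset.sum_congr rfl fun K _ => ?_
    rw [pd_mul ((hprod I K).fun_mul (hT I)) (hT K), pd_mul (hprod I K) (hT I),
      pd_prod fun j _ => hg' _ _]
    ring
  -- Differentiating the `j`-th factor gives two Christoffel terms, one acting on each copy of `T`.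
  -- The index swap and the symmetry of `g⁻¹` bring both to the same form, whence the factor `-2`.
  have h3 (j : Fin k) : ∑ I, ∑ K, (∏ l ∈ Finset.univ.erase j, (g p)⁻¹ (I l) (K l)) *
        pd i (fun q => (g q)⁻¹ (I j) (K j)) p * T I p * T K p =
      -2 * ∑ I, ∑ K, (∏ l, (g p)⁻¹ (I l) (K l)) *
        (∑ m, christoffel g m i (I j) p * T (Function.update I j m) p) * T K p := by
    have h4 : ∑ K, ∑ I, ∑ m, (∏ l ∈ Finset.univ.erase j, (g p)⁻¹ (I l) (K l)) *
        (christoffel g (I j) i m p * (g p)⁻¹ m (K j)) * T I p * T K p =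
      ∑ K, ∑ I, (∏ l, (g p)⁻¹ (I l) (K l)) *
        (∑ m, christoffel g m i (I j) p * T (Function.update I j m) p) * T K p := by
      refine Finset.sum_congr rfl fun K _ => ?_
      rw [sum_update_swap j]
      refine Finset.sum_congr rfl fun I _ => ?_
      rw [Finset.mul_sum, Finset.sum_mul]
      refine Finset.sum_congr rfl fun m _ => ?_
      rw [← Finset.prod_erase_mul _ _ (Finset.mem_univ j)]
      have h5 : ∏ l ∈ Finset.univ.erase j, (g p)⁻¹ (Function.update I j m l) (K l) =
          ∏ l ∈ Finset.univ.erase j, (g p)⁻¹ (I l) (K l) :=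
        Finset.prod_congr rfl fun l hl => by
          rw [Function.update_of_ne (Finset.ne_of_mem_erase hl)]
      rw [h5, Function.update_self]
      ring
    have h6 : ∑ I, ∑ K, ∑ m, (∏ l ∈ Finset.univ.erase j, (g p)⁻¹ (I l) (K l)) *
        (christoffel g (K j) i m p * (g p)⁻¹ (I j) m) * T I p * T K p =
      ∑ K, ∑ I, (∏ l, (g p)⁻¹ (I l) (K l)) *
        (∑ m, christoffel g m i (I j) p * T (Function.update I j m) p) * T K p := by
      rw [← h4]
      refine Finset.sum_congr rfl fun I _ => Finset.sum_congr rfl fun K _ =>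
        Finset.sum_congr rfl fun m _ => ?_
      simp only [fun l => hs (I l) (K l), hs (I j) m]
      ring
    rw [Finset.sum_comm] at h4
    replace h4 := h4.trans Finset.sum_comm
    replace h6 := h6.trans Finset.sum_comm
    have h7 : ∀ x : ℝ, -2 * x = -x + -x := fun x => by ring
    rw [h7]
    nth_rewrite 1 [← h4]
    rw [← h6, ← Finset.sum_neg_distrib, ← Finset.sum_neg_distrib, ← Finset.sum_add_distrib]
    refine Finset.sum_congr rfl fun I _ => ?_
    rw [← Finset.sum_neg_distrib, ← Finset.sum_neg_distrib, ← Finset.sum_add_distrib]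
    refine Finset.sum_congr rfl fun K _ => ?_
    rw [pd_metric_inv hg hg' hsymm hdet, Finset.sum_add_distrib]
    simp only [← Finset.sum_mul, ← Finset.mul_sum]
    ring
  have h8 : contract (g p)⁻¹ (fun I => covDeriv g T (Fin.cons i I) p) (T · p) =
      contract (g p)⁻¹ (fun I => pd i (T I) p) (T · p) - ∑ j, ∑ I, ∑ K,
        (∏ l, (g p)⁻¹ (I l) (K l)) *
          (∑ m, christoffel g m i (I j) p * T (Function.update I j m) p) * T K p := by
    rw [Finset.sum_comm]
    simp only [contract]
    rw [← Finset.sum_sub_distrib]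
    refine Finset.sum_congr rfl fun I _ => ?_
    rw [Finset.sum_comm, ← Finset.sum_sub_distrib]
    refine Finset.sum_congr rfl fun K _ => ?_
    simp only [covDeriv, Fin.cons_zero, Fin.tail_cons, Fin.cons_succ]
    rw [← Finset.sum_mul, ← Finset.mul_sum]
    ring
  rw [h1, h8]
  simp only [Finset.sum_mul]
  have h9 : ∑ I, ∑ K, ∑ j, (∏ l ∈ Finset.univ.erase j, (g p)⁻¹ (I l) (K l)) *
        pd i (fun q => (g q)⁻¹ (I j) (K j)) p * T I p * T K p =
      ∑ j, ∑ I, ∑ K, (∏ l ∈ Finset.univ.erase j, (g p)⁻¹ (I l) (K l)) *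
        pd i (fun q => (g q)⁻¹ (I j) (K j)) p * T I p * T K p := by
    rw [Finset.sum_comm (s := Finset.univ (α := Fin k))]
    exact Finset.sum_congr rfl fun I _ => Finset.sum_comm
  rw [h9, Finset.sum_congr rfl fun j _ => h3 j, ← Finset.mul_sum]
  ring

/-- **Kato's inequality** for the square of the norm: `|d|T|²|² ≤ 4 |T|² |∇T|²`. -/
theorem contract_pd_le {g : Coord → Matrix (Fin 3) (Fin 3) ℝ} {p : Coord}
    (hg : ∀ i j, DifferentiableAt ℝ (fun q => g q i j) p)
    (hg' : ∀ i j, DifferentiableAt ℝ (fun q => (g q)⁻¹ i j) p)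
    (hsymm : ∀ᶠ q in nhds p, ∀ i j, g q i j = g q j i)
    (hdet : ∀ᶠ q in nhds p, (g q).det ≠ 0) {B : Matrix (Fin 3) (Fin 3) ℝ}
    (hB : ∀ i j, (g p)⁻¹ i j = ∑ a, B a i * B a j) {T : (Fin k → Fin 3) → Coord → ℝ}
    (hT : ∀ I, DifferentiableAt ℝ (T I) p) :
    ∑ i, ∑ j, (g p)⁻¹ i j * pd i (fun q => contract (g q)⁻¹ (T · q) (T · q)) p *
        pd j (fun q => contract (g q)⁻¹ (T · q) (T · q)) p ≤
      4 * contract (g p)⁻¹ (T · p) (T · p) *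
        contract (g p)⁻¹ (covDeriv g T · p) (covDeriv g T · p) := by
  set w := fun q => contract (g q)⁻¹ (T · q) (T · q) with hw
  set X := changeFrame B (T · p) with hX
  set Z := changeFrame B (covDeriv g T · p) with hZ
  have h1 : ∑ i, ∑ j, (g p)⁻¹ i j * pd i w p * pd j w p = ∑ a, (∑ i, B a i * pd i w p) ^ 2 := by
    simp only [hB, sq]
    simp only [Finset.sum_mul_sum]
    simp only [Finset.sum_mul]
    conv_rhs => rw [Finset.sum_comm]
    refine Finset.sum_congr rfl fun i _ => ?_
    conv_rhs => rw [Finset.sum_comm]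
    refine Finset.sum_congr rfl fun j _ => Finset.sum_congr rfl fun a _ => ?_
    ring
  have h2 (a : Fin 3) : ∑ i, B a i * pd i w p = 2 * ∑ α, Z (Fin.cons a α) * X α := by
    simp only [hZ, changeFrame_cons, Finset.sum_mul]
    rw [Finset.sum_comm, Finset.mul_sum]
    refine Finset.sum_congr rfl fun i _ => ?_
    rw [hw, pd_contract hg hg' hsymm hdet hT, contract_eq_sum hB]
    simp only [mul_assoc, ← Finset.mul_sum]
    ring
  have h3 : contract (g p)⁻¹ (covDeriv g T · p) (covDeriv g T · p) =
      ∑ a, ∑ α, Z (Fin.cons a α) ^ 2 := by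
    rw [contract_eq_sum hB, ← (Fin.consEquiv fun _ => Fin 3).sum_comp, Fintype.sum_prod_type]
    simp [hZ, sq, Fin.consEquiv]
  have h4 : contract (g p)⁻¹ (T · p) (T · p) = ∑ α, X α ^ 2 := by
    rw [contract_eq_sum hB]
    simp [hX, sq]
  rw [h1, h3, h4, Finset.mul_sum]
  refine Finset.sum_le_sum fun a _ => ?_
  rw [h2, mul_pow]
  -- Cauchy–Schwarz for `⟨∇_a T, T⟩`, one frame direction `a` at a time.
  have := Finset.sum_mul_sq_le_sq_mul_sq Finset.univ (fun α => Z (Fin.cons a α)) X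
  linarith

theorem contract_self_nonneg {h B : Matrix (Fin 3) (Fin 3) ℝ}
    (hB : ∀ i j, h i j = ∑ a, B a i * B a j) (T : (Fin k → Fin 3) → ℝ) : 0 ≤ contract h T T := by
  rw [contract_eq_sum hB]
  exact Finset.sum_nonneg fun α _ => mul_self_nonneg _

end Tensor
namespace FoliatedCylinder
variable {M : FoliatedCylinder}

/-- An orthonormal frame diagonalises the inverse metric. -/
theorem exists_orthonormal_frame {p : Coord} (hp : p.1 ∈ M.J) :
    ∃ B : Matrix (Fin 3) (Fin 3) ℝ, ∀ i j, (M.metric p)⁻¹ i j = ∑ a, B a i * B a j := by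
  have hR := leafMetric_diag_pos hp p.2 1
  have hD := leafMetric_det_pos hp p.2
  have hdet := leafMetric_det hp p.2
  have h00 := metric_inv_zero_zero hp
  have h0s := metric_inv_zero_succ hp
  have hs0 := metric_inv_succ_zero hp
  have hss := metric_inv_succ_succ hp
  rw [leafMetric_inv hp] at hss
  generalize M.leafMetric p.1 p.2 1 1 = R at *
  generalize M.leafMetric p.1 p.2 0 1 = Q at *
  generalize M.leafMetric p.1 p.2 0 0 = P at *
  generalize (M.leafMetric p.1 p.2).det = D at *
  have ha := M.a_pos _ hp (stereoS p.2)
  generalize M.a p.1 (stereoS p.2) = a at *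
  have hRs := Real.sq_sqrt hR.le
  have hDs := Real.sq_sqrt hD.le
  have hR0 := (Real.sqrt_pos.2 hR).ne'
  have hD0 := (Real.sqrt_pos.2 hD).ne'
  generalize √R = x at *
  generalize √D = z at *
  -- Gram–Schmidt within the leaf starting from `∂₂`, whose length is `√R`: the rows are `a⁻¹ ∂_u`,
  -- the unit vector of the leaf orthogonal to `∂₂`, and `∂₂ / √R`.
  refine ⟨!![a⁻¹, 0, 0; 0, x / z, -Q / (x * z); 0, 0, x⁻¹], fun i j => ?_⟩
  rw [Fin.sum_univ_three]
  subst hRs hDs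
  refine Fin.cases ?_ (fun A => ?_) i <;> refine Fin.cases ?_ (fun B => ?_) j
  · rw [h00]; simp; field_simp
  · rw [h0s]; fin_cases B <;> simp
  · rw [hs0]; fin_cases A <;> simp
  · rw [hss]
    fin_cases A <;> fin_cases B <;> simp <;> field_simp
    linarith

theorem differentiableAt_of_contDiffOn {f : Coord → ℝ} {n : ℕ∞ω} (hn : n ≠ 0)
    (hf : ContDiffOn ℝ n f (M.J ×ˢ Set.univ)) {p : Coord} (hp : p.1 ∈ M.J) :
    DifferentiableAt ℝ f p :=
  (hf.differentiableOn hn).differentiableAt (isOpen_coord M |>.mem_nhds ⟨hp, trivial⟩)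

theorem eventually_mem_J {p : Coord} (hp : p.1 ∈ M.J) : ∀ᶠ q : Coord in nhds p, q.1 ∈ M.J :=
  Filter.mem_of_superset (isOpen_coord M |>.mem_nhds ⟨hp, trivial⟩) fun _ hq => hq.1

theorem continuousOn_pd {n : ℕ∞ω} (hn : 1 ≤ n) {f : Coord → ℝ}
    (hf : ContDiffOn ℝ n f (M.J ×ˢ Set.univ)) (i : Fin 3) :
    ContinuousOn (pd i f) (M.J ×ˢ Set.univ) :=
  (hf.continuousOn_fderiv_of_isOpen (isOpen_coord M) hn).clm_apply continuousOn_const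

theorem continuousOn_christoffel (k i j : Fin 3) :
    ContinuousOn (christoffel M.metric k i j) (M.J ×ˢ Set.univ) := by
  refine continuousOn_const.mul (continuousOn_finsetSum _ fun l _ => ?_)
  have h (i j l : Fin 3) := continuousOn_pd (M := M) (by simp) (contDiffOn_metric i j) l
  exact (contDiffOn_metric_inv k l).continuousOn.mul (((h _ _ _).add (h _ _ _)).sub (h _ _ _))

/-! ### The norm of a tensor field on the leaves -/

section Tensor
variable {k : ℕ} {θ : LeafTensor k}

theorem _root_.FoliatedSobolev.LeafTensor.IsC1.contDiffOn_comp (hθ : θ.IsC1 M)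
    (I : Fin k → Fin 3) : ContDiffOn ℝ 1 (θ.comp I) (M.J ×ˢ Set.univ) := by
  have h1 := contDiffOn_coord (by simp) hθ
  have h2 := (ContinuousLinearMap.analyticOnNhd_uncurry_of_multilinear
    (ContinuousLinearMap.id ℝ (E3 [×k]→L[ℝ] ℝ)) (s := Set.univ)).contDiffOn (n := 1)
    uniqueDiffOn_univ
  have h3 : ContDiff ℝ 1 fun p : Coord => fun j => frame (I j) p.2 :=
    contDiff_pi.2 fun j => ((contDiff_frame (I j)).of_le (by simp)).comp contDiff_snd
  exact (contDiffOn_univ.1 h2).comp_contDiffOn (h1.prodMk h3.contDiffOn)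

variable (M θ) in
/-- The square `|θ|²` of the norm, as a function of the coordinates. -/
def normSq (p : Coord) : ℝ := contract (M.metric p)⁻¹ (θ.comp · p) (θ.comp · p)

theorem normSq_nonneg {p : Coord} (hp : p.1 ∈ M.J) : 0 ≤ M.normSq θ p := by
  obtain ⟨B, hB⟩ := exists_orthonormal_frame hp
  exact contract_self_nonneg hB _

theorem norm_sq_eq {p : Coord} (hp : p.1 ∈ M.J) : θ.norm M p ^ 2 = M.normSq θ p :=
  Real.sq_sqrt (normSq_nonneg hp)

theorem normDeriv_sq_eq {p : Coord} (hp : p.1 ∈ M.J) : θ.normDeriv M p ^ 2 =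
    contract (M.metric p)⁻¹ (covDeriv M.metric θ.comp · p) (covDeriv M.metric θ.comp · p) := by
  obtain ⟨B, hB⟩ := exists_orthonormal_frame hp
  exact Real.sq_sqrt (contract_self_nonneg hB _)

theorem contDiffOn_normSq (hθ : θ.IsC1 M) : ContDiffOn ℝ 1 (M.normSq θ) (M.J ×ˢ Set.univ) := by
  refine ContDiffOn.sum fun I _ => ContDiffOn.sum fun K _ => ?_
  refine (ContDiffOn.mul ?_ (hθ.contDiffOn_comp I)).mul (hθ.contDiffOn_comp K)
  exact contDiffOn_prod fun j _ => (contDiffOn_metric_inv _ _).of_le (by simp)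

theorem continuousOn_normDeriv (hθ : θ.IsC1 M) :
    ContinuousOn (θ.normDeriv M) (M.J ×ˢ Set.univ) := by
  have h (I : Fin (k + 1) → Fin 3) :
      ContinuousOn (covDeriv M.metric θ.comp I) (M.J ×ˢ Set.univ) := by
    refine (continuousOn_pd le_rfl (hθ.contDiffOn_comp _) _).sub
      (continuousOn_finsetSum _ fun j _ => continuousOn_finsetSum _ fun m _ => ?_)
    exact (continuousOn_christoffel _ _ _).mul (hθ.contDiffOn_comp _).continuousOn
  refine ContinuousOn.sqrt (continuousOn_finsetSum _ fun I _ =>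
    continuousOn_finsetSum _ fun K _ => ((continuousOn_finsetProd _ fun j _ => ?_).mul
      (h I)).mul (h K))
  exact (contDiffOn_metric_inv _ _).continuousOn

/-- The metric is block diagonal, so `|d|θ|²|²` splits into its part along `u` and its part along
the leaf. The square `|θ|²`, unlike `|θ|`, is `C¹` also at zeros of `θ`. -/
theorem kato (hθ : θ.IsC1 M) {p : Coord} (hp : p.1 ∈ M.J) :
    (pd 0 (M.normSq θ) p) ^ 2 / M.a p.1 (stereoS p.2) ^ 2 +
      (M.leafMetric p.1 p.2 1 1 * pd 1 (M.normSq θ) p ^ 2 -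
        2 * M.leafMetric p.1 p.2 0 1 * (pd 1 (M.normSq θ) p * pd 2 (M.normSq θ) p) +
        M.leafMetric p.1 p.2 0 0 * pd 2 (M.normSq θ) p ^ 2) / (M.leafMetric p.1 p.2).det ≤
      4 * M.normSq θ p * θ.normDeriv M p ^ 2 := by
  obtain ⟨B, hB⟩ := exists_orthonormal_frame hp
  have h := contract_pd_le
    (fun i j => differentiableAt_of_contDiffOn (by simp) (contDiffOn_metric i j) hp)
    (fun i j => differentiableAt_of_contDiffOn (by simp) (contDiffOn_metric_inv i j) hp)
    ((eventually_mem_J hp).mono fun q hq => metric_symm hq)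
    ((eventually_mem_J hp).mono fun q hq => metric_det_ne_zero hq) hB
    (fun I => differentiableAt_of_contDiffOn (by simp) (hθ.contDiffOn_comp I) hp)
  rw [← normDeriv_sq_eq hp] at h
  refine le_trans (le_of_eq ?_) h
  simp only [Fin.sum_univ_succ (n := 2), metric_inv_zero_zero hp, metric_inv_zero_succ hp,
    metric_inv_succ_zero hp, metric_inv_succ_succ hp, Fin.sum_univ_two, leafMetric_inv hp]
  change _ = _ * pd 0 (M.normSq θ) p * pd 0 (M.normSq θ) p + (0 * _ * _ + 0 * _ * _) +
    (0 * _ * _ + (_ * pd 1 (M.normSq θ) p * pd 1 (M.normSq θ) p +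
      _ * pd 1 (M.normSq θ) p * pd 2 (M.normSq θ) p) +
      (0 * _ * _ + (_ * pd 2 (M.normSq θ) p * pd 1 (M.normSq θ) p +
      _ * pd 2 (M.normSq θ) p * pd 2 (M.normSq θ) p)))
  simp
  ring

/-- The square of the norm of a covector on a leaf, times the determinant of the metric. -/
def cof (M : FoliatedCylinder) (u : ℝ) (y : E2) (s t : ℝ) : ℝ :=
  M.leafMetric u y 1 1 * s ^ 2 - 2 * M.leafMetric u y 0 1 * (s * t) + M.leafMetric u y 0 0 * t ^ 2

/-- The adjugate of a `2 × 2` matrix is its conjugate by a quarter turn, so the form is `γ` on the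
rotated vector `(t, -s)`. -/
theorem cof_nonneg {u : ℝ} (hu : u ∈ M.J) (y : E2) (s t : ℝ) : 0 ≤ M.cof u y s t := by
  have h : M.cof u y s t = M.γ u (stereoS y) (fderiv ℝ stereo y !₂[t, -s])
      (fderiv ℝ stereo y !₂[t, -s]) := by
    rw [← leafMetric_quadratic hu, cof]; ring
  rw [h]
  rcases eq_or_ne (fderiv ℝ stereo y !₂[t, -s]) 0 with h0 | h0
  · simp [h0]
  · exact (M.γ_pos u hu _ _ (isTangent_fderiv_stereo y _) h0).le

theorem cof_pd_normSq_le (hθ : θ.IsC1 M) {p : Coord} (hp : p.1 ∈ M.J) :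
    M.cof p.1 p.2 (pd 1 (M.normSq θ) p) (pd 2 (M.normSq θ) p) ≤
      (M.leafMetric p.1 p.2).det * (4 * M.normSq θ p * θ.normDeriv M p ^ 2) := by
  rw [← div_le_iff₀' (leafMetric_det_pos hp _)]
  refine le_trans (le_add_of_nonneg_left ?_) (kato hθ hp)
  positivity

theorem sq_pd_zero_normSq_le (hθ : θ.IsC1 M) {p : Coord} (hp : p.1 ∈ M.J) :
    pd 0 (M.normSq θ) p ^ 2 ≤
      M.a p.1 (stereoS p.2) ^ 2 * (4 * M.normSq θ p * θ.normDeriv M p ^ 2) := by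
  rw [← div_le_iff₀' (pow_pos (M.a_pos _ hp _) 2)]
  exact le_trans (le_add_of_nonneg_right
    (div_nonneg (cof_nonneg hp _ _ _) (leafMetric_det_pos hp _).le)) (kato hθ hp)

end Tensor

/-! ### The mean curvature -/

/-- Lowering the index cancels the inverse metric in the Christoffel symbol. The shift vanishes, so
the mixed derivatives drop out and only `∂_u γ` remains; the derivative of `a⁻¹` along the leaf
affects only the normal component. -/
theorem secondForm_eq {p : Coord} (hp : p.1 ∈ M.J) (A B : Fin 2) :
    M.secondForm p A B = (2 * M.a p.1 (stereoS p.2))⁻¹ *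
      pd 0 (fun q => M.leafMetric q.1 q.2 A B) p := by
  have hsymm (i j l : Fin 3) : pd l (fun q => M.metric q i j) p = pd l (fun q => M.metric q j i) p :=
    pd_congr ((eventually_mem_J hp).mono fun q hq => metric_symm hq i j)
  have hinv : M.metric p * (M.metric p)⁻¹ = 1 :=
    Matrix.mul_nonsing_inv _ (metric_det_ne_zero hp).isUnit
  have h1 (k : Fin 3) (hk : k ≠ 0) : covDerivVec M.metric M.unitNormal A.succ k p =
      christoffel M.metric k A.succ 0 p * (M.a p.1 (stereoS p.2))⁻¹ := by
    have h2 : M.unitNormal k = fun _ => 0 := by ext q; simp [unitNormal, hk]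
    rw [covDerivVec, h2, pd_const, zero_add, Fin.sum_univ_succ]
    simp [unitNormal]
  have h3 : M.secondForm p A B =
      (∑ k, M.metric p B.succ k * christoffel M.metric k A.succ 0 p) *
        (M.a p.1 (stereoS p.2))⁻¹ := by
    simp only [secondForm, Matrix.of_apply]
    rw [Fin.sum_univ_succ, metric_zero_succ, zero_mul, zero_add]
    conv_rhs => rw [Fin.sum_univ_succ, metric_succ_zero, zero_mul, zero_add, Finset.sum_mul]
    refine Finset.sum_congr rfl fun C _ => ?_
    rw [h1 _ (Fin.succ_ne_zero C), metric_symm hp C.succ B.succ]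
    ring
  have h4 : ∑ k, M.metric p B.succ k * christoffel M.metric k A.succ 0 p =
      (1 / 2) * (pd A.succ (fun q => M.metric q 0 B.succ) p +
        pd 0 (fun q => M.metric q A.succ B.succ) p -
        pd B.succ (fun q => M.metric q A.succ 0) p) := by
    simp only [christoffel, Finset.mul_sum]
    rw [Finset.sum_comm]
    have h5 (l : Fin 3) (x : ℝ) : ∑ k, M.metric p B.succ k * (1 / 2 * ((M.metric p)⁻¹ k l * x)) =
        (1 / 2) * ((1 : Matrix (Fin 3) (Fin 3) ℝ) B.succ l * x) := by
      rw [← hinv, Matrix.mul_apply, Finset.sum_mul, Finset.mul_sum]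
      exact Finset.sum_congr rfl fun k _ => by ring
    simp only [h5, Matrix.one_apply, ite_mul, one_mul, zero_mul, mul_ite, mul_zero]
    simp
  rw [h3, h4]
  simp only [metric_zero_succ, metric_succ_zero, pd_const, metric_succ_succ, mul_inv]
  ring

/-- First variation of area: `∂_u √(det γ) = ½ tr(γ⁻¹ ∂_u γ) √(det γ)`, and `½ ∂_u γ` is `a` times
the second fundamental form. -/
theorem pd_areaDensity {p : Coord} (hp : p.1 ∈ M.J) :
    pd 0 (fun q => M.areaDensity q.1 q.2) p =
      M.a p.1 (stereoS p.2) * M.meanCurvature p * M.areaDensity p.1 p.2 := by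
  have hD := leafMetric_det_pos hp p.2
  have hsymm : pd 0 (fun q => M.leafMetric q.1 q.2 1 0) p =
      pd 0 (fun q => M.leafMetric q.1 q.2 0 1) p :=
    pd_congr ((eventually_mem_J hp).mono fun q hq => leafMetric_symm hq _ _ _)
  have hd (A B : Fin 2) :=
    differentiableAt_of_contDiffOn (by simp) (contDiffOn_leafMetric (M := M) A B) hp
  have hdd := differentiableAt_of_contDiffOn (by simp) (contDiffOn_leafMetric_det (M := M)) hp
  have h1 : pd 0 (fun q => M.areaDensity q.1 q.2) p =
      (1 / (2 * M.areaDensity p.1 p.2)) * pd 0 (fun q => (M.leafMetric q.1 q.2).det) p := by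
    simp only [areaDensity, pd]
    rw [fderiv_sqrt hdd hD.ne']
    simp
  have h2 : pd 0 (fun q => (M.leafMetric q.1 q.2).det) p =
      pd 0 (fun q => M.leafMetric q.1 q.2 0 0) p * M.leafMetric p.1 p.2 1 1 +
      M.leafMetric p.1 p.2 0 0 * pd 0 (fun q => M.leafMetric q.1 q.2 1 1) p -
      2 * M.leafMetric p.1 p.2 0 1 * pd 0 (fun q => M.leafMetric q.1 q.2 0 1) p := by
    simp only [Matrix.det_fin_two]
    have h3 : pd 0 (fun q => M.leafMetric q.1 q.2 0 0 * M.leafMetric q.1 q.2 1 1 -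
        M.leafMetric q.1 q.2 0 1 * M.leafMetric q.1 q.2 1 0) p =
        pd 0 (fun q => M.leafMetric q.1 q.2 0 0 * M.leafMetric q.1 q.2 1 1) p -
        pd 0 (fun q => M.leafMetric q.1 q.2 0 1 * M.leafMetric q.1 q.2 1 0) p := by
      simp only [pd]
      rw [fderiv_fun_sub ((hd _ _).fun_mul (hd _ _)) ((hd _ _).fun_mul (hd _ _))]
      rfl
    rw [h3, pd_mul (hd _ _) (hd _ _), pd_mul (hd _ _) (hd _ _), hsymm, leafMetric_symm hp p.2 1 0]
    ring
  have ha := (M.a_pos _ hp (stereoS p.2)).ne'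
  have hA := (areaDensity_pos hp p.2).ne'
  have hA2 := areaDensity_sq hp p.2
  rw [h1, h2, meanCurvature, Fin.sum_univ_two, Fin.sum_univ_two, Fin.sum_univ_two,
    secondForm_eq hp, secondForm_eq hp, secondForm_eq hp, secondForm_eq hp, hsymm,
    leafMetric_inv hp, ← hA2]
  simp
  field_simp
  ring

end FoliatedCylinder

/-! ### Cut-off functions -/

/-- At these points the function attains its minimum `0` or its maximum `1`. -/
theorem deriv_smoothTransition_eq_zero {s : ℝ} (hs : s ≤ 0 ∨ 1 ≤ s) :
    deriv Real.smoothTransition s = 0 := by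
  rcases hs with hs | hs
  · refine IsLocalMin.deriv_eq_zero (Filter.Eventually.of_forall fun x => ?_)
    rw [Real.smoothTransition.zero_of_nonpos hs]
    exact Real.smoothTransition.nonneg x
  · refine IsLocalMax.deriv_eq_zero (Filter.Eventually.of_forall fun x => ?_)
    rw [Real.smoothTransition.one_of_one_le hs]
    exact Real.smoothTransition.le_one x

theorem exists_deriv_smoothTransition_le :
    ∃ L : ℝ, 0 < L ∧ ∀ s, |deriv Real.smoothTransition s| ≤ L := by
  have hc : Continuous (deriv Real.smoothTransition) :=
    (Real.smoothTransition.contDiff (n := 1)).continuous_deriv le_rfl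
  obtain ⟨C, hC⟩ := (isCompact_Icc (a := (0 : ℝ)) (b := 1)).exists_bound_of_continuousOn
    hc.continuousOn
  refine ⟨max C 1, by positivity, fun s => ?_⟩
  by_cases hs : s ∈ Set.Icc (0 : ℝ) 1
  · exact (hC s hs).trans (le_max_left _ _)
  · rw [deriv_smoothTransition_eq_zero, abs_zero]
    · positivity
    · rw [Set.mem_Icc, not_and_or] at hs
      rcases hs with hs | hs
      · exact Or.inl (by linarith)
      · exact Or.inr (by linarith)

/-- A bound for the derivative of the smooth transition function. -/
def transitionBound : ℝ := exists_deriv_smoothTransition_le.choose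

theorem transitionBound_pos : 0 < transitionBound :=
  exists_deriv_smoothTransition_le.choose_spec.1

theorem abs_deriv_smoothTransition_le (s : ℝ) :
    |deriv Real.smoothTransition s| ≤ transitionBound :=
  exists_deriv_smoothTransition_le.choose_spec.2 s

/-- Partial derivative in the plane. -/
def pd2 (A : Fin 2) (f : E2 → ℝ) (y : E2) : ℝ := fderiv ℝ f y (EuclideanSpace.single A 1)

theorem pd2_mul {A : Fin 2} {f g : E2 → ℝ} {y : E2} (hf : DifferentiableAt ℝ f y)
    (hg : DifferentiableAt ℝ g y) :
    pd2 A (fun z => f z * g z) y = f y * pd2 A g y + g y * pd2 A f y := by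
  simp [pd2, fderiv_fun_mul hf hg]

theorem pd2_comp {A : Fin 2} {ρ : ℝ → ℝ} {f : E2 → ℝ} {y : E2} (hρ : DifferentiableAt ℝ ρ (f y))
    (hf : DifferentiableAt ℝ f y) :
    pd2 A (fun z => ρ (f z)) y = deriv ρ (f y) * pd2 A f y := by
  have := (hρ.hasDerivAt.comp_hasFDerivAt y hf.hasFDerivAt).fderiv
  rw [pd2, pd2]
  simp only [Function.comp_def] at this
  rw [this]; simp

theorem continuous_pd2 {A : Fin 2} {f : E2 → ℝ} (hf : ContDiff ℝ 1 f) : Continuous (pd2 A f) :=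
  (hf.continuous_fderiv one_ne_zero).clm_apply continuous_const

/-- A cut-off function on the plane, equal to one in the disc of radius `n + 1`. -/
def cutoff (n : ℕ) (y : E2) : ℝ := Real.smoothTransition (2 - ‖y‖ ^ 2 / ((n : ℝ) + 1) ^ 2)

theorem contDiff_cutoff (n : ℕ) : ContDiff ℝ ∞ (cutoff n) :=
  Real.smoothTransition.contDiff.comp
    (contDiff_const.sub ((contDiff_norm_sq ℝ).div_const _))

theorem cutoff_nonneg (n : ℕ) (y : E2) : 0 ≤ cutoff n y := Real.smoothTransition.nonneg _

theorem cutoff_le_one (n : ℕ) (y : E2) : cutoff n y ≤ 1 := Real.smoothTransition.le_one _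

theorem hasCompactSupport_cutoff (n : ℕ) : HasCompactSupport (cutoff n) := by
  refine HasCompactSupport.of_support_subset_isCompact
    (isCompact_closedBall (0 : E2) (2 * (n + 1))) fun y hy => ?_
  by_contra h
  refine hy (Real.smoothTransition.zero_of_nonpos ?_)
  rw [mem_closedBall_zero_iff, not_le] at h
  have h1 : (2 * ((n : ℝ) + 1)) ^ 2 ≤ ‖y‖ ^ 2 := by gcongr
  rw [sub_nonpos, le_div_iff₀ (by positivity)]
  nlinarith [sq_nonneg ((n : ℝ) + 1)]

theorem tendsto_cutoff (y : E2) : Filter.Tendsto (fun n => cutoff n y) Filter.atTop (nhds 1) := by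
  refine tendsto_const_nhds.congr' ?_
  obtain ⟨N, hN⟩ := exists_nat_ge ‖y‖
  filter_upwards [Filter.eventually_ge_atTop N] with n hn
  refine (Real.smoothTransition.one_of_one_le ?_).symm
  have h1 : ‖y‖ ≤ n + 1 := hN.trans (by have : (N : ℝ) ≤ n := by exact_mod_cast hn
                                        linarith)
  have h2 : ‖y‖ ^ 2 / ((n : ℝ) + 1) ^ 2 ≤ 1 := by
    rw [div_le_one (by positivity)]; gcongr
  linarith

theorem pd2_cutoff (n : ℕ) (A : Fin 2) (y : E2) :
    pd2 A (cutoff n) y = deriv Real.smoothTransition (2 - ‖y‖ ^ 2 / ((n : ℝ) + 1) ^ 2) *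
      (-(2 * y A) / ((n : ℝ) + 1) ^ 2) := by
  have h1 : HasFDerivAt (fun y : E2 => 2 - ‖y‖ ^ 2 * (((n : ℝ) + 1) ^ 2)⁻¹)
      (-((((n : ℝ) + 1) ^ 2)⁻¹ • (2 • innerSL ℝ y))) y := by
    simpa using ((hasStrictFDerivAt_norm_sq y).hasFDerivAt.mul_const _).const_sub 2
  have h2 := pd2_comp (A := A) (f := fun y : E2 => 2 - ‖y‖ ^ 2 / ((n : ℝ) + 1) ^ 2)
    ((Real.smoothTransition.contDiff (n := 1)).differentiable one_ne_zero _)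
    (by simpa only [div_eq_mul_inv] using h1.differentiableAt)
  refine h2.trans ?_
  congr 1
  simp only [pd2, div_eq_mul_inv]
  rw [h1.fderiv]
  simp [EuclideanSpace.inner_single_right]
  ring

theorem pd2_cutoff_eq_zero {n : ℕ} {A : Fin 2} {y : E2} (hy : ‖y‖ ≤ n + 1) :
    pd2 A (cutoff n) y = 0 := by
  rw [pd2_cutoff, deriv_smoothTransition_eq_zero, zero_mul]
  right
  have h2 : ‖y‖ ^ 2 / ((n : ℝ) + 1) ^ 2 ≤ 1 := by
    rw [div_le_one (by positivity)]; gcongr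
  linarith

/-- Where the gradient lives, `|y|² ≤ 2m` with `m = (n + 1)² ≥ 1`, so `4 |y|² (1 + |y|²) ≤ 8m + 16m²
≤ 24 m²`. A bound free of `n` is what dominated convergence requires. -/
theorem pd2_cutoff_sq_le (n : ℕ) (y : E2) :
    pd2 0 (cutoff n) y ^ 2 + pd2 1 (cutoff n) y ^ 2 ≤
      24 * transitionBound ^ 2 / (1 + ‖y‖ ^ 2) := by
  have hL := transitionBound_pos
  rw [pd2_cutoff, pd2_cutoff]
  have hn : (1 : ℝ) ≤ ((n : ℝ) + 1) ^ 2 := by nlinarith [Nat.cast_nonneg (α := ℝ) n]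
  set m : ℝ := ((n : ℝ) + 1) ^ 2 with hm
  by_cases h : 2 - ‖y‖ ^ 2 / m ≤ 0
  · rw [deriv_smoothTransition_eq_zero (Or.inl h)]
    simp; positivity
  · have hy2 : ‖y‖ ^ 2 ≤ 2 * m := by
      have : ‖y‖ ^ 2 / m < 2 := by linarith
      rw [div_lt_iff₀ (by positivity)] at this
      exact this.le
    have hy : y 0 ^ 2 + y 1 ^ 2 = ‖y‖ ^ 2 := by
      rw [EuclideanSpace.norm_sq_eq]; simp [Fin.sum_univ_two]
    have hd : deriv Real.smoothTransition (2 - ‖y‖ ^ 2 / m) ^ 2 ≤ transitionBound ^ 2 :=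
      sq_le_sq' (abs_le.1 (abs_deriv_smoothTransition_le _)).1
        (abs_le.1 (abs_deriv_smoothTransition_le _)).2
    generalize deriv Real.smoothTransition (2 - ‖y‖ ^ 2 / m) = ρ at hd ⊢
    have h1 : (ρ * (-(2 * y 0) / m)) ^ 2 + (ρ * (-(2 * y 1) / m)) ^ 2 =
        ρ ^ 2 * (4 * ‖y‖ ^ 2 / m ^ 2) := by rw [← hy]; field_simp; ring
    rw [h1, mul_comm (24 : ℝ), mul_div_assoc (_ ^ 2) (24 : ℝ)]
    refine mul_le_mul hd ?_ (by positivity) (by positivity)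
    rw [div_le_div_iff₀ (by positivity) (by positivity)]
    nlinarith [sq_nonneg ‖y‖]

namespace FoliatedCylinder
variable {M : FoliatedCylinder}

/-! ### The divergence theorem on a leaf -/

theorem contDiff_leaf {V : Type*} [NormedAddCommGroup V] [NormedSpace ℝ V] {n : ℕ∞ω}
    {f : Coord → V} (hf : ContDiffOn ℝ n f (M.J ×ˢ Set.univ)) {u : ℝ} (hu : u ∈ M.J) :
    ContDiff ℝ n fun y => f (u, y) :=
  contDiffOn_univ.1 (hf.comp (contDiff_prodMk_right u).contDiffOn fun _ _ => ⟨hu, trivial⟩)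

theorem continuous_areaDensity {u : ℝ} (hu : u ∈ M.J) : Continuous (M.areaDensity u) :=
  (contDiff_leaf contDiffOn_areaDensity hu).continuous

theorem contDiff_vecComp {u : ℝ} (hu : u ∈ M.J) {Y : S2 → E3}
    (hY : ContMDiff (𝓡 2) 𝓘(ℝ, E3) ∞ Y) (A : Fin 2) :
    ContDiff ℝ ∞ fun y => M.areaDensity u y * M.vecComp u Y A y := by
  refine (contDiff_leaf contDiffOn_areaDensity hu).mul (ContDiff.sum fun B _ => ?_)
  refine (contDiff_leaf (contDiffOn_leafMetric_inv A B) hu).mul ?_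
  exact ((contDiff_leaf (contDiffOn_coord le_rfl M.γ_smooth) hu).clm_apply
    (contDiff_coord hY)).clm_apply (contDiff_frame _)

/-- Cauchy–Schwarz `|Y f| ≤ |Y| |df|` with `|Y| ≤ 1`, multiplied by the area density. -/
theorem abs_pairing_le {u : ℝ} (hu : u ∈ M.J) {Y : S2 → E3} (hY : M.IsTestField u Y) (y : E2)
    (s t : ℝ) :
    |M.areaDensity u y * M.vecComp u Y 0 y * s + M.areaDensity u y * M.vecComp u Y 1 y * t| ≤
      √(M.cof u y s t) := by
  obtain ⟨-, hYt, hY1⟩ := hY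
  have hYt := hYt (stereoS y)
  have hY1 := hY1 (stereoS y)
  have hD := leafMetric_det_pos hu y
  have hDe := leafMetric_det hu y
  have hA2 := areaDensity_sq hu y
  set P := M.leafMetric u y 0 0 with hP
  set Q := M.leafMetric u y 0 1 with hQ
  set R := M.leafMetric u y 1 1 with hR
  set D := (M.leafMetric u y).det with hDD
  set b := M.γ u (stereoS y) (Y (stereoS y)) (frame 1 y) with hb
  set c := M.γ u (stereoS y) (Y (stereoS y)) (frame 2 y) with hc
  have hv0 : M.vecComp u Y 0 y = (R * b - Q * c) / D := by
    rw [vecComp, leafMetric_inv hu, Fin.sum_univ_two]; simp [← hb, ← hc]; ring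
  have hv1 : M.vecComp u Y 1 y = (P * c - Q * b) / D := by
    rw [vecComp, leafMetric_inv hu, Fin.sum_univ_two]; simp [← hb, ← hc]; ring
  have hbound : M.cof u y b c ≤ D := by
    -- Bessel's inequality: `Z` is `D` times the difference of `Y` and its projection to the frame,
    -- and `γ(Z, Z) ≥ 0`. That the frame spans the tangent plane is not needed.
    set Z := D • Y (stereoS y) - ((R * b - Q * c) • frame 1 y + (P * c - Q * b) • frame 2 y)
    have hZt : IsTangent (stereoS y) Z := by
      have h1 := isTangent_frame 1 y
      have h2 := isTangent_frame 2 y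
      simp only [IsTangent, Z, inner_sub_right, inner_add_right, inner_smul_right] at *
      rw [hYt, h1, h2]; ring
    have hZ : 0 ≤ M.γ u (stereoS y) Z Z := by
      rcases eq_or_ne Z 0 with h0 | h0
      · simp [h0]
      · exact (M.γ_pos u hu _ _ hZt h0).le
    have e11 : M.γ u (stereoS y) (frame 1 y) (frame 1 y) = P := (leafMetric_apply M u y 0 0).symm
    have e12 : M.γ u (stereoS y) (frame 1 y) (frame 2 y) = Q := (leafMetric_apply M u y 0 1).symm
    have e21 : M.γ u (stereoS y) (frame 2 y) (frame 1 y) = Q :=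
      (leafMetric_apply M u y 1 0).symm.trans (leafMetric_symm hu y 1 0)
    have e22 : M.γ u (stereoS y) (frame 2 y) (frame 2 y) = R := (leafMetric_apply M u y 1 1).symm
    have eb : M.γ u (stereoS y) (frame 1 y) (Y (stereoS y)) = b :=
      M.γ_symm u hu _ _ _ (isTangent_frame 1 y) hYt
    have ec : M.γ u (stereoS y) (frame 2 y) (Y (stereoS y)) = c :=
      M.γ_symm u hu _ _ _ (isTangent_frame 2 y) hYt
    have hexp : M.γ u (stereoS y) Z Z =
        D * (D * M.γ u (stereoS y) (Y (stereoS y)) (Y (stereoS y)) - M.cof u y b c) := by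
      simp only [Z, map_sub, map_add, map_smul, sub_apply, add_apply, smul_apply, smul_eq_mul,
        e11, e12, e21, e22, eb, ec, ← hb, ← hc, cof, ← hP, ← hQ, ← hR]
      rw [hDe]
      ring
    rw [hexp] at hZ
    have := nonneg_of_mul_nonneg_right hZ hD
    nlinarith
  -- Lagrange's identity for the cofactor form; the defect is `D (bt - cs)²`.
  have hcs : (R * b * s - Q * (b * t + c * s) + P * c * t) ^ 2 ≤
      M.cof u y b c * M.cof u y s t := by
    have : M.cof u y b c * M.cof u y s t -
        (R * b * s - Q * (b * t + c * s) + P * c * t) ^ 2 = D * (b * t - c * s) ^ 2 := by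
      simp only [cof, ← hP, ← hQ, ← hR, hDe]; ring
    nlinarith [mul_nonneg hD.le (sq_nonneg (b * t - c * s))]
  have hcof := cof_nonneg hu y s t
  refine Real.abs_le_sqrt ?_
  have hfin : (M.areaDensity u y * M.vecComp u Y 0 y * s +
      M.areaDensity u y * M.vecComp u Y 1 y * t) ^ 2 =
      (R * b * s - Q * (b * t + c * s) + P * c * t) ^ 2 / D := by
    rw [hv0, hv1, ← hA2]
    have := (areaDensity_pos hu y).ne'
    field_simp
    ring
  rw [hfin, div_le_iff₀ hD]
  nlinarith [mul_le_mul_of_nonneg_right hbound hcof]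

theorem continuous_cof {u : ℝ} (hu : u ∈ M.J) {s t : E2 → ℝ} (hs : Continuous s)
    (ht : Continuous t) : Continuous fun y => M.cof u y (s y) (t y) := by
  have h (A B : Fin 2) := (contDiff_leaf (contDiffOn_leafMetric A B) hu).continuous
  exact (((h 1 1).mul (hs.pow 2)).sub ((continuous_const.mul (h 0 1)).mul (hs.mul ht))).add
    ((h 0 0).mul (ht.pow 2))

theorem exists_cof_le {u : ℝ} (hu : u ∈ M.J) : ∃ C : ℝ, 0 ≤ C ∧ ∀ y s t,
    M.cof u y s t ≤ C / (1 + ‖y‖ ^ 2) ^ 2 * (s ^ 2 + t ^ 2) := by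
  obtain ⟨C, hC0, hC⟩ := exists_leafMetric_le (isCompact_singleton (x := u))
    (Set.singleton_subset_iff.2 hu)
  refine ⟨8 * C, by positivity, fun y s t => ?_⟩
  have hP := abs_le.1 (hC u rfl y 0 0)
  have hQ := abs_le.1 (hC u rfl y 0 1)
  have hR := abs_le.1 (hC u rfl y 1 1)
  rw [show C * (2 / (1 + ‖y‖ ^ 2)) ^ 2 = 4 * C / (1 + ‖y‖ ^ 2) ^ 2 by
    rw [div_pow]; ring] at hP hQ hR
  rw [show 8 * C / (1 + ‖y‖ ^ 2) ^ 2 = 2 * (4 * C / (1 + ‖y‖ ^ 2) ^ 2) by ring, cof]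
  generalize 4 * C / (1 + ‖y‖ ^ 2) ^ 2 = m at *
  nlinarith [mul_nonneg (sub_nonneg.2 hP.2) (sq_nonneg t),
    mul_nonneg (sub_nonneg.2 hR.2) (sq_nonneg s),
    mul_nonneg (sub_nonneg.2 hQ.2) (sq_nonneg (s - t)),
    mul_nonneg (by linarith [hQ.1] : 0 ≤ m + M.leafMetric u y 0 1) (sq_nonneg (s + t))]

/-- The missing pole has zero capacity. The `γ`-norm of the cut-off gradient times the area density
is at most a multiple of `(1 + |y|²)^(-3/2)`, which is integrable over the plane, and at each `y` it
vanishes for large `n`. -/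
theorem tendsto_lintegral_cutoff {u : ℝ} (hu : u ∈ M.J) :
    Filter.Tendsto (fun n : ℕ => ∫⁻ y, ENNReal.ofReal
      √(M.cof u y (pd2 0 (cutoff n) y) (pd2 1 (cutoff n) y))) Filter.atTop (nhds 0) := by
  obtain ⟨C, hC0, hC⟩ := exists_cof_le hu
  set K := √(C * (24 * transitionBound ^ 2)) with hK
  have hint : Integrable (fun y : E2 => ((1 : ℝ) + ‖y‖ ^ 2) ^ (-(3 : ℝ) / 2)) :=
    integrable_rpow_neg_one_add_norm_sq (by simp; norm_num)
  have hlim := tendsto_lintegral_of_dominated_convergence (μ := (volume : Measure E2))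
    (F := fun (n : ℕ) y => ENNReal.ofReal
      √(M.cof u y (pd2 0 (cutoff n) y) (pd2 1 (cutoff n) y))) (f := fun _ => 0)
    (fun y => ENNReal.ofReal (K * ((1 : ℝ) + ‖y‖ ^ 2) ^ (-(3 : ℝ) / 2)))
    (fun n => ?_) (fun n => Filter.Eventually.of_forall fun y => ?_) ?_
    (Filter.Eventually.of_forall fun y => ?_)
  · simpa using hlim
  · have h (A : Fin 2) := continuous_pd2 (A := A) ((contDiff_cutoff n).of_le (by simp))
    exact (continuous_cof hu (h 0) (h 1)).sqrt.measurable.ennreal_ofReal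
  · refine ENNReal.ofReal_le_ofReal (Real.sqrt_le_iff.2 ⟨by positivity, ?_⟩)
    have hp : (0 : ℝ) < 1 + ‖y‖ ^ 2 := by positivity
    have h3 : ((((1 : ℝ) + ‖y‖ ^ 2) ^ (-(3 : ℝ) / 2)) ^ 2) = ((1 + ‖y‖ ^ 2) ^ 3)⁻¹ := by
      generalize (1 : ℝ) + ‖y‖ ^ 2 = x at hp
      rw [← Real.rpow_natCast, ← Real.rpow_mul hp.le, ← Real.rpow_natCast, ← Real.rpow_neg hp.le]
      norm_num
    rw [mul_pow, h3, hK, Real.sq_sqrt (by positivity)]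
    refine (hC y _ _).trans ((mul_le_mul_of_nonneg_left (pd2_cutoff_sq_le n y)
      (by positivity)).trans (le_of_eq ?_))
    field_simp
  · exact (hint.const_mul K).lintegral_lt_top.ne
  · refine tendsto_const_nhds.congr' ?_
    obtain ⟨N, hN⟩ := exists_nat_ge ‖y‖
    filter_upwards [Filter.eventually_ge_atTop N] with n hn
    have h1 : ‖y‖ ≤ n + 1 := hN.trans (by have : (N : ℝ) ≤ n := by exact_mod_cast hn
                                          linarith)
    rw [pd2_cutoff_eq_zero h1, pd2_cutoff_eq_zero h1]
    simp [cof]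

theorem continuous_divDensity {u : ℝ} (hu : u ∈ M.J) {Y : S2 → E3}
    (hY : ContMDiff (𝓡 2) 𝓘(ℝ, E3) ∞ Y) : Continuous (M.divDensity u Y) :=
  continuous_finsetSum _ fun A _ =>
    continuous_pd2 (A := A) ((contDiff_vecComp hu hY A).of_le (by simp))

theorem integral_mul_divDensity {u : ℝ} (hu : u ∈ M.J) {Y : S2 → E3}
    (hY : ContMDiff (𝓡 2) 𝓘(ℝ, E3) ∞ Y) {g : E2 → ℝ} (hg : ContDiff ℝ 1 g)
    (hgs : HasCompactSupport g) :
    ∫ y, g y * M.divDensity u Y y = ∫ y, -(M.areaDensity u y * M.vecComp u Y 0 y * pd2 0 g y +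
      M.areaDensity u y * M.vecComp u Y 1 y * pd2 1 g y) := by
  have hV (A : Fin 2) : ContDiff ℝ 1 (fun y => M.areaDensity u y * M.vecComp u Y A y) :=
    (contDiff_vecComp hu hY A).of_le (by simp)
  have hs (A : Fin 2) : HasCompactSupport (pd2 A g) :=
    hgs.fderiv_apply ℝ _
  have h1 (A : Fin 2) : Integrable fun y => pd2 A g y * (M.areaDensity u y * M.vecComp u Y A y) :=
    ((continuous_pd2 hg).mul (hV A).continuous).integrable_of_hasCompactSupport (hs A).mul_right
  have h2 (A : Fin 2) : Integrable fun y =>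
      g y * pd2 A (fun y => M.areaDensity u y * M.vecComp u Y A y) y :=
    (hg.continuous.mul (continuous_pd2 (hV A))).integrable_of_hasCompactSupport hgs.mul_right
  have h3 (A : Fin 2) : Integrable fun y => g y * (M.areaDensity u y * M.vecComp u Y A y) :=
    (hg.continuous.mul (hV A).continuous).integrable_of_hasCompactSupport hgs.mul_right
  have h4 (A : Fin 2) : ∫ y, g y * pd2 A (fun y => M.areaDensity u y * M.vecComp u Y A y) y =
      - ∫ y, pd2 A g y * (M.areaDensity u y * M.vecComp u Y A y) :=
    integral_mul_fderiv_eq_neg_fderiv_mul_of_integrable (h1 A) (h2 A) (h3 A)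
      (fun x _ => hg.differentiable one_ne_zero x)
      (fun x _ => (hV A).differentiable one_ne_zero x)
  have h5 : (fun y => g y * M.divDensity u Y y) = fun y =>
      g y * pd2 0 (fun y => M.areaDensity u y * M.vecComp u Y 0 y) y +
      g y * pd2 1 (fun y => M.areaDensity u y * M.vecComp u Y 1 y) y := by
    ext y; rw [divDensity, Fin.sum_univ_two, mul_add]; rfl
  rw [h5, integral_add (h2 0) (h2 1), h4, h4, ← neg_add, ← integral_add (h1 0) (h1 1),
    ← integral_neg]
  congr 1
  ext y
  ring

theorem abs_pairing_mul_le {u : ℝ} (hu : u ∈ M.J) {Y : S2 → E3} (hY : M.IsTestField u Y) {g χ : E2 → ℝ}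
    (y : E2) (hg : DifferentiableAt ℝ g y) (hχ : DifferentiableAt ℝ χ y) (hg1 : |g y| ≤ 1)
    (hχ1 : |χ y| ≤ 1) :
    |M.areaDensity u y * M.vecComp u Y 0 y * pd2 0 (fun z => χ z * g z) y +
      M.areaDensity u y * M.vecComp u Y 1 y * pd2 1 (fun z => χ z * g z) y| ≤
      √(M.cof u y (pd2 0 g y) (pd2 1 g y)) + √(M.cof u y (pd2 0 χ y) (pd2 1 χ y)) := by
  have h1 := abs_pairing_le hu hY y (pd2 0 g y) (pd2 1 g y)
  have h2 := abs_pairing_le hu hY y (pd2 0 χ y) (pd2 1 χ y)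
  rw [pd2_mul hχ hg, pd2_mul hχ hg]
  set a := M.areaDensity u y * M.vecComp u Y 0 y
  set b := M.areaDensity u y * M.vecComp u Y 1 y
  have h3 : |χ y * (a * pd2 0 g y + b * pd2 1 g y)| ≤ √(M.cof u y (pd2 0 g y) (pd2 1 g y)) := by
    rw [abs_mul]
    exact (mul_le_of_le_one_left (abs_nonneg _) hχ1).trans h1
  have h4 : |g y * (a * pd2 0 χ y + b * pd2 1 χ y)| ≤ √(M.cof u y (pd2 0 χ y) (pd2 1 χ y)) := by
    rw [abs_mul]
    exact (mul_le_of_le_one_left (abs_nonneg _) hg1).trans h2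
  have h5 := abs_add_le (χ y * (a * pd2 0 g y + b * pd2 1 g y))
    (g y * (a * pd2 0 χ y + b * pd2 1 χ y))
  refine le_trans (le_of_eq ?_) (h5.trans (add_le_add h3 h4))
  congr 1
  ring

/-- The divergence theorem on a leaf, as an estimate. -/
theorem ofReal_integral_mul_divDensity_le {u : ℝ} (hu : u ∈ M.J) {Y : S2 → E3}
    (hY : M.IsTestField u Y) {g : E2 → ℝ} (hg : ContDiff ℝ 1 g) (hg1 : ∀ y, |g y| ≤ 1)
    (hint : Integrable fun y => g y * M.divDensity u Y y) :
    ENNReal.ofReal (∫ y, g y * M.divDensity u Y y) ≤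
      ∫⁻ y, ENNReal.ofReal √(M.cof u y (pd2 0 g y) (pd2 1 g y)) := by
  have hχ (n : ℕ) : ContDiff ℝ 1 (cutoff n) := (contDiff_cutoff n).of_le (by simp)
  -- Cutting off near the pole makes the integration by parts compactly supported; the extra
  -- gradient term tends to zero with the integral of the cut-off gradient.
  have hlim : Filter.Tendsto (fun n : ℕ => ∫ y, (cutoff n y * g y) * M.divDensity u Y y)
      Filter.atTop (nhds (∫ y, g y * M.divDensity u Y y)) := by
    refine tendsto_integral_of_dominated_convergence (fun y => ‖g y * M.divDensity u Y y‖)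
      (fun n => ?_) hint.norm (fun n => Filter.Eventually.of_forall fun y => ?_)
      (Filter.Eventually.of_forall fun y => ?_)
    · exact (((hχ n).continuous.mul hg.continuous).mul
        (continuous_divDensity hu hY.1)).aestronglyMeasurable
    · rw [mul_assoc, norm_mul]
      refine mul_le_of_le_one_left (norm_nonneg _) ?_
      rw [Real.norm_eq_abs, abs_of_nonneg (cutoff_nonneg n y)]
      exact cutoff_le_one n y
    · simpa [mul_assoc] using (tendsto_cutoff y).mul_const (g y * M.divDensity u Y y)
  refine le_of_tendsto_of_tendsto' (ENNReal.tendsto_ofReal hlim)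
    (by simpa using tendsto_const_nhds.add (tendsto_lintegral_cutoff hu)) fun n => ?_
  rw [integral_mul_divDensity hu hY.1 ((hχ n).mul hg) (hasCompactSupport_cutoff n).mul_right]
  rw [← lintegral_add_left]
  · refine (Real.ofReal_le_enorm _).trans ((enorm_integral_le_lintegral_enorm _).trans
      (lintegral_mono fun y => ?_))
    rw [enorm_neg, ← ofReal_norm,
      ← ENNReal.ofReal_add (Real.sqrt_nonneg _) (Real.sqrt_nonneg _)]
    refine ENNReal.ofReal_le_ofReal (abs_pairing_mul_le hu hY y (hg.differentiable one_ne_zero y)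
      ((hχ n).differentiable one_ne_zero y) (hg1 y) ?_)
    rw [abs_of_nonneg (cutoff_nonneg n y)]
    exact cutoff_le_one n y
  · have h (A : Fin 2) := continuous_pd2 (A := A) hg
    exact (continuous_cof hu (h 0) (h 1)).sqrt.measurable.ennreal_ofReal

end FoliatedCylinder

/-! ### Level sets -/

section LevelSets
variable {X : Type*} [MeasurableSpace X] {μ : Measure X}

theorem measurableSet_between {f : X → ℝ} (hf : Measurable f) (ε : ℝ) :
    MeasurableSet {p : ℝ × X | p.1 < f p.2 ∧ f p.2 < p.1 + ε} :=
  (measurableSet_lt measurable_fst (hf.comp measurable_snd)).inter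
    (measurableSet_lt (hf.comp measurable_snd) (measurable_fst.add_const ε))

theorem setLIntegral_between_eq {f : X → ℝ} (hf : Measurable f) (H : X → ℝ≥0∞) (ε t : ℝ) :
    ∫⁻ y in {y | t < f y ∧ f y < t + ε}, H y ∂μ =
      ∫⁻ y, {p : ℝ × X | p.1 < f p.2 ∧ f p.2 < p.1 + ε}.indicator (fun p => H p.2) (t, y) ∂μ := by
  have hm : MeasurableSet {y | t < f y ∧ f y < t + ε} :=
    (measurableSet_between hf ε).preimage measurable_prodMk_left
  rw [← lintegral_indicator hm]
  rfl

variable [SFinite μ]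

theorem measurable_setLIntegral_between {f : X → ℝ} (hf : Measurable f) {H : X → ℝ≥0∞}
    (hH : Measurable H) (ε : ℝ) :
    Measurable fun t => ∫⁻ y in {y | t < f y ∧ f y < t + ε}, H y ∂μ := by
  simp only [setLIntegral_between_eq hf]
  exact ((hH.comp measurable_snd).indicator (measurableSet_between hf ε)).lintegral_prod_right'

/-- Tonelli: a point `y` lies in the band exactly for `t` in the interval `(f y - ε, f y)`. -/
theorem lintegral_setLIntegral_between {f : X → ℝ} (hf : Measurable f) {H : X → ℝ≥0∞}
    (hH : Measurable H) (ε : ℝ) :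
    ∫⁻ t, ∫⁻ y in {y | t < f y ∧ f y < t + ε}, H y ∂μ = ENNReal.ofReal ε * ∫⁻ y, H y ∂μ := by
  simp only [setLIntegral_between_eq hf]
  have hm : Measurable (Function.uncurry fun (t : ℝ) (y : X) =>
      {p : ℝ × X | p.1 < f p.2 ∧ f p.2 < p.1 + ε}.indicator (fun p => H p.2) (t, y)) :=
    (hH.comp measurable_snd).indicator (measurableSet_between hf ε)
  rw [lintegral_lintegral_swap hm.aemeasurable,
    ← lintegral_const_mul _ hH]
  refine lintegral_congr fun y => ?_
  have h : (fun t => {p : ℝ × X | p.1 < f p.2 ∧ f p.2 < p.1 + ε}.indicator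
      (fun p => H p.2) (t, y)) = (Set.Ioo (f y - ε) (f y)).indicator fun _ => H y := by
    ext t
    simp only [Set.indicator, Set.mem_ofPred_eq, Set.mem_Ioo]
    congr 1
    exact propext ⟨fun h => ⟨by linarith, h.1⟩, fun h => ⟨h.2, by linarith⟩⟩
  rw [h, lintegral_indicator measurableSet_Ioo, setLIntegral_const, Real.volume_Ioo, mul_comm]
  congr 2
  ring

/-- The lower slope of `t ↦ ∫_{f < t} H`. -/
def levelSlope (μ : Measure X) (f : X → ℝ) (H : X → ℝ≥0∞) (t : ℝ) : ℝ≥0∞ :=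
  Filter.liminf (fun n : ℕ => ENNReal.ofReal ((n : ℝ) + 1) *
    ∫⁻ y in {y | t < f y ∧ f y < t + ((n : ℝ) + 1)⁻¹}, H y ∂μ) Filter.atTop

theorem measurable_levelSlope {f : X → ℝ} (hf : Measurable f) {H : X → ℝ≥0∞}
    (hH : Measurable H) : Measurable (levelSlope μ f H) :=
  Measurable.liminf fun _ => (measurable_setLIntegral_between hf hH _).const_mul _

/-- Fatou's lemma, since each difference quotient has integral `∫ H` exactly. The lower slope thus
replaces differentiation of a monotone function. -/
theorem lintegral_levelSlope_le {f : X → ℝ} (hf : Measurable f) {H : X → ℝ≥0∞}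
    (hH : Measurable H) : ∫⁻ t, levelSlope μ f H t ≤ ∫⁻ y, H y ∂μ := by
  refine (lintegral_liminf_le fun n =>
    (measurable_setLIntegral_between hf hH _).const_mul _).trans (le_of_eq ?_)
  have h (n : ℕ) : ∫⁻ t, ENNReal.ofReal ((n : ℝ) + 1) *
      ∫⁻ y in {y | t < f y ∧ f y < t + ((n : ℝ) + 1)⁻¹}, H y ∂μ = ∫⁻ y, H y ∂μ := by
    rw [lintegral_const_mul _ (measurable_setLIntegral_between hf hH _),
      lintegral_setLIntegral_between hf hH, ← mul_assoc, ← ENNReal.ofReal_mul (by positivity),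
      mul_inv_cancel₀ (by positivity)]
    simp
  simp only [h]
  simp

/-- Layer cake formula above the level `t₀`, with a weight. -/
theorem lintegral_ofReal_sub_mul {f : X → ℝ} (hf : Measurable f) {Z : X → ℝ≥0∞}
    (hZ : Measurable Z) (t₀ : ℝ) :
    ∫⁻ y, ENNReal.ofReal (f y - t₀) * Z y ∂μ =
      ∫⁻ t in Set.Ioi t₀, ∫⁻ y in {y | t < f y}, Z y ∂μ := by
  have hS : MeasurableSet {p : ℝ × X | p.1 < f p.2} :=
    measurableSet_lt measurable_fst (hf.comp measurable_snd)
  have h1 (t : ℝ) : ∫⁻ y in {y | t < f y}, Z y ∂μ =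
      ∫⁻ y, {p : ℝ × X | p.1 < f p.2}.indicator (fun p => Z p.2) (t, y) ∂μ := by
    have hm : MeasurableSet {y | t < f y} := hS.preimage measurable_prodMk_left
    rw [← lintegral_indicator hm]
    rfl
  simp only [h1]
  have hm : Measurable (Function.uncurry fun (t : ℝ) (y : X) =>
      {p : ℝ × X | p.1 < f p.2}.indicator (fun p => Z p.2) (t, y)) :=
    (hZ.comp measurable_snd).indicator hS
  rw [lintegral_lintegral_swap hm.aemeasurable]
  refine lintegral_congr fun y => ?_
  have h : (fun t => {p : ℝ × X | p.1 < f p.2}.indicator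
      (fun p => Z p.2) (t, y)) = (Set.Iio (f y)).indicator fun _ => Z y := by
    ext t
    simp [Set.indicator]
  rw [h, lintegral_indicator measurableSet_Iio, setLIntegral_const,
    Measure.restrict_apply measurableSet_Iio, Set.inter_comm, Set.Ioi_inter_Iio, Real.volume_Ioo,
    mul_comm]

/-- If the measure of the superlevel sets is at most `K q²` then the `L²` norm is at most
`√K ∫ q`. -/
theorem lintegral_ofReal_sub_sq_le {f : X → ℝ} (hf : Measurable f) {q : ℝ → ℝ≥0∞}
    (hq : Measurable q) {K : ℝ≥0∞} {t₀ : ℝ}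
    (h : ∀ t, t₀ < t → μ {y | t < f y} ≤ K * q t ^ 2) :
    ∫⁻ y, ENNReal.ofReal (f y - t₀) ^ 2 ∂μ ≤ K * (∫⁻ t, q t) ^ 2 := by
  have hX : Measurable fun y => ENNReal.ofReal (f y - t₀) := (hf.sub_const t₀).ennreal_ofReal
  have hm (t : ℝ) : MeasurableSet {y | t < f y} := measurableSet_lt measurable_const hf
  have h1 : ∫⁻ y, ENNReal.ofReal (f y - t₀) ^ 2 ∂μ =
      ∫⁻ s in Set.Ioi t₀, ∫⁻ t in Set.Ioi t₀, μ ({y | s < f y} ∩ {y | t < f y}) := by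
    simp only [sq]
    rw [lintegral_ofReal_sub_mul hf hX]
    refine lintegral_congr fun s => ?_
    have h2 := lintegral_ofReal_sub_mul (μ := μ) hf
      (Z := {y | s < f y}.indicator fun _ => 1) (measurable_const.indicator (hm s)) t₀
    have h3 : (fun y => ENNReal.ofReal (f y - t₀) * {y | s < f y}.indicator (fun _ => 1) y) =
        {y | s < f y}.indicator fun y => ENNReal.ofReal (f y - t₀) := by
      ext y; simp [Set.indicator]
    rw [h3, lintegral_indicator (hm s)] at h2
    rw [h2]
    refine lintegral_congr fun t => ?_
    rw [lintegral_indicator (hm s)]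
    simp [Measure.restrict_apply (hm s)]
  rw [h1]
  -- By the double layer cake it suffices to bound the intersection of two superlevel sets: its
  -- measure is at most `K min(q s, q t)² ≤ K q(s) q(t)`, and the right-hand side factorises.
  calc _ ≤ ∫⁻ s in Set.Ioi t₀, ∫⁻ t in Set.Ioi t₀, K * q s * q t := by
        refine setLIntegral_mono' measurableSet_Ioi fun s hs =>
          setLIntegral_mono' measurableSet_Ioi fun t ht => ?_
        rcases le_total (q s) (q t) with hst | hst
        · refine ((measure_mono Set.inter_subset_left).trans (h s hs)).trans ?_
          rw [sq, ← mul_assoc]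
          gcongr
        · refine ((measure_mono Set.inter_subset_right).trans (h t ht)).trans ?_
          rw [sq, ← mul_assoc]
          gcongr
    _ ≤ ∫⁻ s, ∫⁻ t, K * q s * q t :=
        (setLIntegral_le_lintegral _ _).trans
          (lintegral_mono fun s => setLIntegral_le_lintegral _ _)
    _ = K * (∫⁻ t, q t) ^ 2 := by
        simp only [lintegral_const_mul _ hq]
        rw [lintegral_mul_const _ (hq.const_mul K), lintegral_const_mul _ hq, sq, mul_assoc]

end LevelSets

/-! ### From the isoperimetric constant to a Sobolev inequality on a leaf -/

namespace FoliatedCylinder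
variable {M : FoliatedCylinder}

/-- The area measure of a leaf in stereographic coordinates. -/
def leafMeasure (M : FoliatedCylinder) (u : ℝ) : Measure E2 :=
  volume.withDensity fun y => ENNReal.ofReal (M.areaDensity u y)

instance (u : ℝ) : SigmaFinite (M.leafMeasure u) := by
  unfold leafMeasure; infer_instance

theorem area_eq (u : ℝ) (U : Set S2) : M.area u U = M.leafMeasure u (stereoS ⁻¹' U) :=
  (withDensity_apply' _ _).symm

theorem measurable_ofReal_areaDensity {u : ℝ} (hu : u ∈ M.J) :
    Measurable fun y => ENNReal.ofReal (M.areaDensity u y) :=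
  (continuous_areaDensity hu).measurable.ennreal_ofReal

theorem lintegral_leafMeasure {u : ℝ} (hu : u ∈ M.J) (f : E2 → ℝ≥0∞) :
    ∫⁻ y, f y ∂M.leafMeasure u = ∫⁻ y, f y * ENNReal.ofReal (M.areaDensity u y) := by
  rw [leafMeasure, lintegral_withDensity_eq_lintegral_mul_non_measurable _
    (measurable_ofReal_areaDensity hu) (Filter.Eventually.of_forall fun _ => ENNReal.ofReal_lt_top)]
  simp [mul_comm]

theorem integralLeaf_eq {u : ℝ} (hu : u ∈ M.J) (F : Coord → ℝ) :
    M.integralLeaf u F = ∫⁻ y, ENNReal.ofReal (F (u, y)) ∂M.leafMeasure u := by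
  rw [lintegral_leafMeasure hu, integralLeaf]
  exact lintegral_congr fun y => ENNReal.ofReal_mul' (Real.sqrt_nonneg _)

/-- One half of the coarea formula: the perimeter of a superlevel set is bounded by the slope of
the integral of the gradient. -/
theorem perimeter_superlevel_le {u : ℝ} (hu : u ∈ M.J) {f G : E2 → ℝ} (hf : ContDiff ℝ 1 f)
    (hG0 : ∀ y, 0 ≤ G y)
    (hG : ∀ y, M.cof u y (pd2 0 f y) (pd2 1 f y) ≤ (M.leafMetric u y).det * G y ^ 2) (t : ℝ) :
    M.perimeter u (stereoS '' {y | t < f y}) ≤ ENNReal.ofReal transitionBound *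
      levelSlope (M.leafMeasure u) f (fun y => ENNReal.ofReal (G y)) t := by
  have hL := transitionBound_pos
  refine iSup₂_le fun Y hY => ?_
  rw [Set.preimage_image_eq _ stereoS_injective]
  have hopen : MeasurableSet {y | t < f y} := (isOpen_lt continuous_const hf.continuous).measurableSet
  -- If the divergence is not integrable over the set, the Bochner integral in `perimeter` is `0` by
  -- convention and the bound is trivial.
  by_cases hint : IntegrableOn (M.divDensity u Y) {y | t < f y}
  swap
  · rw [integral_undef hint]; simp
  -- `ρ n` rises from `0` to `1` between the levels `t` and `t + 1/(n+1)` with slope at most `(n +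
  -- 1) transitionBound`. Thus `ρ n ∘ f` approximates the indicator of the superlevel set and its
  -- gradient lives in the band defining `levelSlope`.
  set ρ : ℕ → ℝ → ℝ := fun n s => Real.smoothTransition (((n : ℝ) + 1) * (s - t)) with hρ
  have hρd (n : ℕ) : ContDiff ℝ 1 (ρ n) :=
    Real.smoothTransition.contDiff.comp (contDiff_const.mul (contDiff_id.sub contDiff_const))
  have hρ0 (n : ℕ) (s : ℝ) (hs : s ≤ t) : ρ n s = 0 :=
    Real.smoothTransition.zero_of_nonpos
      (mul_nonpos_of_nonneg_of_nonpos (by positivity) (by linarith))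
  have hρ1 (n : ℕ) (s : ℝ) : |ρ n s| ≤ 1 := by
    rw [abs_of_nonneg (Real.smoothTransition.nonneg _)]
    exact Real.smoothTransition.le_one _
  have hρ' (n : ℕ) (s : ℝ) :
      deriv (ρ n) s = ((n : ℝ) + 1) * deriv Real.smoothTransition (((n : ℝ) + 1) * (s - t)) := by
    have h1 : HasDerivAt (fun s => ((n : ℝ) + 1) * (s - t)) ((n : ℝ) + 1) s := by
      simpa using ((hasDerivAt_id s).sub_const t).const_mul ((n : ℝ) + 1)
    have h2 := ((Real.smoothTransition.contDiff (n := 1)).differentiable one_ne_zero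
      (((n : ℝ) + 1) * (s - t))).hasDerivAt
    rw [mul_comm]
    exact (h2.comp s h1).deriv
  have hg (n : ℕ) : ContDiff ℝ 1 fun y => ρ n (f y) := (hρd n).comp hf
  have hlim : Filter.Tendsto (fun n => ∫ y, ρ n (f y) * M.divDensity u Y y) Filter.atTop
      (nhds (∫ y in {y | t < f y}, M.divDensity u Y y)) := by
    rw [← integral_indicator hopen]
    refine tendsto_integral_of_dominated_convergence
      (fun y => ‖{y | t < f y}.indicator (M.divDensity u Y) y‖)
      (fun n => ((hg n).continuous.mul (continuous_divDensity hu hY.1)).aestronglyMeasurable)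
      (hint.integrable_indicator hopen).norm
      (fun n => Filter.Eventually.of_forall fun y => ?_) (Filter.Eventually.of_forall fun y => ?_)
    · by_cases hy : t < f y
      · rw [Set.indicator_of_mem (by exact hy), norm_mul]
        exact mul_le_of_le_one_left (norm_nonneg _) (hρ1 n _)
      · simp [hρ0 n _ (not_lt.1 hy)]
    · by_cases hy : t < f y
      · rw [Set.indicator_of_mem (by exact hy)]
        refine tendsto_const_nhds.congr' ?_
        obtain ⟨N, hN⟩ := exists_nat_ge (f y - t)⁻¹
        filter_upwards [Filter.eventually_ge_atTop N] with n hn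
        have h1 : (f y - t)⁻¹ ≤ n + 1 := hN.trans (by
          have : (N : ℝ) ≤ n := by exact_mod_cast hn
          linarith)
        rw [inv_le_iff_one_le_mul₀ (by linarith)] at h1
        rw [hρ]
        simp only
        rw [Real.smoothTransition.one_of_one_le h1, one_mul]
      · rw [Set.indicator_of_notMem (by exact hy)]
        simp [hρ0 _ _ (not_lt.1 hy)]
  have hbound (n : ℕ) : ENNReal.ofReal (∫ y, ρ n (f y) * M.divDensity u Y y) ≤
      ENNReal.ofReal transitionBound * (ENNReal.ofReal ((n : ℝ) + 1) *
        ∫⁻ y in {y | t < f y ∧ f y < t + ((n : ℝ) + 1)⁻¹}, ENNReal.ofReal (G y)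
          ∂M.leafMeasure u) := by
    have hi : Integrable fun y => ρ n (f y) * M.divDensity u Y y := by
      refine (hint.integrable_indicator hopen).norm.mono'
        ((hg n).continuous.mul (continuous_divDensity hu hY.1)).aestronglyMeasurable
        (Filter.Eventually.of_forall fun y => ?_)
      by_cases hy : t < f y
      · rw [Set.indicator_of_mem (by exact hy), norm_mul]
        exact mul_le_of_le_one_left (norm_nonneg _) (hρ1 n _)
      · simp [hρ0 n _ (not_lt.1 hy)]
    refine (ofReal_integral_mul_divDensity_le hu hY (hg n) (fun y => hρ1 n _) hi).trans ?_
    have hS : MeasurableSet {y | t < f y ∧ f y < t + ((n : ℝ) + 1)⁻¹} :=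
      hopen.inter (isOpen_lt hf.continuous continuous_const).measurableSet
    rw [← mul_assoc, ← ENNReal.ofReal_mul hL.le, leafMeasure, restrict_withDensity hS,
      lintegral_withDensity_eq_lintegral_mul_non_measurable _ (measurable_ofReal_areaDensity hu)
      (Filter.Eventually.of_forall fun _ => ENNReal.ofReal_lt_top),
      ← lintegral_const_mul' _ _ ENNReal.ofReal_ne_top, ← lintegral_indicator hS]
    refine lintegral_mono fun y => ?_
    have hpd (A : Fin 2) : pd2 A (fun y => ρ n (f y)) y = deriv (ρ n) (f y) * pd2 A f y :=
      pd2_comp ((hρd n).differentiable one_ne_zero _) (hf.differentiable one_ne_zero _)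
    have hcof : M.cof u y (pd2 0 (fun y => ρ n (f y)) y) (pd2 1 (fun y => ρ n (f y)) y) =
        deriv (ρ n) (f y) ^ 2 * M.cof u y (pd2 0 f y) (pd2 1 f y) := by
      rw [hpd, hpd, cof, cof]; ring
    simp only
    rw [hcof, Real.sqrt_mul (sq_nonneg _), Real.sqrt_sq_eq_abs, hρ', abs_mul]
    by_cases hy : y ∈ {y | t < f y ∧ f y < t + ((n : ℝ) + 1)⁻¹}
    · rw [Set.indicator_of_mem hy, Pi.mul_apply,
        ← ENNReal.ofReal_mul (areaDensity_pos hu y).le,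
        ← ENNReal.ofReal_mul (by positivity)]
      refine ENNReal.ofReal_le_ofReal ?_
      rw [abs_of_nonneg (by positivity : (0 : ℝ) ≤ n + 1), mul_comm transitionBound]
      refine mul_le_mul (mul_le_mul_of_nonneg_left (abs_deriv_smoothTransition_le _) (by positivity))
        ?_ (Real.sqrt_nonneg _) (by positivity)
      refine (Real.sqrt_le_sqrt (hG y)).trans (le_of_eq ?_)
      rw [Real.sqrt_mul (leafMetric_det_pos hu y).le, Real.sqrt_sq (hG0 y)]
      rfl
    · rw [deriv_smoothTransition_eq_zero]
      · simp
      · rw [Set.mem_ofPred_eq, not_and_or, not_lt, not_lt] at hy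
        rcases hy with hy | hy
        · exact Or.inl (mul_nonpos_of_nonneg_of_nonpos (by positivity) (by linarith))
        · right
          calc (1 : ℝ) = ((n : ℝ) + 1) * ((n : ℝ) + 1)⁻¹ := by field_simp
            _ ≤ _ := by gcongr; linarith
  refine (le_of_eq (ENNReal.tendsto_ofReal hlim).liminf_eq.symm).trans ?_
  refine (Filter.liminf_le_liminf (Filter.Eventually.of_forall hbound)).trans ?_
  rw [levelSlope, ENNReal.liminf_const_mul_of_ne_top ENNReal.ofReal_ne_top]

/-- **Sobolev inequality on a leaf**: the isoperimetric inequality implies the embedding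
`W^{1,1} ⊂ L²`. -/
theorem leaf_sobolev {u : ℝ} (hu : u ∈ M.J) {I₀ : ℝ≥0} (hI : M.isoConst u ≤ I₀)
    (hA0 : M.leafMeasure u Set.univ ≠ 0) (hAt : M.leafMeasure u Set.univ ≠ ⊤)
    {f G : E2 → ℝ} (hf : ContDiff ℝ 1 f) (hf0 : ∀ y, 0 ≤ f y) (hGm : Measurable G)
    (hG0 : ∀ y, 0 ≤ G y)
    (hG : ∀ y, M.cof u y (pd2 0 f y) (pd2 1 f y) ≤ (M.leafMetric u y).det * G y ^ 2) :
    ∫⁻ y, ENNReal.ofReal (f y ^ 2) ∂M.leafMeasure u ≤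
      2 * ((I₀ + 1) * ENNReal.ofReal transitionBound ^ 2) *
          (∫⁻ y, ENNReal.ofReal (G y) ∂M.leafMeasure u) ^ 2 +
        8 * (∫⁻ y, ENNReal.ofReal (f y) ∂M.leafMeasure u) ^ 2 / M.leafMeasure u Set.univ := by
  set μ := M.leafMeasure u with hμ
  set A := μ Set.univ with hA
  set F := ∫⁻ y, ENNReal.ofReal (f y) ∂μ with hF
  have hfm : Measurable f := hf.continuous.measurable
  by_cases hFt : F = ⊤
  · rw [hFt]
    simp [ENNReal.top_div_of_ne_top hAt]
  have : IsFiniteMeasure μ := ⟨hAt.lt_top⟩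
  -- Twice the mean of `f`: by Markov's inequality the superlevel sets above `t₀` have at most half
  -- of the area, so they realise the minimum in `isoConst`.
  set t₀ : ℝ := (2 * F / A).toReal with ht₀
  have ht₀A : ENNReal.ofReal t₀ = 2 * F / A :=
    ENNReal.ofReal_toReal (ENNReal.div_ne_top (ENNReal.mul_ne_top (by simp) hFt) hA0)
  set q := levelSlope μ f (fun y => ENNReal.ofReal (G y)) with hq
  set L := ENNReal.ofReal transitionBound with hL
  have hlevel (t : ℝ) (ht : t₀ < t) : μ {y | t < f y} ≤ ((I₀ + 1) * L ^ 2) * q t ^ 2 := by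
    have hm : MeasurableSet {y | t < f y} := measurableSet_lt measurable_const hfm
    have ht0 : 0 < t := ENNReal.toReal_nonneg.trans_lt ht
    have hhalf : μ {y | t < f y} ≤ A / 2 := by
      have h1 : ENNReal.ofReal t * μ {y | t < f y} ≤ F := by
        refine le_trans ?_ (mul_meas_ge_le_lintegral hfm.ennreal_ofReal (ENNReal.ofReal t))
        gcongr
        exact fun h => ENNReal.ofReal_le_ofReal h.le
      have h2 : F = ENNReal.ofReal t₀ * (A / 2) := by
        rw [ht₀A, mul_div, ENNReal.div_mul_cancel hA0 hAt, mul_comm,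
          ENNReal.mul_div_cancel_right (by simp) (by simp)]
      by_contra h3
      rw [not_le] at h3
      have h4 : ENNReal.ofReal t * (A / 2) ≤ ENNReal.ofReal t₀ * (A / 2) := by
        rw [← h2]
        exact (by gcongr : ENNReal.ofReal t * (A / 2) ≤ _).trans h1
      rw [ENNReal.mul_le_mul_iff_left (by simpa using hA0)
        (ENNReal.div_ne_top hAt (by simp)), ENNReal.ofReal_le_ofReal_iff
        ENNReal.toReal_nonneg] at h4
      linarith
    have hcompl : μ {y | t < f y} ≤ μ {y | t < f y}ᶜ := by
      have h1 : μ {y | t < f y} + μ {y | t < f y} ≤ μ {y | t < f y} + μ {y | t < f y}ᶜ := by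
        rw [measure_add_measure_compl hm]
        refine (add_le_add hhalf hhalf).trans (le_of_eq (ENNReal.add_halves A))
      exact (ENNReal.add_le_add_iff_left (measure_ne_top μ _)).1 h1
    -- The summand `1` makes the constant nonzero. Clearing the denominator is then valid also for
    -- infinite perimeter, where the quotient is `0` whatever the area.
    have hiso : μ {y | t < f y} / M.perimeter u (stereoS '' {y | t < f y}) ^ 2 ≤ I₀ + 1 := by
      have h1 : min (M.area u (stereoS '' {y | t < f y})) (M.area u (stereoS '' {y | t < f y})ᶜ) /
          M.perimeter u (stereoS '' {y | t < f y}) ^ 2 ≤ M.isoConst u :=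
        le_iSup₂ (f := fun (U : Set S2) (_ : MeasurableSet U) =>
          min (M.area u U) (M.area u Uᶜ) / M.perimeter u U ^ 2) _
          (measurableEmbedding_stereoS.measurableSet_image.2 hm)
      rw [area_eq, area_eq, Set.preimage_compl, Set.preimage_image_eq _ stereoS_injective,
        ← hμ, min_eq_left hcompl] at h1
      exact (h1.trans hI).trans le_self_add
    rw [ENNReal.div_le_iff_le_mul (Or.inr (by simp)) (Or.inr (by simp))] at hiso
    refine hiso.trans ?_
    rw [mul_assoc, ← mul_pow]
    gcongr
    exact perimeter_superlevel_le hu hf hG0 hG t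
  have hmain := lintegral_ofReal_sub_sq_le hfm
    (measurable_levelSlope hfm hGm.ennreal_ofReal) hlevel
  have hslope : ∫⁻ t, q t ≤ ∫⁻ y, ENNReal.ofReal (G y) ∂μ :=
    lintegral_levelSlope_le hfm hGm.ennreal_ofReal
  calc ∫⁻ y, ENNReal.ofReal (f y ^ 2) ∂μ
      -- From `f² ≤ 2 (f - t₀)₊² + 2 t₀²`; the constant part integrates to `2 (2F/A)² A = 8 F² / A`.
      ≤ ∫⁻ y, (2 * ENNReal.ofReal (f y - t₀) ^ 2 + 2 * ENNReal.ofReal t₀ ^ 2) ∂μ := by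
        refine lintegral_mono fun y => ?_
        have h0 : 0 ≤ t₀ := ENNReal.toReal_nonneg
        have h1 : f y ^ 2 ≤ 2 * max (f y - t₀) 0 ^ 2 + 2 * t₀ ^ 2 := by
          rcases le_total (f y - t₀) 0 with h | h
          · rw [max_eq_right h]; nlinarith [hf0 y]
          · rw [max_eq_left h]; nlinarith [sq_nonneg (f y - t₀ - t₀)]
        refine (ENNReal.ofReal_le_ofReal h1).trans (le_of_eq ?_)
        rw [ENNReal.ofReal_add (by positivity) (by positivity), ENNReal.ofReal_mul (by simp),
          ENNReal.ofReal_mul (by simp), ENNReal.ofReal_pow (by positivity),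
          ENNReal.ofReal_pow h0]
        simp
    _ = 2 * ∫⁻ y, ENNReal.ofReal (f y - t₀) ^ 2 ∂μ + 2 * (2 * F / A) ^ 2 * A := by
        rw [lintegral_add_right _ measurable_const, lintegral_const, ht₀A,
          lintegral_const_mul _ ((hfm.sub_const t₀).ennreal_ofReal.pow_const 2)]
    _ ≤ _ := by
        refine add_le_add ?_ (le_of_eq ?_)
        · rw [mul_assoc 2]
          gcongr
          exact hmain.trans (by gcongr)
        · simp only [div_eq_mul_inv, mul_pow]
          rw [sq A⁻¹, show 2 * (2 ^ 2 * F ^ 2 * (A⁻¹ * A⁻¹)) * A =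
            8 * F ^ 2 * A⁻¹ * (A⁻¹ * A) by ring, ENNReal.inv_mul_cancel hA0 hAt, mul_one]

end FoliatedCylinder

/-- The area density of the round sphere, the majorant for the densities of the leaves. -/
theorem integrable_stereo_weight : Integrable fun y : E2 => (2 / (1 + ‖y‖ ^ 2)) ^ 2 := by
  have h : Integrable (fun y : E2 => ((1 : ℝ) + ‖y‖ ^ 2) ^ (-(4 : ℝ) / 2)) :=
    integrable_rpow_neg_one_add_norm_sq (by simp; norm_num)
  refine (h.const_mul 4).congr (Filter.Eventually.of_forall fun y => ?_)
  have hp : (0 : ℝ) < 1 + ‖y‖ ^ 2 := by positivity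
  simp only
  rw [show (-(4 : ℝ) / 2) = -((2 : ℕ) : ℝ) by norm_num, Real.rpow_neg hp.le, Real.rpow_natCast,
    div_pow]
  ring

theorem lintegral_mul_sq_le {X : Type*} [MeasurableSpace X] {μ : Measure X} {f g : X → ℝ≥0∞}
    (hf : AEMeasurable f μ) (hg : AEMeasurable g μ) :
    (∫⁻ x, f x * g x ∂μ) ^ 2 ≤ (∫⁻ x, f x ^ 2 ∂μ) * ∫⁻ x, g x ^ 2 ∂μ := by
  have h := ENNReal.lintegral_mul_le_Lp_mul_Lq μ Real.HolderConjugate.two_two hf hg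
  have h2 (x : ℝ≥0∞) : (x ^ (1 / 2 : ℝ)) ^ 2 = x := by
    rw [← ENNReal.rpow_natCast, ← ENNReal.rpow_mul]; norm_num
  calc _ ≤ _ := pow_le_pow_left₀ (by simp) h 2
    _ = _ := by simp only [mul_pow, h2, ENNReal.rpow_ofNat]

namespace FoliatedCylinder
variable {M : FoliatedCylinder}

/-! ### Area and area radius -/

theorem integrable_areaDensity {u : ℝ} (hu : u ∈ M.J) : Integrable (M.areaDensity u) := by
  obtain ⟨C, -, hC⟩ := exists_areaDensity_le (isCompact_singleton (x := u))
    (Set.singleton_subset_iff.2 hu)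
  refine (integrable_stereo_weight.const_mul C).mono'
    (continuous_areaDensity hu).aestronglyMeasurable (Filter.Eventually.of_forall fun y => ?_)
  rw [Real.norm_eq_abs, abs_of_pos (areaDensity_pos hu y)]
  exact hC u rfl y

/-- The area of a leaf, as a real number. -/
def leafArea (M : FoliatedCylinder) (u : ℝ) : ℝ := ∫ y, M.areaDensity u y

theorem leafMeasure_univ {u : ℝ} (hu : u ∈ M.J) :
    M.leafMeasure u Set.univ = ENNReal.ofReal (M.leafArea u) := by
  rw [leafMeasure, withDensity_apply _ MeasurableSet.univ, Measure.restrict_univ, leafArea,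
    ofReal_integral_eq_lintegral_ofReal (integrable_areaDensity hu)
      (Filter.Eventually.of_forall fun y => (areaDensity_pos hu y).le)]

theorem leafArea_pos {u : ℝ} (hu : u ∈ M.J) : 0 < M.leafArea u := by
  rw [leafArea, integral_pos_iff_support_of_nonneg (fun y => (areaDensity_pos hu y).le)
    (integrable_areaDensity hu)]
  have : Function.support (M.areaDensity u) = Set.univ :=
    Set.eq_univ_of_forall fun y => (areaDensity_pos hu y).ne'
  rw [this]
  exact Measure.measure_univ_pos.2 (NeZero.ne _)

theorem areaRadius_eq {u : ℝ} (hu : u ∈ M.J) :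
    M.areaRadius u = √(M.leafArea u / (4 * Real.pi)) := by
  rw [areaRadius, area_eq, Set.preimage_univ, leafMeasure_univ hu,
    ENNReal.toReal_ofReal (leafArea_pos hu).le]

theorem areaRadius_pos {u : ℝ} (hu : u ∈ M.J) : 0 < M.areaRadius u := by
  rw [areaRadius_eq hu]
  exact Real.sqrt_pos.2 (div_pos (leafArea_pos hu) (by positivity))

theorem leafArea_eq {u : ℝ} (hu : u ∈ M.J) :
    M.leafArea u = 4 * Real.pi * M.areaRadius u ^ 2 := by
  rw [areaRadius_eq hu, Real.sq_sqrt (div_nonneg (leafArea_pos hu).le (by positivity))]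
  field_simp

theorem hasDerivAt_fst {f : Coord → ℝ} {n : ℕ∞ω} (hn : n ≠ 0)
    (hf : ContDiffOn ℝ n f (M.J ×ˢ Set.univ)) {u : ℝ} (hu : u ∈ M.J) (y : E2) :
    HasDerivAt (fun v => f (v, y)) (pd 0 f (u, y)) u := by
  have h1 := (differentiableAt_of_contDiffOn hn hf (p := (u, y)) hu).hasFDerivAt
  have h2 : HasDerivAt (fun v : ℝ => ((v, y) : Coord)) (1, 0) u :=
    (hasDerivAt_id u).prodMk (hasDerivAt_const u y)
  exact h1.comp_hasDerivAt u h2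

theorem pd2_slice {f : Coord → ℝ} {n : ℕ∞ω} (hn : n ≠ 0)
    (hf : ContDiffOn ℝ n f (M.J ×ˢ Set.univ)) {u : ℝ} (hu : u ∈ M.J) (y : E2) (A : Fin 2) :
    pd2 A (fun z => f (u, z)) y = pd A.succ f (u, y) := by
  have h1 := (differentiableAt_of_contDiffOn hn hf (p := (u, y)) hu).hasFDerivAt
  have h2 : HasFDerivAt (fun z : E2 => ((u, z) : Coord)) (ContinuousLinearMap.inr ℝ ℝ E2) y :=
    hasFDerivAt_prodMk_right u y
  have h3 := (h1.comp y h2).fderiv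
  simp only [Function.comp_def] at h3
  rw [pd2, h3, pd]
  simp [dir]

theorem exists_Icc_subset {u : ℝ} (hu : u ∈ M.J) :
    ∃ ε > 0, Set.Icc (u - ε) (u + ε) ⊆ M.J := by
  obtain ⟨ε, hε, h⟩ := Metric.nhds_basis_closedBall.mem_iff.1 (M.isOpen_J.mem_nhds hu)
  exact ⟨ε, hε, by rwa [← Real.closedBall_eq_Icc]⟩

theorem Icc_mem_nhds_self {u ε : ℝ} (hε : 0 < ε) : Set.Icc (u - ε) (u + ε) ∈ nhds u :=
  Icc_mem_nhds (by linarith) (by linarith)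

/-- Continuity has to come before differentiability: the majorant for `∂_u` of the area density
contains `1/r`, and so needs a positive lower bound of `r` near `u`. -/
theorem continuousAt_leafArea {u : ℝ} (hu : u ∈ M.J) : ContinuousAt M.leafArea u := by
  obtain ⟨ε, hε, hJ⟩ := exists_Icc_subset hu
  obtain ⟨C, -, hC⟩ := exists_areaDensity_le isCompact_Icc hJ
  have hmem := Icc_mem_nhds_self (u := u) hε
  refine continuousAt_of_dominated (bound := fun y => C * (2 / (1 + ‖y‖ ^ 2)) ^ 2) ?_ ?_
    (integrable_stereo_weight.const_mul C) (Filter.Eventually.of_forall fun y => ?_)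
  · filter_upwards [hmem] with v hv
    exact (continuous_areaDensity (hJ hv)).aestronglyMeasurable
  · filter_upwards [hmem] with v hv
    refine Filter.Eventually.of_forall fun y => ?_
    rw [Real.norm_eq_abs, abs_of_pos (areaDensity_pos (hJ hv) y)]
    exact hC v hv y
  · exact (hasDerivAt_fst (by simp) contDiffOn_areaDensity hu y).continuousAt

theorem continuousOn_areaRadius : ContinuousOn M.areaRadius M.J := by
  have h : ContinuousOn (fun u => √(M.leafArea u / (4 * Real.pi))) M.J := fun u hu =>
    ((continuousAt_leafArea hu).div_const _).sqrt.continuousWithinAt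
  exact h.congr fun u hu => areaRadius_eq hu

section Radius
variable {aM h : ℝ} (haM : ∀ u ∈ M.J, ∀ x, M.a u x ≤ aM)
  (hH : ∀ u ∈ M.J, ∀ y, |M.areaRadius u * M.meanCurvature (u, y)| ≤ h)
include haM hH

theorem abs_pd_areaDensity_le {u : ℝ} (hu : u ∈ M.J) (y : E2) :
    |pd 0 (fun q => M.areaDensity q.1 q.2) (u, y)| ≤
      aM * h / M.areaRadius u * M.areaDensity u y := by
  have hr := areaRadius_pos hu
  have ha := M.a_pos u hu (stereoS y)
  have h1 := haM u hu (stereoS y)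
  have h2 := hH u hu y
  rw [pd_areaDensity (p := (u, y)) hu, abs_mul, abs_mul, abs_of_pos (areaDensity_pos hu y),
    abs_of_pos ha]
  refine mul_le_mul_of_nonneg_right ?_ (areaDensity_pos hu y).le
  rw [abs_mul, abs_of_pos hr] at h2
  rw [le_div_iff₀ hr]
  calc M.a u (stereoS y) * |M.meanCurvature (u, y)| * M.areaRadius u
      = M.a u (stereoS y) * (M.areaRadius u * |M.meanCurvature (u, y)|) := by ring
    _ ≤ aM * h := mul_le_mul h1 h2 (by positivity) (ha.le.trans h1)

theorem hasDerivAt_leafArea {u : ℝ} (hu : u ∈ M.J) :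
    ∃ A' : ℝ, HasDerivAt M.leafArea A' u ∧ |A'| ≤ aM * h / M.areaRadius u * M.leafArea u := by
  obtain ⟨ε, hε, hJ⟩ := exists_Icc_subset hu
  obtain ⟨C, hC0, hC⟩ := exists_areaDensity_le isCompact_Icc hJ
  have hmem := Icc_mem_nhds_self (u := u) hε
  -- `r(v₀)` is the lower bound of `r` that makes the majorant independent of `v`.
  obtain ⟨v₀, hv₀, hmin⟩ := (isCompact_Icc (a := u - ε) (b := u + ε)).exists_isMinOn
    ⟨u, mem_of_mem_nhds hmem⟩ (continuousOn_areaRadius.mono hJ)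
  have hr₀ := areaRadius_pos (hJ hv₀)
  have haM0 : 0 ≤ aM := (M.a_pos u hu (stereoS 0)).le.trans (haM u hu _)
  have hh0 : 0 ≤ h := (abs_nonneg _).trans (hH u hu 0)
  have hder := hasDerivAt_integral_of_dominated_loc_of_deriv_le (μ := volume)
    (F := fun v y => M.areaDensity v y)
    (F' := fun v y => pd 0 (fun q => M.areaDensity q.1 q.2) (v, y)) (x₀ := u)
    (bound := fun y => aM * h / M.areaRadius v₀ * (C * (2 / (1 + ‖y‖ ^ 2)) ^ 2)) hmem
    (by filter_upwards [hmem] with v hv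
        exact (continuous_areaDensity (hJ hv)).aestronglyMeasurable)
    (integrable_areaDensity hu) ?_ ?_
    ((integrable_stereo_weight.const_mul C).const_mul _) ?_
  · refine ⟨_, hder.2, ?_⟩
    rw [leafArea, ← integral_const_mul]
    refine (abs_integral_le_integral_abs).trans ?_
    exact integral_mono hder.1.abs ((integrable_areaDensity hu).const_mul _)
      (abs_pd_areaDensity_le haM hH hu)
  · have := continuousOn_pd (M := M) (by simp) contDiffOn_areaDensity 0
    exact (this.comp_continuous (Continuous.prodMk_right u)
      fun y => ⟨hu, trivial⟩).aestronglyMeasurable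
  · refine Filter.Eventually.of_forall fun y v hv => ?_
    refine (abs_pd_areaDensity_le haM hH (hJ hv) y).trans ?_
    have h1 := areaDensity_pos (hJ hv) y
    have h2 := hC v hv y
    have h3 : M.areaRadius v₀ ≤ M.areaRadius v := hmin hv
    gcongr
  · exact Filter.Eventually.of_forall fun y v hv =>
      hasDerivAt_fst (by simp) contDiffOn_areaDensity (hJ hv) y

/-- With `A = 4πr²` the bound `|A'| ≤ a_M h A / r` reads `8πr |r'| ≤ 4π a_M h r`. Hence `r` is
Lipschitz and grows at most linearly. -/
theorem hasDerivAt_areaRadius {u : ℝ} (hu : u ∈ M.J) :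
    ∃ r' : ℝ, HasDerivAt M.areaRadius r' u ∧ |r'| ≤ aM * h / 2 := by
  obtain ⟨A', hA', hb⟩ := hasDerivAt_leafArea haM hH hu
  have hr := areaRadius_pos hu
  have hA := leafArea_pos hu
  have h1 := (hA'.div_const (4 * Real.pi)).sqrt (div_pos hA (by positivity)).ne'
  rw [← areaRadius_eq hu] at h1
  refine ⟨_, h1.congr_of_eventuallyEq ?_, ?_⟩
  · filter_upwards [M.isOpen_J.mem_nhds hu] with v hv using areaRadius_eq hv
  · rw [leafArea_eq hu] at hb
    rw [abs_div, abs_div, abs_of_pos (by positivity : 0 < 4 * Real.pi),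
      abs_of_pos (by positivity : 0 < 2 * M.areaRadius u), div_div, div_le_iff₀ (by positivity)]
    refine hb.trans (le_of_eq ?_)
    field_simp

theorem abs_areaRadius_sub_le {u v : ℝ} (hu : u ∈ M.J) (hv : v ∈ M.J) :
    |M.areaRadius v - M.areaRadius u| ≤ aM * h / 2 * |v - u| := by
  choose! r' hr' hb using fun u hu => hasDerivAt_areaRadius haM hH (u := u) hu
  exact M.ordConnected_J.convex.norm_image_sub_le_of_norm_hasDerivWithin_le
    (fun x hx => (hr' x hx).hasDerivWithinAt) (fun x hx => hb x hx) hu hv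

end Radius

/-! ### Estimates on a leaf -/

/-- The constant in the Sobolev inequality of a leaf with isoperimetric constant `I₀`. -/
def leafConst (I₀ : ℝ≥0) : ℝ≥0 := (I₀ + 1) * (Real.toNNReal transitionBound) ^ 2

/-- The scale-invariant form: multiply by `r²` and insert `A = 4πr²`, so that the coefficient `8 r²
/ A = 2/π` is at most `1`. -/
theorem leaf_sobolev' {u : ℝ} (hu : u ∈ M.J) {I₀ : ℝ≥0} (hI : M.isoConst u ≤ I₀)
    {f G : E2 → ℝ} (hf : ContDiff ℝ 1 f) (hf0 : ∀ y, 0 ≤ f y) (hGm : Measurable G)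
    (hG0 : ∀ y, 0 ≤ G y)
    (hG : ∀ y, M.cof u y (pd2 0 f y) (pd2 1 f y) ≤ (M.leafMetric u y).det * G y ^ 2) :
    ENNReal.ofReal (M.areaRadius u ^ 2) * ∫⁻ y, ENNReal.ofReal (f y ^ 2) ∂M.leafMeasure u ≤
      2 * leafConst I₀ * (∫⁻ y, ENNReal.ofReal (M.areaRadius u * G y) ∂M.leafMeasure u) ^ 2 +
        (∫⁻ y, ENNReal.ofReal (f y) ∂M.leafMeasure u) ^ 2 := by
  have hr := areaRadius_pos hu
  have hA := leafArea_pos hu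
  have h := leaf_sobolev hu hI (by rw [leafMeasure_univ hu]; simpa using hA)
    (by rw [leafMeasure_univ hu]; simp) hf hf0 hGm hG0 hG
  refine (mul_le_mul_right h _).trans ?_
  rw [mul_add]
  refine add_le_add (le_of_eq ?_) ?_
  · simp only [ENNReal.ofReal_mul hr.le]
    rw [lintegral_const_mul _ hGm.ennreal_ofReal, mul_pow, ENNReal.ofReal_pow hr.le, leafConst]
    push_cast
    rw [show ENNReal.ofReal transitionBound = (Real.toNNReal transitionBound : ℝ≥0∞) from rfl]
    ring
  · rw [leafMeasure_univ hu, leafArea_eq hu, div_eq_mul_inv]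
    generalize (∫⁻ y, ENNReal.ofReal (f y) ∂M.leafMeasure u) ^ 2 = F
    have h8 : (8 : ℝ≥0∞) = ENNReal.ofReal 8 := by simp
    rw [← ENNReal.ofReal_inv_of_pos (by positivity), h8,
      show ENNReal.ofReal (M.areaRadius u ^ 2) * (ENNReal.ofReal 8 * F *
        ENNReal.ofReal (4 * Real.pi * M.areaRadius u ^ 2)⁻¹) =
        F * (ENNReal.ofReal (M.areaRadius u ^ 2) * ENNReal.ofReal 8 *
          ENNReal.ofReal (4 * Real.pi * M.areaRadius u ^ 2)⁻¹) by ring,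
      ← ENNReal.ofReal_mul (by positivity), ← ENNReal.ofReal_mul (by positivity)]
    refine mul_le_of_le_one_right (by simp) ?_
    rw [← ENNReal.ofReal_one]
    refine ENNReal.ofReal_le_ofReal ?_
    rw [← div_eq_mul_inv, div_le_one (by positivity)]
    nlinarith [Real.pi_gt_three, pow_pos hr 2]

section Leaf
variable {u : ℝ} {I₀ : ℝ≥0} {w n : E2 → ℝ}

/-- `L⁴` estimate on a leaf for `F = √w`, where `|∇F| ≤ n`. -/
theorem leaf_L4_le (hu : u ∈ M.J) (hI : M.isoConst u ≤ I₀) (hw : ContDiff ℝ 1 w)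
    (hw0 : ∀ y, 0 ≤ w y) (hn : Measurable n) (hn0 : ∀ y, 0 ≤ n y)
    (hwn : ∀ y, M.cof u y (pd2 0 w y) (pd2 1 w y) ≤
      (M.leafMetric u y).det * (4 * w y * n y ^ 2)) :
    ENNReal.ofReal (M.areaRadius u ^ 2) * ∫⁻ y, ENNReal.ofReal (w y ^ 2) ∂M.leafMeasure u ≤
      (2 * leafConst I₀ + 1) *
        (∫⁻ y, ENNReal.ofReal (w y + M.areaRadius u ^ 2 * n y ^ 2) ∂M.leafMeasure u) ^ 2 := by
  have hr := areaRadius_pos hu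
  -- Here `f = F²` with gradient at most `2 F n`; then `2 F r n ≤ F² + r² n²`.
  refine (leaf_sobolev' hu hI hw hw0 (G := fun y => 2 * √(w y) * n y)
    ((measurable_const.mul hw.continuous.sqrt.measurable).mul hn)
    (fun y => mul_nonneg (by positivity) (hn0 y)) fun y => ?_).trans ?_
  · refine (hwn y).trans (le_of_eq ?_)
    rw [mul_pow, mul_pow, Real.sq_sqrt (hw0 y)]
    ring
  · rw [add_mul, one_mul]
    gcongr with y y
    · nlinarith [sq_nonneg (√(w y) - M.areaRadius u * n y), Real.sq_sqrt (hw0 y)]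
    · have := hn0 y
      have := sq_nonneg (M.areaRadius u * n y)
      nlinarith

/-- `L⁶` estimate on a leaf for `F = √w`, where `|∇F| ≤ n`. -/
theorem leaf_L6_le (hu : u ∈ M.J) (hI : M.isoConst u ≤ I₀) (hw : ContDiff ℝ 1 w)
    (hw0 : ∀ y, 0 ≤ w y) (hn : Measurable n) (hn0 : ∀ y, 0 ≤ n y)
    (hwn : ∀ y, M.cof u y (pd2 0 w y) (pd2 1 w y) ≤
      (M.leafMetric u y).det * (4 * w y * n y ^ 2)) :
    ENNReal.ofReal (M.areaRadius u ^ 2) * ∫⁻ y, ENNReal.ofReal (w y ^ 3) ∂M.leafMeasure u ≤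
      (18 * leafConst I₀ + 1) * ((∫⁻ y, ENNReal.ofReal (w y ^ 2) ∂M.leafMeasure u) *
        ∫⁻ y, ENNReal.ofReal (w y + M.areaRadius u ^ 2 * n y ^ 2) ∂M.leafMeasure u) := by
  have hr := areaRadius_pos hu
  have hwm := hw.continuous.measurable
  have hf3 (y : E2) : (w y ^ (3 / 2 : ℝ)) ^ 2 = w y ^ 3 := by
    rw [← Real.rpow_natCast, ← Real.rpow_mul (hw0 y), ← Real.rpow_natCast]; norm_num
  have hf1 (y : E2) : w y ^ (3 / 2 : ℝ) = w y * √(w y) := by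
    rw [Real.sqrt_eq_rpow, show (3 / 2 : ℝ) = 1 + 1 / 2 by norm_num,
      Real.rpow_add_of_nonneg (hw0 y) (by norm_num) (by norm_num), Real.rpow_one]
  have hpd (A : Fin 2) (y : E2) :
      pd2 A (fun z => w z ^ (3 / 2 : ℝ)) y = 3 / 2 * √(w y) * pd2 A w y := by
    have h1 := Real.hasDerivAt_rpow_const (x := w y) (p := 3 / 2) (Or.inr (by norm_num))
    rw [pd2_comp (ρ := fun x => x ^ (3 / 2 : ℝ)) h1.differentiableAt
      (hw.differentiable one_ne_zero y), h1.deriv, Real.sqrt_eq_rpow]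
    norm_num
  -- Here `f = F³ = w^(3/2)`, which is `C¹` also at zeros of `w`, with gradient at most `3 F² n`.
  -- Cauchy–Schwarz splits off `∫ F⁴` from both terms, and `18 = 2 · 3²`.
  have h := leaf_sobolev' hu hI (f := fun y => w y ^ (3 / 2 : ℝ)) (G := fun y => 3 * w y * n y)
    (hw.rpow_const_of_le (by norm_num)) (fun y => Real.rpow_nonneg (hw0 y) _)
    ((measurable_const.mul hwm).mul hn) (fun y => mul_nonneg (by have := hw0 y; positivity) (hn0 y))
    fun y => by
      have h1 : M.cof u y (pd2 0 (fun z => w z ^ (3 / 2 : ℝ)) y)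
          (pd2 1 (fun z => w z ^ (3 / 2 : ℝ)) y) =
          9 / 4 * √(w y) ^ 2 * M.cof u y (pd2 0 w y) (pd2 1 w y) := by
        rw [hpd, hpd, cof, cof]; ring
      rw [h1, Real.sq_sqrt (hw0 y)]
      have := mul_le_mul_of_nonneg_left (hwn y) (by have := hw0 y; positivity : 0 ≤ 9 / 4 * w y)
      refine this.trans (le_of_eq ?_)
      ring
  simp only [hf3] at h
  refine h.trans ?_
  set e := ∫⁻ y, ENNReal.ofReal (w y + M.areaRadius u ^ 2 * n y ^ 2) ∂M.leafMeasure u with he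
  set F := ∫⁻ y, ENNReal.ofReal (w y ^ 2) ∂M.leafMeasure u with hF
  have h1 : (∫⁻ y, ENNReal.ofReal (w y ^ (3 / 2 : ℝ)) ∂M.leafMeasure u) ^ 2 ≤ F * e := by
    have h2 := lintegral_mul_sq_le (μ := M.leafMeasure u) hwm.ennreal_ofReal.aemeasurable
      hw.continuous.sqrt.measurable.ennreal_ofReal.aemeasurable
    simp only [← ENNReal.ofReal_mul (hw0 _), ← ENNReal.ofReal_pow (hw0 _),
      ← ENNReal.ofReal_pow (Real.sqrt_nonneg _), Real.sq_sqrt (hw0 _), ← hf1] at h2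
    refine h2.trans (mul_le_mul_right (lintegral_mono fun y => ENNReal.ofReal_le_ofReal ?_) _)
    have := sq_nonneg (M.areaRadius u * n y)
    nlinarith
  have h2 : (∫⁻ y, ENNReal.ofReal (M.areaRadius u * (3 * w y * n y)) ∂M.leafMeasure u) ^ 2 ≤
      9 * (F * e) := by
    have h2 := lintegral_mul_sq_le (μ := M.leafMeasure u) hwm.ennreal_ofReal.aemeasurable
      (hn.const_mul (3 * M.areaRadius u)).ennreal_ofReal.aemeasurable
    simp only [← ENNReal.ofReal_mul (hw0 _), ← ENNReal.ofReal_pow (hw0 _)] at h2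
    have h3 : ∫⁻ y, ENNReal.ofReal (3 * M.areaRadius u * n y) ^ 2 ∂M.leafMeasure u ≤ 9 * e := by
      rw [he, ← lintegral_const_mul' _ _ (by simp)]
      refine lintegral_mono fun y => ?_
      have h9 : (9 : ℝ≥0∞) = ENNReal.ofReal 9 := by simp
      rw [← ENNReal.ofReal_pow (mul_nonneg (by positivity) (hn0 y)), h9,
        ← ENNReal.ofReal_mul (by norm_num)]
      refine ENNReal.ofReal_le_ofReal ?_
      nlinarith [hw0 y]
    calc _ = (∫⁻ y, ENNReal.ofReal (w y * (3 * M.areaRadius u * n y)) ∂M.leafMeasure u) ^ 2 := by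
          congr 2; ext y; congr 1; ring
      _ ≤ F * (9 * e) := h2.trans (mul_le_mul_right h3 _)
      _ = 9 * (F * e) := by ring
  calc _ ≤ 2 * leafConst I₀ * (9 * (F * e)) + F * e := by gcongr
    _ = _ := by ring

end Leaf
end FoliatedCylinder
-- The variation of `∫_{S_u} r⁴ w²` with `u`
namespace FoliatedCylinder
variable {M : FoliatedCylinder}

/-- `w` is the square of a function whose gradient has norm at most `N`. -/
structure Controlled (M : FoliatedCylinder) (w N : Coord → ℝ) : Prop where
  contDiffOn : ContDiffOn ℝ 1 w (M.J ×ˢ Set.univ)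
  nonneg : ∀ p : Coord, p.1 ∈ M.J → 0 ≤ w p
  continuousOn : ContinuousOn N (M.J ×ˢ Set.univ)
  deriv_nonneg : ∀ p : Coord, p.1 ∈ M.J → 0 ≤ N p
  pd_zero_le : ∀ p : Coord, p.1 ∈ M.J →
    pd 0 w p ^ 2 ≤ M.a p.1 (stereoS p.2) ^ 2 * (4 * w p * N p ^ 2)
  cof_le : ∀ p : Coord, p.1 ∈ M.J →
    M.cof p.1 p.2 (pd 1 w p) (pd 2 w p) ≤ (M.leafMetric p.1 p.2).det * (4 * w p * N p ^ 2)

/-- `∫_{S_u} w + r² N²` -/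
def leafEnergy (M : FoliatedCylinder) (w N : Coord → ℝ) (u : ℝ) : ℝ≥0∞ :=
  ∫⁻ y, ENNReal.ofReal (w (u, y) + M.areaRadius u ^ 2 * N (u, y) ^ 2) ∂M.leafMeasure u

/-- `∫_{S_u} r⁴ w²` -/
def leafFour (M : FoliatedCylinder) (w : Coord → ℝ) (u : ℝ) : ℝ≥0∞ :=
  ∫⁻ y, ENNReal.ofReal (M.areaRadius u ^ 4 * w (u, y) ^ 2) ∂M.leafMeasure u

namespace Controlled
variable {w N : Coord → ℝ}

theorem contDiff_slice (hc : Controlled M w N) {u : ℝ} (hu : u ∈ M.J) :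
    ContDiff ℝ 1 fun y => w (u, y) := contDiff_leaf hc.contDiffOn hu

theorem continuous_slice_deriv (hc : Controlled M w N) {u : ℝ} (hu : u ∈ M.J) :
    Continuous fun y => N (u, y) :=
  hc.continuousOn.comp_continuous (Continuous.prodMk_right u) fun _ => ⟨hu, trivial⟩

theorem cof_slice_le (hc : Controlled M w N) {u : ℝ} (hu : u ∈ M.J) (y : E2) :
    M.cof u y (pd2 0 (fun y => w (u, y)) y) (pd2 1 (fun y => w (u, y)) y) ≤
      (M.leafMetric u y).det * (4 * w (u, y) * N (u, y) ^ 2) := by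
  rw [pd2_slice one_ne_zero hc.contDiffOn hu, pd2_slice one_ne_zero hc.contDiffOn hu]
  exact hc.cof_le (u, y) hu

theorem leafFour_eq (u : ℝ) : M.leafFour w u =
    ENNReal.ofReal (M.areaRadius u ^ 4) * ∫⁻ y, ENNReal.ofReal (w (u, y) ^ 2) ∂M.leafMeasure u := by
  rw [leafFour, ← lintegral_const_mul' _ _ ENNReal.ofReal_ne_top]
  refine lintegral_congr fun y => ?_
  rw [ENNReal.ofReal_mul' (sq_nonneg _)]

/-- Serves only to find leaves with small `leafFour`; the factor `r²` prevents its use as a uniform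
bound. -/
theorem leafFour_le (hc : Controlled M w N) {u : ℝ} (hu : u ∈ M.J) {I₀ : ℝ≥0}
    (hI : M.isoConst u ≤ I₀) :
    M.leafFour w u ≤ (2 * leafConst I₀ + 1) * ENNReal.ofReal (M.areaRadius u ^ 2) *
      M.leafEnergy w N u ^ 2 := by
  have h := leaf_L4_le hu hI (hc.contDiff_slice hu) (fun y => hc.nonneg (u, y) hu)
    (hc.continuous_slice_deriv hu).measurable (fun y => hc.deriv_nonneg (u, y) hu)
    (hc.cof_slice_le hu)
  rw [leafFour_eq, show M.areaRadius u ^ 4 = M.areaRadius u ^ 2 * M.areaRadius u ^ 2 by ring,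
    ENNReal.ofReal_mul (sq_nonneg _), mul_assoc]
  refine (mul_le_mul_right h _).trans (le_of_eq ?_)
  rw [leafEnergy]
  ring

/-- Used twice: in the growth estimate for `leafFour`, and integrated over `u` for the final `L⁶`
inequality. -/
theorem leafSix_le (hc : Controlled M w N) {u : ℝ} (hu : u ∈ M.J) {I₀ : ℝ≥0}
    (hI : M.isoConst u ≤ I₀) :
    ∫⁻ y, ENNReal.ofReal (M.areaRadius u ^ 6 * w (u, y) ^ 3) ∂M.leafMeasure u ≤
      (18 * leafConst I₀ + 1) * M.leafFour w u * M.leafEnergy w N u := by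
  have hr := areaRadius_pos hu
  have h := leaf_L6_le hu hI (hc.contDiff_slice hu) (fun y => hc.nonneg (u, y) hu)
    (hc.continuous_slice_deriv hu).measurable (fun y => hc.deriv_nonneg (u, y) hu)
    (hc.cof_slice_le hu)
  have h1 (y : E2) : ENNReal.ofReal (M.areaRadius u ^ 6 * w (u, y) ^ 3) =
      ENNReal.ofReal (M.areaRadius u ^ 4) * (ENNReal.ofReal (M.areaRadius u ^ 2) *
        ENNReal.ofReal (w (u, y) ^ 3)) := by
    rw [← mul_assoc, ← ENNReal.ofReal_mul (by positivity), ← ENNReal.ofReal_mul (by positivity)]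
    congr 1; ring
  simp only [h1]
  rw [lintegral_const_mul' _ _ ENNReal.ofReal_ne_top,
    lintegral_const_mul' _ _ ENNReal.ofReal_ne_top]
  refine (mul_le_mul_right h _).trans (le_of_eq ?_)
  rw [leafFour_eq, leafEnergy]
  ring

theorem abs_pd_zero_le (hc : Controlled M w N) {aM : ℝ} (haM : ∀ u ∈ M.J, ∀ x, M.a u x ≤ aM)
    {p : Coord} (hp : p.1 ∈ M.J) : |pd 0 w p| ≤ aM * (2 * √(w p) * N p) := by
  have ha := M.a_pos p.1 hp (stereoS p.2)
  have hw := hc.nonneg p hp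
  have hN := hc.deriv_nonneg p hp
  calc |pd 0 w p| ≤ M.a p.1 (stereoS p.2) * (2 * √(w p) * N p) := by
        refine abs_le_of_sq_le_sq ?_ (by positivity)
        refine (hc.pd_zero_le p hp).trans (le_of_eq ?_)
        rw [mul_pow, mul_pow, mul_pow, Real.sq_sqrt hw]
        ring
    _ ≤ _ := mul_le_mul_of_nonneg_right (haM _ hp _) (by positivity)

/-- A bound for the derivative in `u` of the density `r⁴ w² dμ`. -/
def rateDensity (M : FoliatedCylinder) (aM h : ℝ) (w N : Coord → ℝ) (p : Coord) : ℝ :=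
  aM * (3 * h * M.areaRadius p.1 ^ 3 * w p ^ 2 +
    4 * M.areaRadius p.1 ^ 4 * (w p * √(w p) * N p))

theorem continuousOn_rateDensity (hc : Controlled M w N) (aM h : ℝ) :
    ContinuousOn (rateDensity M aM h w N) (M.J ×ˢ Set.univ) := by
  have hr : ContinuousOn (fun p : Coord => M.areaRadius p.1) (M.J ×ˢ Set.univ) :=
    continuousOn_areaRadius.comp continuousOn_fst fun p hp => hp.1
  have hw := hc.contDiffOn.continuousOn
  have hN := hc.continuousOn
  unfold rateDensity
  fun_prop

theorem leafFour_eq_lintegral {u : ℝ} (hu : u ∈ M.J) : M.leafFour w u =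
    ∫⁻ y, ENNReal.ofReal (M.areaRadius u ^ 4 * w (u, y) ^ 2 * M.areaDensity u y) := by
  rw [leafFour, lintegral_leafMeasure hu]
  exact lintegral_congr fun y => (ENNReal.ofReal_mul' (areaDensity_pos hu y).le).symm

section Rate
variable {aM h : ℝ} (haM : ∀ u ∈ M.J, ∀ x, M.a u x ≤ aM)
  (hH : ∀ u ∈ M.J, ∀ y, |M.areaRadius u * M.meanCurvature (u, y)| ≤ h)
include haM hH

theorem rateDensity_nonneg (hc : Controlled M w N) {p : Coord} (hp : p.1 ∈ M.J) :
    0 ≤ rateDensity M aM h w N p := by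
  have haM0 : 0 ≤ aM := (M.a_pos _ hp (stereoS 0)).le.trans (haM _ hp _)
  have hh0 : 0 ≤ h := (abs_nonneg _).trans (hH _ hp 0)
  have := areaRadius_pos hp
  have := hc.nonneg p hp
  have := hc.deriv_nonneg p hp
  unfold rateDensity
  positivity

/-- In `rateDensity`, the coefficient `3h` is `2h` from `r⁴`, by `|r'| ≤ a_M h / 2`, plus `h` from
the area element; the `4` comes from `w²`, by `|∂_u w| ≤ 2 a_M √w N`. -/
theorem hasDerivAt_density (hc : Controlled M w N) {u : ℝ} (hu : u ∈ M.J) (y : E2) :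
    ∃ g' : ℝ, HasDerivAt (fun v => M.areaRadius v ^ 4 * w (v, y) ^ 2 * M.areaDensity v y) g' u ∧
      |g'| ≤ rateDensity M aM h w N (u, y) * M.areaDensity u y := by
  have haM0 : 0 ≤ aM := (M.a_pos _ hu (stereoS 0)).le.trans (haM _ hu _)
  have hh0 : 0 ≤ h := (abs_nonneg _).trans (hH _ hu 0)
  have hr := areaRadius_pos hu
  obtain ⟨r', hr', hb⟩ := hasDerivAt_areaRadius haM hH hu
  have hw' := hasDerivAt_fst one_ne_zero hc.contDiffOn hu y
  have hwb := hc.abs_pd_zero_le haM (p := (u, y)) hu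
  have hd' := hasDerivAt_fst (M := M) (by simp) contDiffOn_areaDensity hu y
  have hdb := abs_pd_areaDensity_le haM hH hu y
  have hD := areaDensity_pos hu y
  refine ⟨_, ((hr'.pow 4).mul (hw'.pow 2)).mul hd', ?_⟩
  simp only [Pi.mul_apply, Pi.pow_apply]
  have hw0 : 0 ≤ w (u, y) := hc.nonneg (u, y) hu
  unfold rateDensity
  simp only
  generalize pd 0 (fun q => M.areaDensity q.1 q.2) (u, y) = D' at *
  generalize pd 0 w (u, y) = w' at *
  generalize w (u, y) = W at *
  generalize M.areaDensity u y = D at *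
  generalize M.areaRadius u = r at *
  generalize N (u, y) = n at *
  have e1 : (((4 : ℕ) : ℝ) * r ^ (4 - 1) * r' * W ^ 2 + r ^ 4 * (((2 : ℕ) : ℝ) * W ^ (2 - 1) * w')) * D +
      r ^ 4 * W ^ 2 * D' = 4 * r ^ 3 * W ^ 2 * D * r' + 2 * r ^ 4 * W * D * w' + r ^ 4 * W ^ 2 * D' := by
    push_cast; ring
  rw [e1]
  calc |4 * r ^ 3 * W ^ 2 * D * r' + 2 * r ^ 4 * W * D * w' + r ^ 4 * W ^ 2 * D'|
      ≤ 4 * r ^ 3 * W ^ 2 * D * |r'| + 2 * r ^ 4 * W * D * |w'| + r ^ 4 * W ^ 2 * |D'| := by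
        refine (abs_add_three _ _ _).trans (le_of_eq ?_)
        rw [abs_mul, abs_mul _ w', abs_mul _ D', abs_of_nonneg (by positivity : 0 ≤ 4 * r ^ 3 * W ^ 2 * D),
          abs_of_nonneg (by positivity : 0 ≤ 2 * r ^ 4 * W * D),
          abs_of_nonneg (by positivity : 0 ≤ r ^ 4 * W ^ 2)]
    _ ≤ 4 * r ^ 3 * W ^ 2 * D * (aM * h / 2) + 2 * r ^ 4 * W * D * (aM * (2 * √W * n)) +
        r ^ 4 * W ^ 2 * (aM * h / r * D) := by gcongr
    _ = _ := by field_simp; ring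

/-- The derivative is known only pointwise, not to be integrable; a mean value inequality with a
continuous majorant replaces the fundamental theorem of calculus. -/
theorem density_sub_le (hc : Controlled M w N) {u v : ℝ} (huv : u ≤ v)
    (hJ : Set.Icc u v ⊆ M.J) (y : E2) :
    |M.areaRadius v ^ 4 * w (v, y) ^ 2 * M.areaDensity v y -
      M.areaRadius u ^ 4 * w (u, y) ^ 2 * M.areaDensity u y| ≤
      ∫ τ in u..v, rateDensity M aM h w N (τ, y) * M.areaDensity τ y := by
  choose! g' hg' hb using fun u hu => hc.hasDerivAt_density haM hH (u := u) hu y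
  have hcont : ContinuousOn (fun τ => rateDensity M aM h w N (τ, y) * M.areaDensity τ y)
      (Set.Icc u v) :=
    ((hc.continuousOn_rateDensity aM h).mul contDiffOn_areaDensity.continuousOn).comp
      (Continuous.prodMk_left y).continuousOn fun τ hτ => ⟨hJ hτ, trivial⟩
  have hint := hcont.integrableOn_Icc (μ := volume)
  rw [abs_le]
  constructor
  · have := intervalIntegral.sub_le_integral_of_hasDeriv_right_of_le huv
      (g := fun v => -(M.areaRadius v ^ 4 * w (v, y) ^ 2 * M.areaDensity v y))
      (g' := fun v => - g' v)
      (fun τ hτ => (hg' τ (hJ hτ)).neg.continuousAt.continuousWithinAt)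
      (fun τ hτ => (hg' τ (hJ (Set.Ioo_subset_Icc_self hτ))).neg.hasDerivWithinAt) hint
      (fun τ hτ => (neg_le_abs _).trans (hb τ (hJ (Set.Ioo_subset_Icc_self hτ))))
    linarith
  · exact intervalIntegral.sub_le_integral_of_hasDeriv_right_of_le huv
      (fun τ hτ => (hg' τ (hJ hτ)).continuousAt.continuousWithinAt)
      (fun τ hτ => (hg' τ (hJ (Set.Ioo_subset_Icc_self hτ))).hasDerivWithinAt) hint
      (fun τ hτ => (le_abs_self _).trans (hb τ (hJ (Set.Ioo_subset_Icc_self hτ))))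

/-- Integrates the pointwise estimate over the leaf and applies Tonelli, so `leafFour` itself is
never differentiated. Both directions are needed because the leaf of comparison may lie on either
side. -/
theorem leafFour_le_add (hc : Controlled M w N) {u v : ℝ} (huv : u ≤ v)
    (hJ : Set.Icc u v ⊆ M.J) :
    M.leafFour w v ≤ M.leafFour w u + ∫⁻ τ in Set.Icc u v, ∫⁻ y,
        ENNReal.ofReal (rateDensity M aM h w N (τ, y)) ∂M.leafMeasure τ ∧
    M.leafFour w u ≤ M.leafFour w v + ∫⁻ τ in Set.Icc u v, ∫⁻ y,
        ENNReal.ofReal (rateDensity M aM h w N (τ, y)) ∂M.leafMeasure τ := by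
  have hu : u ∈ M.J := hJ (Set.left_mem_Icc.2 huv)
  have hv : v ∈ M.J := hJ (Set.right_mem_Icc.2 huv)
  set b : ℝ → E2 → ℝ := fun τ y => rateDensity M aM h w N (τ, y) * M.areaDensity τ y with hb
  have hbc : ContinuousOn (Function.uncurry b) (M.J ×ˢ Set.univ) :=
    (hc.continuousOn_rateDensity aM h).mul contDiffOn_areaDensity.continuousOn
  have hb0 (τ : ℝ) (hτ : τ ∈ M.J) (y : E2) : 0 ≤ b τ y :=
    mul_nonneg (hc.rateDensity_nonneg haM hH (p := (τ, y)) hτ) (areaDensity_pos hτ y).le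
  have hint (y : E2) : ENNReal.ofReal (∫ τ in u..v, b τ y) =
      ∫⁻ τ in Set.Icc u v, ENNReal.ofReal (b τ y) := by
    have hcont : ContinuousOn (fun τ => b τ y) (Set.Icc u v) :=
      ContinuousOn.comp (g := Function.uncurry b) (f := fun τ => ((τ, y) : Coord))
        (t := M.J ×ˢ Set.univ) hbc (Continuous.prodMk_left y).continuousOn
        fun τ hτ => ⟨hJ hτ, trivial⟩
    rw [intervalIntegral.integral_of_le huv, ← integral_Icc_eq_integral_Ioc,
      ofReal_integral_eq_lintegral_ofReal (f := fun τ => b τ y) hcont.integrableOn_Icc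
        (ae_restrict_of_forall_mem measurableSet_Icc fun τ hτ => hb0 τ (hJ hτ) y)]
  have hswap : ∫⁻ y, ∫⁻ τ in Set.Icc u v, ENNReal.ofReal (b τ y) =
      ∫⁻ τ in Set.Icc u v, ∫⁻ y, ENNReal.ofReal (rateDensity M aM h w N (τ, y))
        ∂M.leafMeasure τ := by
    rw [← lintegral_lintegral_swap]
    · refine setLIntegral_congr_fun measurableSet_Icc fun τ hτ => ?_
      rw [lintegral_leafMeasure (hJ hτ)]
      exact lintegral_congr fun y => ENNReal.ofReal_mul' (areaDensity_pos (hJ hτ) y).le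
    · have h1 : (volume.restrict (Set.Icc u v)).prod (volume : Measure E2) =
          (volume : Measure Coord).restrict (Set.Icc u v ×ˢ Set.univ) := by
        rw [Measure.volume_eq_prod, ← Measure.prod_restrict, Measure.restrict_univ]
      rw [h1]
      exact ((hbc.mono (Set.prod_mono hJ subset_rfl)).aemeasurable
        (measurableSet_Icc.prod MeasurableSet.univ)).ennreal_ofReal
  have key {s t : ℝ} (hs : s ∈ M.J) (ht : t ∈ M.J)
      (hst : ∀ y, M.areaRadius t ^ 4 * w (t, y) ^ 2 * M.areaDensity t y ≤
        M.areaRadius s ^ 4 * w (s, y) ^ 2 * M.areaDensity s y + ∫ τ in u..v, b τ y) :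
      M.leafFour w t ≤ M.leafFour w s + ∫⁻ τ in Set.Icc u v, ∫⁻ y,
        ENNReal.ofReal (rateDensity M aM h w N (τ, y)) ∂M.leafMeasure τ := by
    rw [leafFour_eq_lintegral ht, leafFour_eq_lintegral hs, ← hswap,
      ← lintegral_add_left]
    · refine lintegral_mono fun y => ?_
      rw [← hint]
      exact (ENNReal.ofReal_le_ofReal (hst y)).trans ENNReal.ofReal_add_le
    · exact (((continuous_const.mul ((hc.contDiff_slice hs).continuous.pow 2)).mul
        (continuous_areaDensity hs))).measurable.ennreal_ofReal
  have hsub := hc.density_sub_le haM hH huv hJ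
  exact ⟨key hu hv fun y => by have := (abs_le.1 (hsub y)).2; linarith,
    key hv hu fun y => by have := (abs_le.1 (hsub y)).1; linarith⟩

/-- Young's inequality with weight `s`: `r³ F³ (F + rN) ≤ s⁻¹ r⁶ F⁶ + s (F² + r² N²)`. The `L⁶`
bound and `φ ≤ s²` make both terms linear in `s`. A positive bound `s` in place of `√φ` avoids
division by zero. -/
theorem lintegral_rateDensity_le (hc : Controlled M w N) {u : ℝ} (hu : u ∈ M.J) {I₀ : ℝ≥0}
    (hI : M.isoConst u ≤ I₀) {s : ℝ} (hs : 0 < s) (hφ : M.leafFour w u ≤ ENNReal.ofReal (s ^ 2)) :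
    ∫⁻ y, ENNReal.ofReal (rateDensity M aM h w N (u, y)) ∂M.leafMeasure u ≤
      ENNReal.ofReal (aM * (3 * h + 4)) * (18 * leafConst I₀ + 2) * ENNReal.ofReal s *
        M.leafEnergy w N u := by
  have haM0 : 0 ≤ aM := (M.a_pos _ hu (stereoS 0)).le.trans (haM _ hu _)
  have hh0 : 0 ≤ h := (abs_nonneg _).trans (hH _ hu 0)
  have hr := areaRadius_pos hu
  have hpt (y : E2) : rateDensity M aM h w N (u, y) ≤ (aM * (3 * h + 4)) *
      (s⁻¹ * (M.areaRadius u ^ 6 * w (u, y) ^ 3) +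
        s * (w (u, y) + M.areaRadius u ^ 2 * N (u, y) ^ 2)) := by
    have hw0 : 0 ≤ w (u, y) := hc.nonneg (u, y) hu
    have hn0 : 0 ≤ N (u, y) := hc.deriv_nonneg (u, y) hu
    unfold rateDensity
    simp only
    generalize w (u, y) = W at *
    generalize M.areaRadius u = r at *
    generalize N (u, y) = n at *
    rw [mul_assoc aM]
    refine mul_le_mul_of_nonneg_left ?_ haM0
    obtain ⟨F, hF0, rfl⟩ : ∃ F : ℝ, 0 ≤ F ∧ W = F ^ 2 :=
      ⟨√W, Real.sqrt_nonneg _, (Real.sq_sqrt hw0).symm⟩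
    rw [Real.sqrt_sq hF0]
    have h1 : 3 * h * r ^ 3 * (F ^ 2) ^ 2 + 4 * r ^ 4 * (F ^ 2 * F * n) ≤
        (3 * h + 4) * ((r ^ 3 * F ^ 3) * (F + r * n)) := by
      have h2 : 0 ≤ h * (r ^ 3 * F ^ 3) * (r * n) := by positivity
      have h3 : 0 ≤ r ^ 3 * F ^ 3 * F := by positivity
      linarith
    refine h1.trans (mul_le_mul_of_nonneg_left ?_ (by positivity))
    have h2 : s⁻¹ * (r ^ 6 * (F ^ 2) ^ 3) = s * (s⁻¹ * (r ^ 3 * F ^ 3)) ^ 2 := by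
      field_simp
    have h3 : r ^ 3 * F ^ 3 = s * (s⁻¹ * (r ^ 3 * F ^ 3)) := by field_simp
    rw [h2, ← mul_add]
    nth_rewrite 1 [h3]
    rw [mul_assoc]
    refine mul_le_mul_of_nonneg_left ?_ hs.le
    nlinarith [sq_nonneg (s⁻¹ * (r ^ 3 * F ^ 3) - F), sq_nonneg (s⁻¹ * (r ^ 3 * F ^ 3) - r * n)]
  have h6 := hc.leafSix_le hu hI
  have hm : Measurable fun y => ENNReal.ofReal (s⁻¹ * (M.areaRadius u ^ 6 * w (u, y) ^ 3)) :=
    (continuous_const.mul (continuous_const.mul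
      ((hc.contDiff_slice hu).continuous.pow 3))).measurable.ennreal_ofReal
  calc _ ≤ ∫⁻ y, ENNReal.ofReal (aM * (3 * h + 4)) *
        (ENNReal.ofReal (s⁻¹ * (M.areaRadius u ^ 6 * w (u, y) ^ 3)) +
        ENNReal.ofReal (s * (w (u, y) + M.areaRadius u ^ 2 * N (u, y) ^ 2)))
          ∂M.leafMeasure u := by
        refine lintegral_mono fun y => (ENNReal.ofReal_le_ofReal (hpt y)).trans ?_
        rw [ENNReal.ofReal_mul (by positivity)]
        gcongr
        exact ENNReal.ofReal_add_le
    _ = ENNReal.ofReal (aM * (3 * h + 4)) * (ENNReal.ofReal s⁻¹ *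
        (∫⁻ y, ENNReal.ofReal (M.areaRadius u ^ 6 * w (u, y) ^ 3) ∂M.leafMeasure u) +
        ENNReal.ofReal s * M.leafEnergy w N u) := by
        rw [lintegral_const_mul' _ _ ENNReal.ofReal_ne_top, lintegral_add_left hm]
        simp only [ENNReal.ofReal_mul (inv_pos.2 hs).le, ENNReal.ofReal_mul hs.le]
        rw [lintegral_const_mul' _ _ ENNReal.ofReal_ne_top,
          lintegral_const_mul' _ _ ENNReal.ofReal_ne_top]
        rfl
    _ ≤ ENNReal.ofReal (aM * (3 * h + 4)) * (ENNReal.ofReal s⁻¹ *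
        ((18 * leafConst I₀ + 1) * ENNReal.ofReal (s ^ 2) * M.leafEnergy w N u) +
        ENNReal.ofReal s * M.leafEnergy w N u) := by
        gcongr
        exact h6.trans (by gcongr)
    _ = _ := by
        have h1 : ENNReal.ofReal s⁻¹ * ENNReal.ofReal (s ^ 2) = ENNReal.ofReal s := by
          rw [← ENNReal.ofReal_mul (by positivity)]
          congr 1; field_simp
        rw [show ENNReal.ofReal s⁻¹ * ((18 * leafConst I₀ + 1) * ENNReal.ofReal (s ^ 2) *
          M.leafEnergy w N u) = (ENNReal.ofReal s⁻¹ * ENNReal.ofReal (s ^ 2)) *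
            ((18 * leafConst I₀ + 1) * M.leafEnergy w N u) by ring, h1]
        ring

end Rate
end Controlled
end FoliatedCylinder

/-! ### Divergent integrals over unbounded intervals -/

/-- For `x > 1` the integrand is at least `η / ((R + k) x)`, whose integral diverges
logarithmically. -/
theorem lintegral_inv_linear_eq_top {η R k : ℝ} (hη : 0 < η) (hR : 0 < R) (hk : 0 ≤ k) :
    ∫⁻ x, (Set.Ici (0 : ℝ)).indicator (fun x => ENNReal.ofReal (η / (R + k * |x|))) x = ⊤ := by
  rw [lintegral_indicator measurableSet_Ici]
  by_contra htop
  have hsub : Set.Ioi (1 : ℝ) ⊆ Set.Ici 0 := fun x hx =>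
    Set.mem_Ici.2 (zero_le_one.trans (le_of_lt (Set.mem_Ioi.1 hx)))
  have h1 : ∫⁻ x in Set.Ioi (1 : ℝ), ENNReal.ofReal (η / (R + k) * x⁻¹) < ⊤ := by
    refine lt_of_le_of_lt ?_ (lt_top_iff_ne_top.2 htop)
    refine (setLIntegral_mono' measurableSet_Ioi fun x hx => ?_).trans (lintegral_mono_set hsub)
    have hx1 : (1 : ℝ) < x := hx
    have hx0 : 0 < x := by linarith
    refine ENNReal.ofReal_le_ofReal ?_
    rw [abs_of_pos hx0, ← div_eq_mul_inv, div_div]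
    refine div_le_div_of_nonneg_left hη.le (by positivity) ?_
    nlinarith
  have h2 : IntegrableOn (fun x : ℝ => η / (R + k) * x⁻¹) (Set.Ioi 1) := by
    refine ⟨(measurable_const.mul measurable_inv).aestronglyMeasurable, ?_⟩
    rw [hasFiniteIntegral_iff_ofReal]
    · exact h1
    · exact ae_restrict_of_forall_mem measurableSet_Ioi fun x hx => by
        have hx1 : (1 : ℝ) < x := hx
        have hx0 : 0 < x := by linarith
        simp only [Pi.zero_apply]
        positivity
  refine not_integrableOn_Ioi_inv (a := 1) ?_
  have h3 := h2.const_mul (η / (R + k))⁻¹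
  refine h3.congr (Filter.Eventually.of_forall fun x => ?_)
  have : R + k ≠ 0 := by positivity
  simp only
  field_simp

theorem Ici_or_Iic_subset {J : Set ℝ} (hJ : J.OrdConnected) (hb : ¬ Bornology.IsBounded J) {u : ℝ}
    (hu : u ∈ J) : Set.Ici u ⊆ J ∨ Set.Iic u ⊆ J := by
  by_contra! h
  obtain ⟨⟨x, hx, hxJ⟩, ⟨y, hy, hyJ⟩⟩ := And.intro (Set.not_subset.1 h.1) (Set.not_subset.1 h.2)
  refine hb ((Metric.isBounded_Icc y x).subset fun z hz => ⟨?_, ?_⟩)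
  · by_contra hlt
    exact hyJ (hJ.out hz hu ⟨(not_le.1 hlt).le, hy⟩)
  · by_contra hlt
    exact hxJ (hJ.out hu hz ⟨hx, (not_le.1 hlt).le⟩)

/-- `1 / (R + k |v - u|)` is not integrable over an unbounded interval. -/
theorem setLIntegral_inv_linear_eq_top {J : Set ℝ} (hJ : J.OrdConnected)
    (hb : ¬ Bornology.IsBounded J) (hm : MeasurableSet J) {u : ℝ} (hu : u ∈ J) {η R k : ℝ}
    (hη : 0 < η) (hR : 0 < R) (hk : 0 ≤ k) :
    ∫⁻ v in J, ENNReal.ofReal (η / (R + k * |v - u|)) = ⊤ := by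
  have h := lintegral_inv_linear_eq_top hη hR hk
  rw [eq_top_iff, ← lintegral_indicator hm]
  rcases Ici_or_Iic_subset hJ hb hu with hs | hs
  · rw [← h, ← lintegral_sub_right_eq_self _ u]
    refine lintegral_mono fun v => ?_
    by_cases hv : u ≤ v
    · rw [Set.indicator_of_mem (by simpa using hv), Set.indicator_of_mem (hs hv)]
    · rw [Set.indicator_of_notMem (by simpa using hv)]; simp
  · rw [← h, ← lintegral_sub_left_eq_self _ u]
    refine lintegral_mono fun v => ?_
    by_cases hv : v ≤ u
    · rw [Set.indicator_of_mem (by simpa using hv), Set.indicator_of_mem (hs hv), abs_sub_comm]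
    · rw [Set.indicator_of_notMem (by simpa using hv)]; simp

namespace FoliatedCylinder
variable {M : FoliatedCylinder}
namespace Controlled
variable {w N : Coord → ℝ}

/-! ### Truncation -/

/-- A bounded function comparable to `min w m`. -/
def truncate (m : ℝ) (w : Coord → ℝ) (p : Coord) : ℝ := w p * (m / (m + w p))

theorem truncate_le {m : ℝ} (hm : 0 < m) (hc : Controlled M w N) {p : Coord} (hp : p.1 ∈ M.J) :
    truncate m w p ≤ w p := by
  have hw := hc.nonneg p hp
  refine mul_le_of_le_one_right hw ?_
  rw [div_le_one (by positivity)]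
  linarith

theorem truncate_le_const {m : ℝ} (hm : 0 < m) (hc : Controlled M w N) {p : Coord}
    (hp : p.1 ∈ M.J) : truncate m w p ≤ m := by
  have hw := hc.nonneg p hp
  rw [truncate, mul_div, div_le_iff₀ (by positivity)]
  nlinarith

theorem pd_truncate {m : ℝ} (hm : 0 < m) (hc : Controlled M w N) {p : Coord} (hp : p.1 ∈ M.J)
    (i : Fin 3) : pd i (truncate m w) p = (m / (m + w p)) ^ 2 * pd i w p := by
  have hw := hc.nonneg p hp
  have hne : m + w p ≠ 0 := by positivity
  have h1 : HasDerivAt (fun s : ℝ => s * (m / (m + s))) ((m / (m + w p)) ^ 2) (w p) := by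
    have h2 := (hasDerivAt_id (w p)).mul
      ((hasDerivAt_const (w p) m).div ((hasDerivAt_id (w p)).const_add m) hne)
    refine h2.congr_deriv ?_
    simp only [id, Pi.div_apply]
    field_simp
    ring
  have h2 := (h1.comp_hasFDerivAt p
    (differentiableAt_of_contDiffOn one_ne_zero hc.contDiffOn hp).hasFDerivAt).fderiv
  rw [pd, pd, show truncate m w = (fun s : ℝ => s * (m / (m + s))) ∘ w from rfl, h2]
  simp

/-- The squared derivative of the truncation is the fourth power of `m / (m + w) ≤ 1`, and one power
of it suffices. -/
theorem truncate_mul_le {m : ℝ} (hm : 0 < m) (hc : Controlled M w N) {p : Coord}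
    (hp : p.1 ∈ M.J) : ((m / (m + w p)) ^ 2) ^ 2 * w p ≤ truncate m w p := by
  have hw := hc.nonneg p hp
  have h1 : m / (m + w p) ≤ 1 := by
    rw [div_le_one (by positivity)]; linarith
  have h0 : 0 ≤ m / (m + w p) := by positivity
  rw [truncate, mul_comm, ← pow_mul]
  exact mul_le_mul_of_nonneg_left (pow_le_of_le_one h0 h1 (by norm_num)) hw

/-- Truncation does not increase the gradient of `√w`, so the same `N` serves. -/
theorem controlled_truncate {m : ℝ} (hm : 0 < m) (hc : Controlled M w N) :
    Controlled M (truncate m w) N where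
  contDiffOn := hc.contDiffOn.mul (contDiffOn_const.div (contDiffOn_const.add hc.contDiffOn)
    fun p hp => by have := hc.nonneg p hp.1; positivity)
  nonneg p hp := by
    have := hc.nonneg p hp
    unfold truncate
    positivity
  continuousOn := hc.continuousOn
  deriv_nonneg := hc.deriv_nonneg
  pd_zero_le p hp := by
    have h1 := hc.truncate_mul_le hm hp
    rw [pd_truncate hm hc hp, mul_pow]
    refine (mul_le_mul_of_nonneg_left (hc.pd_zero_le p hp) (by positivity)).trans ?_
    have h2 : 0 ≤ M.a p.1 (stereoS p.2) ^ 2 * (4 * N p ^ 2) := by positivity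
    nlinarith [mul_le_mul_of_nonneg_left h1 h2]
  cof_le p hp := by
    have h1 := hc.truncate_mul_le hm hp
    have hD := leafMetric_det_pos hp p.2
    have h3 : M.cof p.1 p.2 (pd 1 (truncate m w) p) (pd 2 (truncate m w) p) =
        ((m / (m + w p)) ^ 2) ^ 2 * M.cof p.1 p.2 (pd 1 w p) (pd 2 w p) := by
      rw [pd_truncate hm hc hp, pd_truncate hm hc hp, cof, cof]; ring
    rw [h3]
    refine (mul_le_mul_of_nonneg_left (hc.cof_le p hp) (by positivity)).trans ?_
    have h2 : 0 ≤ (M.leafMetric p.1 p.2).det * (4 * N p ^ 2) := by positivity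
    nlinarith [mul_le_mul_of_nonneg_left h1 h2]

theorem leafEnergy_truncate_le {m : ℝ} (hm : 0 < m) (hc : Controlled M w N) {u : ℝ}
    (hu : u ∈ M.J) : M.leafEnergy (truncate m w) N u ≤ M.leafEnergy w N u :=
  lintegral_mono fun y => ENNReal.ofReal_le_ofReal
    (add_le_add (hc.truncate_le hm (p := (u, y)) hu) le_rfl)

theorem tendsto_truncate (p : Coord) :
    Filter.Tendsto (fun n : ℕ => truncate (n + 1) w p) Filter.atTop (nhds (w p)) := by
  have h := ((tendsto_natCast_div_add_atTop (w p)).comp (Filter.tendsto_add_atTop_nat 1)).const_mul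
    (w p)
  simpa [truncate, Function.comp_def] using h

/-! ### The supremum of `∫_{S_u} r⁴ w²` -/

section Rate
variable {aM h : ℝ} (haM : ∀ u ∈ M.J, ∀ x, M.a u x ≤ aM)
  (hH : ∀ u ∈ M.J, ∀ y, |M.areaRadius u * M.meanCurvature (u, y)| ≤ h)
  {I₀ : ℝ≥0} (hI : ∀ u ∈ M.J, M.isoConst u ≤ I₀)

theorem leafFour_le_of_bounded_at (hc : Controlled M w N) {m : ℝ}
    (hm : ∀ p : Coord, p.1 ∈ M.J → w p ≤ m) {u : ℝ} (hu : u ∈ M.J) :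
    M.leafFour w u ≤ ENNReal.ofReal (M.areaRadius u ^ 4 * m ^ 2 * M.leafArea u) := by
  have hm0 : 0 ≤ m := (hc.nonneg (u, 0) hu).trans (hm _ hu)
  have hr := areaRadius_pos hu
  rw [ENNReal.ofReal_mul (by positivity), ← leafMeasure_univ hu, ← lintegral_const]
  refine lintegral_mono fun y => ENNReal.ofReal_le_ofReal ?_
  have h0 := hc.nonneg (u, y) hu
  have h1 := hm (u, y) hu
  gcongr

include haM hH hI

theorem leafFour_le_add_of_le (hc : Controlled M w N) {u v s : ℝ} (hu : u ∈ M.J) (hv : v ∈ M.J)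
    (hs : 0 < s) (hφ : ∀ τ ∈ Set.uIcc u v, M.leafFour w τ ≤ ENNReal.ofReal (s ^ 2)) :
    M.leafFour w u ≤ M.leafFour w v + ENNReal.ofReal (aM * (3 * h + 4)) *
      (18 * leafConst I₀ + 2) * ENNReal.ofReal s * ∫⁻ τ in M.J, M.leafEnergy w N τ := by
  set κ := ENNReal.ofReal (aM * (3 * h + 4)) * (18 * leafConst I₀ + 2) * ENNReal.ofReal s with hκ
  have hκt : κ ≠ ⊤ := by
    rw [hκ]
    exact ENNReal.mul_ne_top (ENNReal.mul_ne_top (by simp)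
      (by simp [ENNReal.mul_eq_top])) (by simp)
  have key {b c : ℝ} (hJ : Set.Icc b c ⊆ M.J) (hsub : Set.Icc b c ⊆ Set.uIcc u v) :
      ∫⁻ τ in Set.Icc b c, ∫⁻ y, ENNReal.ofReal (rateDensity M aM h w N (τ, y))
        ∂M.leafMeasure τ ≤ κ * ∫⁻ τ in M.J, M.leafEnergy w N τ := by
    refine (setLIntegral_mono' measurableSet_Icc fun τ hτ =>
      hc.lintegral_rateDensity_le haM hH (hJ hτ) (hI τ (hJ hτ)) hs (hφ τ (hsub hτ))).trans ?_
    rw [lintegral_const_mul' _ _ hκt]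
    exact mul_le_mul_right (lintegral_mono_set hJ) _
  rcases le_total u v with huv | huv
  · have hJ := M.ordConnected_J.out hu hv
    exact (hc.leafFour_le_add haM hH huv hJ).2.trans
      (add_le_add le_rfl (key hJ (by rw [Set.uIcc_of_le huv])))
  · have hJ := M.ordConnected_J.out hv hu
    exact (hc.leafFour_le_add haM hH huv hJ).1.trans
      (add_le_add le_rfl (key hJ (by rw [Set.uIcc_of_ge huv])))

/-- Absorption: let `s²` be the supremum of `leafFour` over the segment from `u` to `v`. The growth
estimate gives `s² ≤ δ² + B s`, hence `s ≤ δ + B`. Boundedness of `w` makes `s` finite, without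
which nothing can be absorbed. -/
theorem leafFour_le_of_bounded (hc : Controlled M w N) {m : ℝ}
    (hm : ∀ p : Coord, p.1 ∈ M.J → w p ≤ m) {u v δ B : ℝ} (hu : u ∈ M.J) (hv : v ∈ M.J)
    (hδ : 0 ≤ δ) (hB0 : 0 ≤ B)
    (hB : ENNReal.ofReal (aM * (3 * h + 4)) * (18 * leafConst I₀ + 2) *
      ∫⁻ τ in M.J, M.leafEnergy w N τ ≤ ENNReal.ofReal B)
    (hvδ : M.leafFour w v ≤ ENNReal.ofReal (δ ^ 2)) :
    M.leafFour w u ≤ ENNReal.ofReal ((δ + B) ^ 2) := by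
  have hJ : Set.uIcc u v ⊆ M.J := M.ordConnected_J.uIcc_subset hu hv
  have hcont : ContinuousOn (fun τ => M.areaRadius τ ^ 4 * m ^ 2 * M.leafArea τ) (Set.uIcc u v) :=
    (((continuousOn_areaRadius.mono hJ).pow 4).mul continuousOn_const).mul
      fun τ hτ => (continuousAt_leafArea (hJ hτ)).continuousWithinAt
  have hne (τ : ℝ) (hτ : τ ∈ Set.uIcc u v) : M.leafFour w τ ≠ ⊤ :=
    ne_top_of_le_ne_top ENNReal.ofReal_ne_top (hc.leafFour_le_of_bounded_at hm (hJ hτ))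
  set S := (fun τ => (M.leafFour w τ).toReal) '' Set.uIcc u v with hS
  have hbdd : BddAbove S := by
    obtain ⟨C, hC⟩ := (isCompact_uIcc.image_of_continuousOn hcont).bddAbove
    refine ⟨C, ?_⟩
    rintro _ ⟨τ, hτ, rfl⟩
    have h1 := hC (Set.mem_image_of_mem _ hτ)
    refine le_trans ?_ h1
    refine ENNReal.toReal_le_of_le_ofReal ?_ (hc.leafFour_le_of_bounded_at hm (hJ hτ))
    have := leafArea_pos (hJ hτ)
    have := areaRadius_pos (hJ hτ)
    positivity
  have hSne : S.Nonempty := ⟨_, u, Set.left_mem_uIcc, rfl⟩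
  have hS0 : 0 ≤ sSup S := Real.sSup_nonneg (by rintro _ ⟨τ, -, rfl⟩; positivity)
  set s := √(sSup S) with hs
  have hs2 : s ^ 2 = sSup S := Real.sq_sqrt hS0
  have hφ (τ : ℝ) (hτ : τ ∈ Set.uIcc u v) : M.leafFour w τ ≤ ENNReal.ofReal (s ^ 2) := by
    rw [hs2, ← ENNReal.ofReal_toReal (hne τ hτ)]
    exact ENNReal.ofReal_le_ofReal (le_csSup hbdd ⟨τ, hτ, rfl⟩)
  have hsle : s ≤ δ + B := by
    by_contra hlt
    rw [not_le] at hlt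
    have hspos : 0 < s := by linarith
    have h1 : sSup S ≤ δ ^ 2 + B * s := by
      refine csSup_le hSne ?_
      rintro _ ⟨τ, hτ, rfl⟩
      refine ENNReal.toReal_le_of_le_ofReal (by positivity) ?_
      refine (hc.leafFour_le_add_of_le haM hH hI (hJ hτ) hv hspos fun σ hσ =>
        hφ σ (Set.uIcc_subset_uIcc hτ Set.right_mem_uIcc hσ)).trans ?_
      rw [ENNReal.ofReal_add (by positivity) (by positivity), ENNReal.ofReal_mul hB0]
      refine add_le_add hvδ ?_
      rw [mul_right_comm]
      exact mul_le_mul_left hB _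
    rw [← hs2] at h1
    nlinarith
  refine (hφ u Set.left_mem_uIcc).trans (ENNReal.ofReal_le_ofReal ?_)
  gcongr

/-- Otherwise `leafFour_le` forces `leafEnergy ≥ η / r` on all leaves, and `r` is at most linear, so
the energy would diverge over the unbounded `J`. -/
theorem exists_leafFour_le (hc : Controlled M w N) {u δ : ℝ} (hu : u ∈ M.J) (hδ : 0 < δ)
    (hE : ∫⁻ τ in M.J, M.leafEnergy w N τ ≠ ⊤) :
    ∃ v ∈ M.J, M.leafFour w v ≤ ENNReal.ofReal (δ ^ 2) := by
  by_contra! hcon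
  have haM0 : 0 ≤ aM := (M.a_pos _ hu (stereoS 0)).le.trans (haM _ hu _)
  have hh0 : 0 ≤ h := (abs_nonneg _).trans (hH _ hu 0)
  set c : ℝ := 2 * leafConst I₀ + 1 with hcdef
  have hc0 : 0 < c := by positivity
  have hcE : (2 * leafConst I₀ + 1 : ℝ≥0∞) = ENNReal.ofReal c := by
    rw [hcdef, ENNReal.ofReal_add (by positivity) (by positivity), ENNReal.ofReal_mul (by simp)]
    simp
  -- Chosen so that `c η² = δ²`, with `c` the constant of `leafFour_le`.
  set η := δ / √c with hη
  have hη0 : 0 < η := div_pos hδ (Real.sqrt_pos.2 hc0)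
  refine hE (eq_top_iff.2 ?_)
  rw [← setLIntegral_inv_linear_eq_top M.ordConnected_J M.unbounded_J M.isOpen_J.measurableSet hu
    hη0 (areaRadius_pos hu) (by positivity : 0 ≤ aM * h / 2)]
  refine setLIntegral_mono' M.isOpen_J.measurableSet fun v hv => ?_
  have hr := areaRadius_pos hv
  have hrv : M.areaRadius v ≤ M.areaRadius u + aM * h / 2 * |v - u| := by
    have := (abs_le.1 (abs_areaRadius_sub_le haM hH hu hv)).2
    linarith
  calc ENNReal.ofReal (η / (M.areaRadius u + aM * h / 2 * |v - u|))
      ≤ ENNReal.ofReal (η / M.areaRadius v) := ENNReal.ofReal_le_ofReal (by gcongr)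
    _ ≤ M.leafEnergy w N v := by
      by_contra hlt
      rw [not_le] at hlt
      refine absurd ((hcon v hv).trans_le (hc.leafFour_le hv (hI v hv))) (not_lt.2 ?_)
      calc _ ≤ (2 * leafConst I₀ + 1) * ENNReal.ofReal (M.areaRadius v ^ 2) *
            ENNReal.ofReal (η / M.areaRadius v) ^ 2 := by gcongr
        _ = ENNReal.ofReal (δ ^ 2) := by
          rw [hcE, ← ENNReal.ofReal_pow (by positivity), ← ENNReal.ofReal_mul (by positivity),
            ← ENNReal.ofReal_mul (by positivity)]
          congr 1
          rw [hη, div_pow, div_pow, Real.sq_sqrt hc0.le]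
          field_simp

/-- For each truncation let `δ → 0`; the bound `B` does not depend on the level, so Fatou's lemma
removes the truncation. -/
theorem leafFour_le_sq (hc : Controlled M w N) {u B : ℝ} (hu : u ∈ M.J) (hB0 : 0 ≤ B)
    (hE : ∫⁻ τ in M.J, M.leafEnergy w N τ ≠ ⊤)
    (hB : ENNReal.ofReal (aM * (3 * h + 4)) * (18 * leafConst I₀ + 2) *
      ∫⁻ τ in M.J, M.leafEnergy w N τ ≤ ENNReal.ofReal B) :
    M.leafFour w u ≤ ENNReal.ofReal (B ^ 2) := by
  have htr (n : ℕ) : M.leafFour (truncate (n + 1) w) u ≤ ENNReal.ofReal (B ^ 2) := by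
    have hn : (0 : ℝ) < n + 1 := by positivity
    have hcn := hc.controlled_truncate hn
    have hle : ∫⁻ τ in M.J, M.leafEnergy (truncate (n + 1) w) N τ ≤
        ∫⁻ τ in M.J, M.leafEnergy w N τ :=
      setLIntegral_mono' M.isOpen_J.measurableSet fun τ hτ => hc.leafEnergy_truncate_le hn hτ
    have hlim : Filter.Tendsto (fun δ : ℝ => ENNReal.ofReal ((δ + B) ^ 2))
        (nhdsWithin 0 (Set.Ioi 0)) (nhds (ENNReal.ofReal (B ^ 2))) := by
      have h1 : Continuous fun δ : ℝ => ENNReal.ofReal ((δ + B) ^ 2) :=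
        ENNReal.continuous_ofReal.comp ((continuous_id.add continuous_const).pow 2)
      simpa using (h1.tendsto 0).mono_left nhdsWithin_le_nhds
    refine ge_of_tendsto hlim ?_
    filter_upwards [self_mem_nhdsWithin] with δ hδ
    have hδ0 : 0 < δ := hδ
    obtain ⟨v, hv, hvδ⟩ := hcn.exists_leafFour_le haM hH hI hu hδ0 (ne_top_of_le_ne_top hE hle)
    exact hcn.leafFour_le_of_bounded haM hH hI (fun p hp => hc.truncate_le_const hn hp) hu hv
      hδ0.le hB0 ((mul_le_mul_right hle _).trans hB) hvδ
  have hmeas (n : ℕ) : Measurable fun y =>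
      ENNReal.ofReal (M.areaRadius u ^ 4 * truncate (n + 1) w (u, y) ^ 2) :=
    (continuous_const.mul
      (((hc.controlled_truncate (by positivity)).contDiff_slice hu).continuous.pow
        2)).measurable.ennreal_ofReal
  calc M.leafFour w u = ∫⁻ y, Filter.liminf (fun n : ℕ =>
        ENNReal.ofReal (M.areaRadius u ^ 4 * truncate (n + 1) w (u, y) ^ 2)) Filter.atTop
          ∂M.leafMeasure u := by
        refine lintegral_congr fun y => (Filter.Tendsto.liminf_eq ?_).symm
        exact ENNReal.tendsto_ofReal (((tendsto_truncate (u, y)).pow 2).const_mul _)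
    _ ≤ Filter.liminf (fun n : ℕ => M.leafFour (truncate (n + 1) w) u) Filter.atTop :=
        lintegral_liminf_le hmeas
    _ ≤ Filter.liminf (fun _ : ℕ => ENNReal.ofReal (B ^ 2)) Filter.atTop :=
        Filter.liminf_le_liminf (Filter.Eventually.of_forall htr)
    _ = _ := by simp

end Rate

/-! ### Integrals over the cylinder -/

theorem volume_restrict_coord (M : FoliatedCylinder) :
    (volume : Measure Coord).restrict (M.J ×ˢ Set.univ) =
      (volume.restrict M.J).prod (volume : Measure E2) := by
  rw [Measure.volume_eq_prod, ← Measure.prod_restrict, Measure.restrict_univ]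

/-- Tonelli with the volume element `a du dμ` and `a ≥ a_m`. -/
theorem ofReal_mul_lintegral_leafEnergy_le (hc : Controlled M w N) {am : ℝ} (ham : 0 < am)
    (ha : ∀ u ∈ M.J, ∀ x, am ≤ M.a u x) :
    ENNReal.ofReal am * ∫⁻ u in M.J, M.leafEnergy w N u ≤
      M.integralSigma fun p => w p + M.areaRadius p.1 ^ 2 * N p ^ 2 := by
  have hr : ContinuousOn (fun p : Coord => M.areaRadius p.1) (M.J ×ˢ Set.univ) :=
    continuousOn_areaRadius.comp continuousOn_fst fun p hp => hp.1
  have hcont : ContinuousOn (fun p : Coord => (w p + M.areaRadius p.1 ^ 2 * N p ^ 2) *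
      M.volDensity p) (M.J ×ˢ Set.univ) := by
    refine (hc.contDiffOn.continuousOn.add ((hr.pow 2).mul (hc.continuousOn.pow 2))).mul ?_
    exact (contDiffOn_lapse.continuousOn.mul contDiffOn_areaDensity.continuousOn).congr
      fun p hp => volDensity_eq hp.1
  have hae := (hcont.aemeasurable (μ := volume)
    (M.isOpen_J.measurableSet.prod MeasurableSet.univ)).ennreal_ofReal
  rw [integralSigma, volume_restrict_coord, lintegral_prod _ (by rwa [← volume_restrict_coord]),
    ← lintegral_const_mul' _ _ ENNReal.ofReal_ne_top]
  refine setLIntegral_mono' M.isOpen_J.measurableSet fun u hu => ?_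
  rw [leafEnergy, lintegral_leafMeasure hu, ← lintegral_const_mul' _ _ ENNReal.ofReal_ne_top]
  refine lintegral_mono fun y => ?_
  have h0 : 0 ≤ w (u, y) + M.areaRadius u ^ 2 * N (u, y) ^ 2 :=
    add_nonneg (hc.nonneg (u, y) hu) (by positivity)
  rw [← ENNReal.ofReal_mul h0, ← ENNReal.ofReal_mul ham.le]
  refine ENNReal.ofReal_le_ofReal ?_
  rw [volDensity_eq (p := (u, y)) hu]
  have h1 := ha u hu (stereoS y)
  have h2 := areaDensity_pos hu y
  calc am * ((w (u, y) + M.areaRadius u ^ 2 * N (u, y) ^ 2) * M.areaDensity u y)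
      = (w (u, y) + M.areaRadius u ^ 2 * N (u, y) ^ 2) * (am * M.areaDensity u y) := by ring
    _ ≤ _ := by gcongr

/-- This half of Tonelli's theorem needs no measurability of `f`. -/
theorem integralSigma_le {f : Coord → ℝ} (hf : ∀ p : Coord, p.1 ∈ M.J → 0 ≤ f p) {aM : ℝ}
    (haM : ∀ u ∈ M.J, ∀ x, M.a u x ≤ aM) :
    M.integralSigma f ≤ ENNReal.ofReal aM *
      ∫⁻ u in M.J, ∫⁻ y, ENNReal.ofReal (f (u, y)) ∂M.leafMeasure u := by
  rw [integralSigma, volume_restrict_coord, ← lintegral_const_mul' _ _ ENNReal.ofReal_ne_top]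
  refine (lintegral_prod_le _).trans (setLIntegral_mono' M.isOpen_J.measurableSet fun u hu => ?_)
  rw [lintegral_leafMeasure hu, ← lintegral_const_mul' _ _ ENNReal.ofReal_ne_top]
  refine lintegral_mono fun y => ?_
  have haM0 : 0 ≤ aM := (M.a_pos _ hu (stereoS y)).le.trans (haM _ hu _)
  have h0 := hf (u, y) hu
  rw [← ENNReal.ofReal_mul h0, ← ENNReal.ofReal_mul haM0]
  refine ENNReal.ofReal_le_ofReal ?_
  rw [volDensity_eq (p := (u, y)) hu]
  have h1 := haM u hu (stereoS y)
  have h2 := areaDensity_pos hu y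
  calc f (u, y) * (M.a u (stereoS y) * M.areaDensity u y)
      ≤ f (u, y) * (aM * M.areaDensity u y) := by gcongr
    _ = _ := by ring

theorem controlled_normSq {k : ℕ} {θ : LeafTensor k} (hθ : θ.IsC1 M) :
    Controlled M (M.normSq θ) (θ.normDeriv M) where
  contDiffOn := contDiffOn_normSq hθ
  nonneg _ hp := normSq_nonneg hp
  continuousOn := continuousOn_normDeriv hθ
  deriv_nonneg _ _ := Real.sqrt_nonneg _
  pd_zero_le _ hp := sq_pd_zero_normSq_le hθ hp
  cof_le _ hp := cof_pd_normSq_le hθ hp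

end Controlled

theorem integralSigma_congr {f g : Coord → ℝ} (h : ∀ p : Coord, p.1 ∈ M.J → f p = g p) :
    M.integralSigma f = M.integralSigma g :=
  setLIntegral_congr_fun (M.isOpen_J.measurableSet.prod MeasurableSet.univ) fun p hp => by
    rw [h p hp.1]

end FoliatedCylinder

theorem rpow_inv_le_of_le_pow {x y : ℝ≥0∞} {n : ℕ} (hn : n ≠ 0) (h : x ≤ y ^ n) :
    x ^ (1 / (n : ℝ)) ≤ y := by
  have h1 := ENNReal.rpow_le_rpow h (by positivity : 0 ≤ 1 / (n : ℝ))
  rwa [← ENNReal.rpow_natCast, ← ENNReal.rpow_mul, mul_one_div_cancel (by positivity),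
    ENNReal.rpow_one] at h1

end FoliatedSobolev

end

/-! ### Constants and conclusion -/

namespace FoliatedSobolev
namespace FoliatedCylinder

/-- The scaled Sobolev inequalities, with an explicit constant. -/
theorem exists_sobolev_const (Λ I₀ h₀ : ℝ≥0) :
    ∃ C : ℝ≥0, ∀ (M : FoliatedSobolev.FoliatedCylinder) (a_m a_M : ℝ),
      0 < a_m →
      (∀ u ∈ M.J, ∀ x, a_m ≤ M.a u x ∧ M.a u x ≤ a_M) →
      a_M / a_m ≤ Λ →
      (∀ u ∈ M.J, M.isoConst u ≤ I₀) →
      (∀ u ∈ M.J, ∀ y, |M.areaRadius u * M.meanCurvature (u, y)| ≤ h₀) →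
      ∀ (k : ℕ) (θ : FoliatedSobolev.LeafTensor k), θ.IsC1 M →
        M.integralSigma (fun p => M.areaRadius p.1 ^ 6 * θ.norm M p ^ 6) ^ (1 / 6 : ℝ)
            ≤ C * θ.energy M ^ (1 / 2 : ℝ) ∧
        (⨆ u ∈ M.J,
          M.integralLeaf u (fun p => M.areaRadius p.1 ^ 4 * θ.norm M p ^ 4) ^ (1 / 4 : ℝ))
            ≤ C * θ.energy M ^ (1 / 2 : ℝ) := by
  set K := leafConst I₀ with hK
  -- `D E` bounds the total variation term `B` of `leafFour_le_sq`, so that `φ ≤ (D E)²`.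
  set D : ℝ≥0 := Λ * (3 * h₀ + 4) * (18 * K + 2) with hD
  -- The sum dominates `1`, `D` and the coefficient of the `L⁶` estimate. Being at least `1`, it
  -- dominates them also after it is raised to the powers `2` and `6`.
  refine ⟨1 + D + Λ * (18 * K + 1) * D ^ 2, fun M a_m a_M ham ha hΛ hI hH k θ hθ => ?_⟩
  set C : ℝ≥0 := 1 + D + Λ * (18 * K + 1) * D ^ 2 with hC
  have hC1 : 1 ≤ C := by rw [hC, add_assoc]; exact le_self_add
  have hC0 : (C : ℝ≥0∞) ≠ 0 := by
    rw [ENNReal.coe_ne_zero]; exact (zero_lt_one.trans_le hC1).ne'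
  have hDC : D ≤ C := by rw [hC]; exact le_add_self.trans le_self_add
  have hΛC : Λ * (18 * K + 1) * D ^ 2 ≤ C := le_add_self
  have haM : ∀ u ∈ M.J, ∀ x, M.a u x ≤ a_M := fun u hu x => (ha u hu x).2
  have hc := Controlled.controlled_normSq hθ
  set E := θ.energy M with hE
  have hEeq : E = M.integralSigma
      fun p => M.normSq θ p + M.areaRadius p.1 ^ 2 * θ.normDeriv M p ^ 2 :=
    integralSigma_congr fun p hp => by rw [norm_sq_eq hp]
  -- For infinite energy the right-hand side is infinite because `C ≠ 0`.
  by_cases hEt : E = ⊤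
  · rw [hEt, ENNReal.top_rpow_of_pos (by norm_num), ENNReal.mul_top hC0]
    exact ⟨le_top, le_top⟩
  set EJ := ∫⁻ u in M.J, M.leafEnergy (M.normSq θ) (θ.normDeriv M) u with hEJ
  have hEJE : ENNReal.ofReal a_m * EJ ≤ E := by
    rw [hEeq]
    exact hc.ofReal_mul_lintegral_leafEnergy_le ham fun u hu x => (ha u hu x).1
  have hEJt : EJ ≠ ⊤ := by
    intro h
    rw [h, ENNReal.mul_top (by simpa using ham)] at hEJE
    exact hEt (top_le_iff.1 hEJE)
  have haMΛ : ENNReal.ofReal a_M ≤ Λ * ENNReal.ofReal a_m := by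
    rw [div_le_iff₀ ham] at hΛ
    rw [← ENNReal.ofReal_coe_nnreal, ← ENNReal.ofReal_mul (by positivity)]
    exact ENNReal.ofReal_le_ofReal hΛ
  -- The upper bound of the lapse and the loss `1 / a_m` in the energy combine to the ratio, which
  -- is all that `C` may depend on.
  have haE : ENNReal.ofReal a_M * EJ ≤ Λ * E :=
    (mul_le_mul_left haMΛ _).trans (by rw [mul_assoc]; gcongr)
  have hκ : ENNReal.ofReal (a_M * (3 * h₀ + 4)) * (18 * leafConst I₀ + 2) * EJ ≤ D * E := by
    have h1 : ENNReal.ofReal (3 * (h₀ : ℝ) + 4) = (3 * h₀ + 4 : ℝ≥0) := by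
      rw [← ENNReal.ofReal_coe_nnreal]; push_cast; rfl
    rw [ENNReal.ofReal_mul' (by positivity), h1]
    calc ENNReal.ofReal a_M * (3 * h₀ + 4 : ℝ≥0) * (18 * K + 2) * EJ
        = (ENNReal.ofReal a_M * EJ) * ((3 * h₀ + 4 : ℝ≥0) * (18 * K + 2)) := by ring
      _ ≤ (Λ * E) * ((3 * h₀ + 4 : ℝ≥0) * (18 * K + 2)) := by gcongr
      _ = D * E := by rw [hD]; push_cast; ring
  have hfour (u : ℝ) (hu : u ∈ M.J) : M.leafFour (M.normSq θ) u ≤ (D * E) ^ 2 := by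
    have hDE : (D : ℝ≥0∞) * E ≠ ⊤ := ENNReal.mul_ne_top (by simp) hEt
    have h1 := hc.leafFour_le_sq haM hH hI hu (B := (D * E).toReal) ENNReal.toReal_nonneg hEJt
      (by rw [ENNReal.ofReal_toReal hDE]; exact hκ)
    rwa [ENNReal.ofReal_pow ENNReal.toReal_nonneg, ENNReal.ofReal_toReal hDE] at h1
  have hE2 : (E ^ (1 / 2 : ℝ)) ^ 2 = E := by
    rw [← ENNReal.rpow_natCast, ← ENNReal.rpow_mul]; norm_num
  have hC1' : (1 : ℝ≥0∞) ≤ C := by exact_mod_cast hC1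
  have hDC' : (D : ℝ≥0∞) ≤ C := by exact_mod_cast hDC
  constructor
  · have h6 : M.integralSigma (fun p => M.areaRadius p.1 ^ 6 * θ.norm M p ^ 6) ≤
        (C * E ^ (1 / 2 : ℝ)) ^ 6 := by
      rw [integralSigma_congr (g := fun p => M.areaRadius p.1 ^ 6 * M.normSq θ p ^ 3)
        fun p hp => by rw [← norm_sq_eq hp]; ring]
      calc _ ≤ ENNReal.ofReal a_M * ∫⁻ u in M.J, ∫⁻ y,
            ENNReal.ofReal (M.areaRadius u ^ 6 * M.normSq θ (u, y) ^ 3) ∂M.leafMeasure u :=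
            Controlled.integralSigma_le (fun p hp => by
              have := normSq_nonneg (θ := θ) hp
              positivity) haM
        -- `leafSix_le` on each leaf, with the uniform bound of `leafFour` taken out of the integral
        -- over `u`.
        _ ≤ ENNReal.ofReal a_M * ∫⁻ u in M.J, (18 * K + 1) * (D * E) ^ 2 *
            M.leafEnergy (M.normSq θ) (θ.normDeriv M) u := by
            refine mul_le_mul_right (setLIntegral_mono' M.isOpen_J.measurableSet fun u hu => ?_) _
            refine (hc.leafSix_le hu (hI u hu)).trans ?_
            gcongr
            exact hfour u hu
        _ = (18 * K + 1) * (D * E) ^ 2 * (ENNReal.ofReal a_M * EJ) := by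
            rw [lintegral_const_mul']
            · ring
            · exact ENNReal.mul_ne_top (by simp [ENNReal.mul_eq_top])
                (ENNReal.pow_ne_top (ENNReal.mul_ne_top (by simp) hEt))
        _ ≤ (18 * K + 1) * (D * E) ^ 2 * (Λ * E) := by gcongr
        _ = (Λ * (18 * K + 1) * D ^ 2 : ℝ≥0) * E ^ 3 := by push_cast; ring
        _ ≤ C ^ 6 * E ^ 3 := by
            gcongr
            refine le_trans (by exact_mod_cast hΛC) (le_self_pow₀ hC1' (by norm_num))
        _ = (C * E ^ (1 / 2 : ℝ)) ^ 6 := by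
            rw [mul_pow, show (E ^ (1 / 2 : ℝ)) ^ 6 = ((E ^ (1 / 2 : ℝ)) ^ 2) ^ 3 by ring, hE2]
    exact_mod_cast rpow_inv_le_of_le_pow (by norm_num) h6
  · refine iSup₂_le fun u hu => ?_
    have h4 : M.integralLeaf u (fun p => M.areaRadius p.1 ^ 4 * θ.norm M p ^ 4) ≤
        (C * E ^ (1 / 2 : ℝ)) ^ 4 := by
      have h5 : M.integralLeaf u (fun p => M.areaRadius p.1 ^ 4 * θ.norm M p ^ 4) =
          M.leafFour (M.normSq θ) u := by
        rw [integralLeaf_eq hu, leafFour]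
        refine lintegral_congr fun y => ?_
        rw [← norm_sq_eq (p := (u, y)) hu]
        congr 1
        ring
      rw [h5]
      refine (hfour u hu).trans ?_
      calc (D * E) ^ 2 ≤ (C ^ 2 * E) ^ 2 := by
            gcongr
            exact hDC'.trans (le_self_pow₀ hC1' (by norm_num))
        _ = (C * E ^ (1 / 2 : ℝ)) ^ 4 := by
            rw [mul_pow _ (E ^ (1 / 2 : ℝ)),
              show (E ^ (1 / 2 : ℝ)) ^ 4 = ((E ^ (1 / 2 : ℝ)) ^ 2) ^ 2 by ring, hE2]
            ring
    exact_mod_cast rpow_inv_le_of_le_pow (by norm_num) h4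

end FoliatedCylinder
end FoliatedSobolev

theorem mainTheorem7 (Λ I₀ h₀ : ℝ≥0) :
    ∃ C : ℝ≥0, ∀ (M : FoliatedSobolev.FoliatedCylinder) (a_m a_M : ℝ),
      0 < a_m →
      (∀ u ∈ M.J, ∀ x, a_m ≤ M.a u x ∧ M.a u x ≤ a_M) →
      a_M / a_m ≤ Λ →
      (∀ u ∈ M.J, M.isoConst u ≤ I₀) →
      (∀ u ∈ M.J, ∀ y, |M.areaRadius u * M.meanCurvature (u, y)| ≤ h₀) →
      ∀ (k : ℕ) (θ : FoliatedSobolev.LeafTensor k), θ.IsC1 M →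
        M.integralSigma (fun p => M.areaRadius p.1 ^ 6 * θ.norm M p ^ 6) ^ (1 / 6 : ℝ)
            ≤ C * θ.energy M ^ (1 / 2 : ℝ) ∧
        (⨆ u ∈ M.J,
          M.integralLeaf u (fun p => M.areaRadius p.1 ^ 4 * θ.norm M p ^ 4) ^ (1 / 4 : ℝ))
            ≤ C * θ.energy M ^ (1 / 2 : ℝ) :=
  FoliatedSobolev.FoliatedCylinder.exists_sobolev_const Λ I₀ h₀
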